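/- **Setting.** Let $\mathbb A$ be a countable structure over a finite relational vocabulary; its elements are called atoms. Fix an encoding of atoms by bit strings (a surjection $\{0,1\}^*\to\mathbb A$) and a numbering of the relation symbols. *Definable sets.* An expression is either a variable or a formal finite union (possibly empty) of set-builder expressions $\{e \mid a_1,\dots,a_n\in\mathbb A,\ \varphi\}$, where $e$ is an expression, $a_1,\dots,a_n$ are variables (bound in $e$ and $\varphi$) and $\varphi$ is a first-order formula over the vocabulary of $\mathbb A$. Under a valuation of its free variables in $\mathbb A$, an expression has a value, which is an atom or a (hereditary) set built over the atoms; such values are called definable. Tuples are encoded by iterated Kuratowski pairs. Automorphisms of $\mathbb A$ act on definable sets by renaming atoms hereditarily; for a set $S$ of atoms, an $S$-automorphism is an automorphism that fixes $S$ pointwise. *Definable structures.* A definable signature is a definable set $\Sigma$ partitioned into definable sets $\Sigma_1\uplus\dots\uplus\Sigma_l$ of symbols of arity $1,\dots,l$. A definable $\Sigma$-structure is a tuple $(A,I_1,\dots,I_l)$ of definable sets, where each $I_r$ is a set of tuples $(\sigma,a_1,\dots,a_r)$ with $\sigma\in\Sigma_r$ and $a_1,\dots,a_r\in A$. A definable isomorphism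 from $(A,I_1,\dots,I_l)$ to $(B,J_1,\dots,J_l)$ is a bijection $h:A\to B$ whose graph is a definable set and which satisfies $(\sigma,a_1,\dots,a_r)\in I_r \iff (\sigma,h(a_1),\dots,h(a_r))\in J_r$ for all $1\le r\le l$, $\sigma\in\Sigma_r$ and $a_1,\dots,a_r\in A$. *Assumptions on the atoms.* - $\mathbb A$ is *effectively $\omega$-categorical* if every countable structure satisfying the same first-order sentences as $\mathbb A$ is isomorphic to $\mathbb A$; it is decidable whether a given first-order formula holds in $\mathbb A$ under a given valuation of its free variables (atoms being given by their codes); and the function mapping $n\in\mathbb N$ to the (finite) number of orbits of the automorphism group of $\mathbb A$ on $\mathbb A^n$ is computable. - $\mathbb A$ is *dense* if for all finite sets $T\subseteq S\subseteq\mathbb A$ there is an elementary embedding $H:\mathbb A\to\mathbb A$ that fixes $T$ pointwise and is such that every automorphism of $H(\mathbb A)$ that fixes $T$ pointwise extends to an $S$-automorphism of $\mathbb A$. - $\mathbb A$ *has least supports* if for every definable $x$ there is a least (under inclusion) finite set $S\subseteq\mathbb A$ such that $\pi x=x$ for every $S$-automorphism $\pi$ of $\mathbb A$. **Theorem.** Let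 $\mathbb A$ be effectively $\omega$-categorical, dense, and have least supports. Then the definable isomorphism problem over $\mathbb A$ is decidable: there is an algorithm which, given expressions (together with codes of the atoms that are the values of their free variables) for sets $\Sigma_1,\dots,\Sigma_l$, $A,I_1,\dots,I_l$ and $B,J_1,\dots,J_l$, decides whether these form a definable signature $\Sigma$ and two definable $\Sigma$-structures between which there is a definable isomorphism. -/

import Mathlib

open FirstOrder

universe u v w

namespace DefinableSets

/-! ### First-order formulas and set-builder expressions as finite data

Variables are natural numbers, and the relation symbols of the (finite, relational) vocabulary of
the atoms are referred to by their indices.  Both types of expressions are put in bijection with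
`ℕ` by an explicit Gödel numbering; computability below is computability on these codes. -/

/-- First-order formulas, with named variables. -/
inductive Fm : Type
  | falsum : Fm
  | eq (x y : ℕ) : Fm
  | rel (i : ℕ) (xs : List ℕ) : Fm
  | imp (φ ψ : Fm) : Fm
  | all (x : ℕ) (φ : Fm) : Fm

namespace Fm

/-- The Gödel number of a formula. -/
def code : Fm → ℕ
  | falsum => 0
  | eq x y => 4 * Nat.pair x y + 1
  | rel i xs => 4 * Nat.pair i (Encodable.encode xs) + 2
  | imp φ ψ => 4 * Nat.pair (code φ) (code ψ) + 3
  | all x φ => 4 * Nat.pair x (code φ) + 4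

theorem unpair_lt (n c : ℕ) :
    (n / c).unpair.1 < n + 1 ∧ (n / c).unpair.2 < n + 1 := by
  have h : n / c < n + 1 := lt_of_le_of_lt (Nat.div_le_self _ _) (Nat.lt_succ_self _)
  exact ⟨lt_of_le_of_lt (Nat.unpair_left_le _) h, lt_of_le_of_lt (Nat.unpair_right_le _) h⟩

/-- The formula with a given Gödel number. -/
def ofCode : ℕ → Fm
  | 0 => falsum
  | n + 1 =>
    have _h1 := (unpair_lt n 4).1
    have _h2 := (unpair_lt n 4).2
    match n % 4 with
    | 0 => eq (n / 4).unpair.1 (n / 4).unpair.2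
    | 1 => rel (n / 4).unpair.1 (Denumerable.ofNat (List ℕ) (n / 4).unpair.2)
    | 2 => imp (ofCode (n / 4).unpair.1) (ofCode (n / 4).unpair.2)
    | _ => all (n / 4).unpair.1 (ofCode (n / 4).unpair.2)

theorem ofCode_code (φ : Fm) : ofCode (code φ) = φ := by
  induction φ with
  | falsum => simp [code, ofCode]
  | eq x y =>
    have h1 : (4 * Nat.pair x y) % 4 = 0 := by omega
    have h2 : (4 * Nat.pair x y) / 4 = Nat.pair x y := by omega
    simp only [code]
    rw [ofCode, h1, h2]
    simp
  | rel i xs =>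
    have h1 : (4 * Nat.pair i (Encodable.encode xs) + 1) % 4 = 1 := by omega
    have h2 : (4 * Nat.pair i (Encodable.encode xs) + 1) / 4
        = Nat.pair i (Encodable.encode xs) := by omega
    simp only [code]
    rw [ofCode, h1, h2]
    simp
  | imp φ ψ ih1 ih2 =>
    have h1 : (4 * Nat.pair (code φ) (code ψ) + 2) % 4 = 2 := by omega
    have h2 : (4 * Nat.pair (code φ) (code ψ) + 2) / 4 = Nat.pair (code φ) (code ψ) := by omega
    simp only [code]
    rw [ofCode, h1, h2]
    simp [ih1, ih2]
  | all x φ ih =>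
    have h1 : (4 * Nat.pair x (code φ) + 3) % 4 = 3 := by omega
    have h2 : (4 * Nat.pair x (code φ) + 3) / 4 = Nat.pair x (code φ) := by omega
    simp only [code]
    rw [ofCode, h1, h2]
    simp [ih]

theorem code_ofCode (n : ℕ) : code (ofCode n) = n := by
  induction n using Nat.strong_induction_on with
  | _ n ih =>
    cases n with
    | zero => simp [code, ofCode]
    | succ n =>
      have h1 := ih _ (unpair_lt n 4).1
      have h2 := ih _ (unpair_lt n 4).2
      have h4 : n % 4 = 0 ∨ n % 4 = 1 ∨ n % 4 = 2 ∨ n % 4 = 3 := by omega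
      rw [ofCode]
      rcases h4 with h | h | h | h <;> rw [h] <;>
        simp only [code, h1, h2, Denumerable.encode_ofNat, Nat.pair_unpair] <;> omega

instance : Denumerable Fm :=
  Denumerable.mk' ⟨code, ofCode, ofCode_code, code_ofCode⟩

end Fm

/-- Formal finite unions of set-builder expressions `{e | a₁, …, aₙ ∈ 𝔸, φ}`:
`empty` is the empty union, `consVar x as φ r` is `{x | as ∈ 𝔸, φ} ∪ r` with a variable `x`, and
`consSet e as φ r` is `{e | as ∈ 𝔸, φ} ∪ r` with a formal union `e`.  (An expression is
a variable or such a formal union.) -/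
inductive SetExpr : Type
  | empty : SetExpr
  | consVar (x : ℕ) (as : List ℕ) (φ : Fm) (r : SetExpr) : SetExpr
  | consSet (e : SetExpr) (as : List ℕ) (φ : Fm) (r : SetExpr) : SetExpr

namespace SetExpr

/-- The Gödel number of a formal union. -/
def code : SetExpr → ℕ
  | empty => 0
  | consVar x as φ r =>
    2 * Nat.pair (Nat.pair x (code r)) (Nat.pair (Encodable.encode as) (Encodable.encode φ)) + 1
  | consSet e as φ r =>
    2 * Nat.pair (Nat.pair (code e) (code r))
      (Nat.pair (Encodable.encode as) (Encodable.encode φ)) + 2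

theorem unpair_lt (n : ℕ) :
    (n / 2).unpair.1.unpair.1 < n + 1 ∧ (n / 2).unpair.1.unpair.2 < n + 1 := by
  have h := (Fm.unpair_lt n 2).1
  exact ⟨lt_of_le_of_lt (Nat.unpair_left_le _) h, lt_of_le_of_lt (Nat.unpair_right_le _) h⟩

/-- The formal union with a given Gödel number. -/
def ofCode : ℕ → SetExpr
  | 0 => empty
  | n + 1 =>
    have _h1 := (unpair_lt n).1
    have _h2 := (unpair_lt n).2
    match n % 2 with
    | 0 =>
      consVar (n / 2).unpair.1.unpair.1
        (Denumerable.ofNat (List ℕ) (n / 2).unpair.2.unpair.1)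
        (Denumerable.ofNat Fm (n / 2).unpair.2.unpair.2)
        (ofCode (n / 2).unpair.1.unpair.2)
    | _ =>
      consSet (ofCode (n / 2).unpair.1.unpair.1)
        (Denumerable.ofNat (List ℕ) (n / 2).unpair.2.unpair.1)
        (Denumerable.ofNat Fm (n / 2).unpair.2.unpair.2)
        (ofCode (n / 2).unpair.1.unpair.2)

theorem ofCode_code (e : SetExpr) : ofCode (code e) = e := by
  induction e with
  | empty => simp [code, ofCode]
  | consVar x as φ r ih =>
    simp only [code]
    generalize hm : Nat.pair (Nat.pair x (code r))
      (Nat.pair (Encodable.encode as) (Encodable.encode φ)) = m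
    have h1 : (2 * m) % 2 = 0 := by omega
    have h2 : (2 * m) / 2 = m := by omega
    rw [ofCode, h1, h2, ← hm]
    simp [ih]
  | consSet e as φ r ih1 ih2 =>
    simp only [code]
    generalize hm : Nat.pair (Nat.pair (code e) (code r))
      (Nat.pair (Encodable.encode as) (Encodable.encode φ)) = m
    have h1 : (2 * m + 1) % 2 = 1 := by omega
    have h2 : (2 * m + 1) / 2 = m := by omega
    rw [ofCode, h1, h2, ← hm]
    simp [ih1, ih2]

theorem code_ofCode (n : ℕ) : code (ofCode n) = n := by
  induction n using Nat.strong_induction_on with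
  | _ n ih =>
    cases n with
    | zero => simp [code, ofCode]
    | succ n =>
      have h1 := ih _ (unpair_lt n).1
      have h2 := ih _ (unpair_lt n).2
      have h4 : n % 2 = 0 ∨ n % 2 = 1 := by omega
      rw [ofCode]
      rcases h4 with h | h <;> rw [h] <;>
        simp only [code, h1, h2, Denumerable.encode_ofNat, Nat.pair_unpair] <;> omega

instance : Denumerable SetExpr :=
  Denumerable.mk' ⟨code, ofCode, ofCode_code, code_ofCode⟩

end SetExpr

/-! ### Sets with atoms -/

/-- Well-founded trees with leaves labelled by atoms, presenting sets with atoms. -/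
inductive PreHSet (A : Type u) : Type (u + 1)
  | atom (a : A) : PreHSet A
  | set (ι : Type u) (f : ι → PreHSet A) : PreHSet A

namespace PreHSet

variable {A : Type u}

/-- Extensional equality. -/
def Equiv : PreHSet A → PreHSet A → Prop
  | atom a, atom b => a = b
  | set _ f, set _ g => (∀ i, ∃ j, Equiv (f i) (g j)) ∧ (∀ j, ∃ i, Equiv (f i) (g j))
  | atom _, set _ _ => False
  | set _ _, atom _ => False

theorem Equiv.refl (x : PreHSet A) : Equiv x x := by
  induction x with
  | atom a => simp [Equiv]
  | set ι f ih => exact ⟨fun i => ⟨i, ih i⟩, fun i => ⟨i, ih i⟩⟩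

theorem Equiv.symm {x y : PreHSet A} (h : Equiv x y) : Equiv y x := by
  induction x generalizing y with
  | atom a =>
    cases y with
    | atom b => simpa [Equiv] using Eq.symm h
    | set κ g => exact h.elim
  | set ι f ih =>
    cases y with
    | atom b => exact h.elim
    | set κ g =>
      exact ⟨fun j => (h.2 j).imp fun i hi => ih i hi, fun i => (h.1 i).imp fun j hj => ih i hj⟩

theorem Equiv.trans {x y z : PreHSet A} (h : Equiv x y) (h' : Equiv y z) : Equiv x z := by
  induction x generalizing y z with
  | atom a =>
    cases y with
    | atom b =>
      cases z with
      | atom c => exact Eq.trans h h'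
      | set μ k => exact h'.elim
    | set κ g => exact h.elim
  | set ι f ih =>
    cases y with
    | atom b => exact h.elim
    | set κ g =>
      cases z with
      | atom c => exact h'.elim
      | set μ k =>
        refine ⟨fun i => ?_, fun l => ?_⟩
        · obtain ⟨j, hj⟩ := h.1 i
          obtain ⟨l, hl⟩ := h'.1 j
          exact ⟨l, ih i hj hl⟩
        · obtain ⟨j, hj⟩ := h'.2 l
          obtain ⟨i, hi⟩ := h.2 j
          exact ⟨i, ih i hi hj⟩

instance setoid (A : Type u) : Setoid (PreHSet A) :=
  ⟨Equiv, Equiv.refl, Equiv.symm, Equiv.trans⟩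

/-- The index type of the elements (an atom has no elements). -/
def Idx : PreHSet A → Type u
  | atom _ => PEmpty
  | set ι _ => ι

/-- The family of elements. -/
def elem : (x : PreHSet A) → x.Idx → PreHSet A
  | atom _ => fun i => i.elim
  | set _ f => f

/-- Membership, up to extensional equality. -/
def Mem (x y : PreHSet A) : Prop := ∃ i, Equiv x (y.elem i)

theorem Mem.congr {x x' y y' : PreHSet A} (hx : Equiv x x') (hy : Equiv y y') :
    Mem x y → Mem x' y' := by
  rintro ⟨i, hi⟩
  cases y with
  | atom a => exact i.elim
  | set ι f =>
    cases y' with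
    | atom b => exact hy.elim
    | set κ g =>
      obtain ⟨j, hj⟩ := hy.1 i
      exact ⟨j, hx.symm.trans (Equiv.trans hi hj)⟩

/-- Renaming of all atoms along a function. -/
def map (f : A → A) : PreHSet A → PreHSet A
  | atom a => atom (f a)
  | set ι g => set ι fun i => map f (g i)

theorem map_congr (f : A → A) {x y : PreHSet A} (h : Equiv x y) :
    Equiv (map f x) (map f y) := by
  induction x generalizing y with
  | atom a =>
    cases y with
    | atom b => exact congrArg f h
    | set κ g => exact h.elim
  | set ι g ih =>
    cases y with
    | atom b => exact h.elim
    | set κ k =>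
      exact ⟨fun i => (h.1 i).imp fun j hj => ih i hj, fun j => (h.2 j).imp fun i hi => ih i hi⟩

end PreHSet

/-- The universe of sets with atoms (including the atoms themselves): its members are atoms, and
sets of members, with extensional equality between sets. -/
def HSet (A : Type u) : Type (u + 1) := Quotient (PreHSet.setoid A)

namespace HSet

variable {A : Type u}

/-- An atom, as an object of the universe. -/
def atom (a : A) : HSet A := Quotient.mk _ (PreHSet.atom a)

/-- Membership. -/
def Mem (y x : HSet A) : Prop :=
  Quotient.liftOn₂ x y PreHSet.Mem fun _ _ _ _ h1 h2 =>
    propext ⟨PreHSet.Mem.congr h1 h2,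
      PreHSet.Mem.congr (PreHSet.Equiv.symm h1) (PreHSet.Equiv.symm h2)⟩

instance : Membership (HSet A) (HSet A) := ⟨Mem⟩

/-- The set `{f i | i}`. -/
noncomputable def range {ι : Type u} (f : ι → HSet A) : HSet A :=
  Quotient.mk _ (PreHSet.set ι fun i => (f i).out)

/-- The unordered pair `{x, y}`. -/
noncomputable def upair (x y : HSet A) : HSet A :=
  range fun b : ULift.{u} Bool => if b.down then x else y

/-- The Kuratowski pair `(x, y) = {{x, y}, {x}}`. -/
noncomputable def pair (x y : HSet A) : HSet A := upair (upair x y) (upair x x)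

/-- The tuple `(x, y₁, …, yᵣ)`, as an iterated pair `(x, (y₁, (…, yᵣ)))`. -/
noncomputable def tuple (x : HSet A) : List (HSet A) → HSet A
  | [] => x
  | y :: ys => pair x (tuple y ys)

/-- The natural action on sets with atoms: `rename π x` is `x` with every atom `a` replaced by
`π a`, hereditarily. -/
def rename (π : A → A) (x : HSet A) : HSet A :=
  Quotient.map (PreHSet.map π) (fun _ _ h => PreHSet.map_congr π h) x

end HSet

/-! ### Semantics -/

section Semantics

variable (L : FirstOrder.Language.{v, w}) (A : Type u) [L.Structure A]

/-- A numbering of the relation symbols of the vocabulary by `0, …, k - 1`. -/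
abbrev SymbolNumbering (k : ℕ) := Fin k ≃ Σ n, L.Relations n

variable {L A} {k : ℕ} (s : SymbolNumbering L k)

/-- Satisfaction of a formula under a valuation.  (An ill-formed atomic formula, with a wrong index
or a wrong number of arguments, is false.) -/
def Fm.Holds : Fm → (ℕ → A) → Prop
  | falsum, _ => False
  | eq x y, val => val x = val y
  | rel i xs, val => ∃ (hi : i < k) (hn : xs.length = (s ⟨i, hi⟩).1),
      FirstOrder.Language.Structure.RelMap (s ⟨i, hi⟩).2 fun j => val (xs.get (j.cast hn.symm))
  | imp φ ψ, val => Fm.Holds φ val → Fm.Holds ψ val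
  | all x φ, val => ∀ a : A, Fm.Holds φ (Function.update val x a)

/-- The valuations over which a set-builder expression with bound variables `as` and guard `φ`
ranges, in the context of the valuation `val`. -/
abbrev Valuations (as : List ℕ) (φ : Fm) (val : ℕ → A) : Type u :=
  {val' : ℕ → A // (∀ x, x ∉ as → val' x = val x) ∧ φ.Holds s val'}

/-- The tree presenting the value of a formal union. -/
def SetExpr.preEval : SetExpr → (ℕ → A) → PreHSet A
  | empty, _ => PreHSet.set PEmpty fun i => i.elim
  | consVar x as φ r, val =>
    PreHSet.set (Valuations s as φ val ⊕ (SetExpr.preEval r val).Idx)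
      (Sum.elim (fun val' => PreHSet.atom (val'.1 x)) (SetExpr.preEval r val).elem)
  | consSet e as φ r, val =>
    PreHSet.set (Valuations s as φ val ⊕ (SetExpr.preEval r val).Idx)
      (Sum.elim (fun val' => SetExpr.preEval e val'.1) (SetExpr.preEval r val).elem)

/-- The value of a formal union under a valuation. -/
def SetExpr.eval (e : SetExpr) (val : ℕ → A) : HSet A := Quotient.mk _ (e.preEval s val)

/-- `x` is a definable set or an atom: the value of an expression (a variable, or a formal union)
under some valuation. -/
def IsDefinable (x : HSet A) : Prop :=
  ∃ val : ℕ → A, (∃ i, x = HSet.atom (val i)) ∨ ∃ e : SetExpr, x = e.eval s val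

end Semantics

/-! ### Assumptions on the atoms -/

/-- The valuation given by a list of codes of atoms: variable `i` has the `i`-th atom of the list as
its value (and the variables beyond the list have the atom with the empty code). -/
def valuation {A : Type u} (enc : List Bool → A) (p : List (List Bool)) (i : ℕ) : A :=
  enc (p.getD i [])

section Assumptions

variable (L : FirstOrder.Language.{v, w}) (A : Type u) [L.Structure A]

/-- `ω`-categoricity: every countable structure that satisfies the same sentences is isomorphic. -/
def IsOmegaCategorical : Prop :=
  ∀ (B : Type) [L.Structure B] [Countable B], A ≅[L] B → Nonempty (A ≃[L] B)

/-- Two `n`-tuples of atoms are in the same orbit of the automorphism group. -/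
def orbitSetoid (n : ℕ) : Setoid (Fin n → A) where
  r a b := ∃ π : A ≃[L] A, ∀ i, π (a i) = b i
  iseqv :=
    { refl := fun a => ⟨FirstOrder.Language.Equiv.refl L A, fun _ => rfl⟩
      symm := by
        rintro a b ⟨π, h⟩
        exact ⟨π.symm, fun i => by rw [← h i]; simp⟩
      trans := by
        rintro a b c ⟨π, h⟩ ⟨ρ, h'⟩
        exact ⟨ρ.comp π, fun i => by rw [FirstOrder.Language.Equiv.comp_apply, h i, h' i]⟩ }

/-- Effective `ω`-categoricity, with respect to a numbering `s` of the vocabulary and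
an encoding `enc` of the atoms by bit strings: `ω`-categorical, satisfaction of formulas under
valuations is decidable, and the function mapping `n` to the (finite) number of orbits of
`n`-tuples is computable. -/
structure IsEffectivelyOmegaCategorical {k : ℕ} (s : SymbolNumbering L k) (enc : List Bool → A) :
    Prop where
  categorical : IsOmegaCategorical L A
  decidable : ComputablePred fun q : Fm × List (List Bool) => q.1.Holds s (valuation enc q.2)
  computable : ∃ r : ℕ → ℕ, Computable r ∧
    ∀ n, ENat.card (Quotient (orbitSetoid L A n)) = (r n : ℕ∞)

/-- Denseness: for all finite sets `T ⊆ S` of atoms there is a self-embedding `H` (an elementary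
embedding of the atoms into themselves) that fixes `T` pointwise and is such that every
automorphism of `H(A)` that fixes `T` pointwise extends to an automorphism of the atoms that fixes
`S` pointwise. -/
def IsDense : Prop :=
  ∀ T S : Finset A, T ⊆ S → ∃ H : A ↪ₑ[L] A, (∀ t ∈ T, H t = t) ∧
    ∀ σ : H.toHom.range ≃[L] H.toHom.range, (∀ x : H.toHom.range, (x : A) ∈ T → σ x = x) →
      ∃ π : A ≃[L] A, (∀ a ∈ S, π a = a) ∧ ∀ x : H.toHom.range, π x = σ x

/-- The finite set `S` of atoms supports `x`. -/
def Supports {A : Type u} [L.Structure A] (S : Finset A) (x : HSet A) : Prop :=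
  ∀ π : A ≃[L] A, (∀ a ∈ S, π a = a) → x.rename π = x

/-- Every definable set has a least support. -/
def HasLeastSupports {k : ℕ} (s : SymbolNumbering L k) : Prop :=
  ∀ x : HSet A, IsDefinable s x →
    ∃ S : Finset A, Supports L S x ∧ ∀ S' : Finset A, Supports L S' x → S ⊆ S'

end Assumptions

/-! ### The definable isomorphism problem -/

section Problem

variable {A : Type u}

/-- `Σ₁, …, Σₗ` are pairwise disjoint, i.e. they are the parts of a signature
partitioned by arity; the entry of index `i` consists of the symbols of arity `i + 1`. -/
def IsSignature (sig : List (HSet A)) : Prop :=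
  sig.Pairwise fun P Q => ∀ x, x ∈ P → x ∉ Q

/-- The tuple `(D, I₁, …, Iₗ)` is a structure with universe `D` over the signature: every `Iᵣ` is
a set of tuples `(σ, x₁, …, xᵣ)` with `σ ∈ Σᵣ` and `x₁, …, xᵣ ∈ D`. -/
def IsStructure (sig : List (HSet A)) (D : HSet A) (I : List (HSet A)) : Prop :=
  I.length = sig.length ∧
  ∀ i P R, sig[i]? = some P → I[i]? = some R → ∀ z ∈ R,
    ∃ σ ∈ P, ∃ xs : List (HSet A), xs.length = i + 1 ∧ (∀ x ∈ xs, x ∈ D) ∧ z = HSet.tuple σ xs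

/-- `G` is the graph of a bijection from `D` to `E`. -/
def IsBijection (D E G : HSet A) : Prop :=
  (∀ z ∈ G, ∃ x ∈ D, ∃ y ∈ E, z = HSet.pair x y) ∧
  (∀ x ∈ D, ∃! y, HSet.pair x y ∈ G) ∧
  (∀ y ∈ E, ∃! x, HSet.pair x y ∈ G)

/-- `G` is the graph of an isomorphism from `(D, I₁, …, Iₗ)` to `(E, J₁, …, Jₗ)`: a bijection
that preserves and reflects every relation of the signature. -/
def IsIsomorphism (sig : List (HSet A)) (D : HSet A) (I : List (HSet A)) (E : HSet A)
    (J : List (HSet A)) (G : HSet A) : Prop :=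
  IsBijection D E G ∧
  ∀ i P R R', sig[i]? = some P → I[i]? = some R → J[i]? = some R' →
    ∀ σ ∈ P, ∀ xs ys : List (HSet A), xs.length = i + 1 → (∀ x ∈ xs, x ∈ D) →
      List.Forall₂ (fun x y => HSet.pair x y ∈ G) xs ys →
        (HSet.tuple σ xs ∈ R ↔ HSet.tuple σ ys ∈ R')

/-- Finite presentations of inputs: the list of the codes of the parameters, the expressions
of `Σ₁, …, Σₗ`, the expressions of the universe and the relations of the first structure, and those
of the second one.  The parameters (a common valuation of the free variables of all the
expressions) are listed once. -/
abbrev Input : Type :=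
  List (List Bool) × List SetExpr × (SetExpr × List SetExpr) × (SetExpr × List SetExpr)

variable {L : FirstOrder.Language.{v, w}} [L.Structure A] {k : ℕ}

/-- The input consists of a definable signature and two definable structures over it. -/
def Input.IsValid (s : SymbolNumbering L k) (enc : List Bool → A) : Input → Prop
  | (p, sg, (d, is), (e, js)) =>
    let ev := fun t : SetExpr => t.eval s (valuation enc p)
    IsSignature (sg.map ev) ∧ IsStructure (sg.map ev) (ev d) (is.map ev) ∧
      IsStructure (sg.map ev) (ev e) (js.map ev)

/-- There is a definable isomorphism between the two structures. -/
def Input.DefinablyIsomorphic (s : SymbolNumbering L k) (enc : List Bool → A) : Input → Prop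
  | (p, sg, (d, is), (e, js)) =>
    let ev := fun t : SetExpr => t.eval s (valuation enc p)
    ∃ G : HSet A, IsDefinable s G ∧
      IsIsomorphism (sg.map ev) (ev d) (is.map ev) (ev e) (js.map ev) G

end Problem

end DefinableSets

/-!
# The definable isomorphism problem is decidable

*Eliminating parameters.*  The heart of the matter is that an isomorphism between two structures
that are supported by a finite set `T` of atoms, if it is definable at all, can be chosen to be
invariant under the group `G` of all automorphisms fixing `T` (`exists_invariant_relIso`).  View
an isomorphism with support `S` as an involution `f` of the disjoint union `X` of the two universes.
Denseness yields an injection `H` of the atoms, locally given by elements of `G`, such that on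
its image every element of `G` acts like an element fixing `S` (`exists_isGeneric`); since least
supports exist, `H` extends to an injection of `X` (`SupportSystem.push`), whose image is the copy
of `X` in general position with respect to `S`.  If `f` preserves the least supports of all
elements in general position, then it maps this copy to itself, and its pullback along `H` is
an equivariant map that agrees on finite sets with conjugates of `f`; so it is an invariant
isomorphism.  Otherwise let `x` be an element with a largest support at which this fails, and let
`f₂` be the conjugate of `f` along `H`.  Some alternating composition `f₂ ∘ f ∘ f₂ ∘ ⋯ ∘ f₂`, which
is an isomorphism again, preserves the support of the copy of `x` (`exists_zigzag_good`): else the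
iterates of `f ∘ f₂` would wander through a finite set without returning to the start, although
`f ∘ f₂` is injective.  Nothing is lost elsewhere (`Good.zigzag`), so that finitely many such steps
reach the first case, as there are finitely many orbits (`SupportSystem.exists_equivariant`).

*A formula for the problem.*  By `ω`-categoricity, more precisely by the finiteness of the numbers
of orbits, every orbit of `N`-tuples is defined by a formula (`exists_isolating` and
`SameType.exists_equiv`), so every invariant relation between two definable sets is the union of
some of finitely many relations cut out by such formulas (`exists_mem_subs_pieces`).  Membership
and inclusion of values of expressions are expressed by first-order formulas over the atoms
(`holds_cmp`), and so is the statement that one of these finitely many unions is an isomorphism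
(`holds_problemFm`).

*Decidability.*  All these formulas are primitive recursive in the input (`primrec_problemFm`) and
in formulas that define the orbits of `N`-tuples.  The latter are found by search: as many pairwise
disjoint satisfiable formulas as there are orbits define the orbits
(`definesOrbits_of_partition`), and the number of orbits and the truth of sentences are computable.
-/

namespace DefinableSets

/-! ### Eliminating the parameters of an isomorphism -/

section ParameterElimination

variable {G α X : Type*} [Group G] [MulAction G α] [MulAction G X]

variable (G) in
/-- An injection `H` of the atoms that is locally given by elements of `G`, and whose image is in
general position with respect to `S`: on this image, every element of `G` acts like an element
fixing `S`.  This is what denseness provides. -/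
structure IsGeneric (S : Finset α) (H : α → α) : Prop where
  inj : Function.Injective H
  loc : ∀ U : Finset α, ∃ g : G, ∀ a ∈ U, g • a = H a
  equi : ∀ τ : G, ∃ ρ : G, (∀ a ∈ S, ρ • a = a) ∧ ∀ a, ρ • H a = H (τ • a)

/-- The map `f` commutes with the pointwise stabilizer of `S`. -/
def SupportsMap (G : Type*) {α X : Type*} [Group G] [MulAction G α] [MulAction G X]
    (S : Finset α) (f : X → X) : Prop :=
  ∀ g : G, (∀ a ∈ S, g • a = a) → ∀ x, f (g • x) = g • f x

theorem SupportsMap.mono {S S' : Finset α} (h : S ⊆ S') {f : X → X} (hf : SupportsMap G S f) :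
    SupportsMap G S' f :=
  fun g hg => hf g fun a ha => hg a (h ha)

theorem SupportsMap.comp {S : Finset α} {f f' : X → X} (hf : SupportsMap G S f)
    (hf' : SupportsMap G S f') : SupportsMap G S (f ∘ f') :=
  fun g hg x => by simp [hf' g hg, hf g hg]

/-- The alternating composition `a ∘ b ∘ a ∘ ⋯ ∘ a` of length `2 * k + 1`. -/
def zigzag (a b : X → X) (k : ℕ) : X → X := a ∘ (b ∘ a)^[k]

theorem zigzag_mem {𝓟 : Set (X → X)} (hpal : ∀ a ∈ 𝓟, ∀ b ∈ 𝓟, a ∘ b ∘ a ∈ 𝓟) {a b : X → X}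
    (ha : a ∈ 𝓟) (hb : b ∈ 𝓟) : ∀ k, zigzag a b k ∈ 𝓟
  | 0 => ha
  | 1 => hpal a ha b hb
  | k + 2 => by
    have := hpal a ha _ (hpal b hb _ (zigzag_mem hpal ha hb k))
    convert this using 1
    funext x
    simp only [zigzag, Function.comp_apply, Function.iterate_succ_apply' _ (k + 1),
      Function.iterate_succ_apply _ k]

theorem SupportsMap.zigzag {S : Finset α} {a b : X → X} (ha : SupportsMap G S a)
    (hb : SupportsMap G S b) (k : ℕ) : SupportsMap G S (zigzag a b k) := by
  refine ha.comp ?_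
  induction k with
  | zero => exact fun g _ x => rfl
  | succ k ih => rw [Function.iterate_succ]; exact ih.comp (hb.comp ha)

variable [DecidableEq α]

variable (G α X) in
/-- A `G`-set `X` all of whose elements have a least finite support in `α`, equivariantly, and which
has only finitely many orbits under the pointwise stabilizer of any finite subset of `α`. -/
structure SupportSystem where
  /-- The least support. -/
  supp : X → Finset α
  smul_eq_of_fix : ∀ (g : G) x, (∀ a ∈ supp x, g • a = a) → g • x = x
  supp_smul : ∀ (g : G) x, supp (g • x) = (supp x).image fun a => g • a
  supp_subset : ∀ (S : Finset α) x, (∀ g : G, (∀ a ∈ S, g • a = a) → g • x = x) → supp x ⊆ S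
  finite_orbits : ∀ S : Finset α, ∃ (K : Type) (_ : Finite K) (κ : X → K), ∀ x y, κ x = κ y →
    ∃ g : G, (∀ a ∈ S, g • a = a) ∧ g • x = y

/-- If `H` is generic over `S`, then `H ∘ H` is generic over `S ∪ H(S)`. -/
theorem IsGeneric.comp_self {S : Finset α} {H : α → α} (hH : IsGeneric G S H) :
    IsGeneric G (S ∪ S.image H) (H ∘ H) where
  inj := hH.inj.comp hH.inj
  loc U := by
    obtain ⟨g, hg⟩ := hH.loc U
    obtain ⟨g', hg'⟩ := hH.loc (U.image H)
    refine ⟨g' * g, fun a ha => ?_⟩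
    rw [mul_smul, hg a ha, hg' _ (Finset.mem_image_of_mem _ ha)]; rfl
  equi τ := by
    obtain ⟨ρ, h1, h2⟩ := hH.equi τ
    obtain ⟨ρ', h1', h2'⟩ := hH.equi ρ
    refine ⟨ρ', fun a ha => ?_, fun a => ?_⟩
    · rcases Finset.mem_union.1 ha with ha | ha
      · exact h1' a ha
      · obtain ⟨b, hb, rfl⟩ := Finset.mem_image.1 ha
        rw [h2', h1 b hb]
    · simp [h2', h2]

namespace SupportSystem

variable (D : SupportSystem G α X) {S : Finset α} {H : α → α}

theorem smul_eq_smul {g g' : G} {x : X} (h : ∀ a ∈ D.supp x, g • a = g' • a) :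
    g • x = g' • x := by
  have := D.smul_eq_of_fix (g'⁻¹ * g) x fun a ha => by rw [mul_smul, h a ha, inv_smul_smul]
  rw [mul_smul, inv_smul_eq_iff] at this
  exact this

theorem card_supp_smul (g : G) (x : X) : (D.supp (g • x)).card = (D.supp x).card := by
  rw [D.supp_smul, Finset.card_image_of_injective _ (MulAction.injective g)]

/-- The extension of a generic injection from the atoms to the elements of `X`. -/
noncomputable def push (hH : IsGeneric G S H) (x : X) : X :=
  Classical.choose (hH.loc (D.supp x)) • x

theorem push_eq (hH : IsGeneric G S H) {g : G} {x : X} (h : ∀ a ∈ D.supp x, g • a = H a) :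
    D.push hH x = g • x :=
  D.smul_eq_smul fun a ha => by rw [Classical.choose_spec (hH.loc (D.supp x)) a ha, h a ha]

theorem exists_push_eq (hH : IsGeneric G S H) (x : X) : ∃ g : G, D.push hH x = g • x :=
  ⟨_, rfl⟩

theorem supp_push (hH : IsGeneric G S H) (x : X) : D.supp (D.push hH x) = (D.supp x).image H := by
  obtain ⟨g, hg⟩ := hH.loc (D.supp x)
  rw [D.push_eq hH hg, D.supp_smul]
  exact Finset.image_congr fun a ha => hg a ha

theorem card_supp_push (hH : IsGeneric G S H) (x : X) :
    (D.supp (D.push hH x)).card = (D.supp x).card := by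
  rw [D.supp_push, Finset.card_image_of_injective _ hH.inj]

theorem push_injective (hH : IsGeneric G S H) : Function.Injective (D.push hH) := by
  intro x y h
  obtain ⟨g, hg⟩ := hH.loc (D.supp x ∪ D.supp y)
  rw [D.push_eq hH fun a ha => hg a (Finset.mem_union_left _ ha),
    D.push_eq hH fun a ha => hg a (Finset.mem_union_right _ ha)] at h
  exact MulAction.injective g h

/-- Every element whose support consists of atoms in the image of `H` is in the image of the
extension of `H`. -/
theorem exists_push (hH : IsGeneric G S H) {z : X} (hz : ∀ a ∈ D.supp z, a ∈ Set.range H) :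
    ∃ y, D.push hH y = z := by
  choose! k hk using hz
  obtain ⟨g, hg⟩ := hH.loc ((D.supp z).image k)
  refine ⟨g⁻¹ • z, ?_⟩
  rw [D.push_eq hH (g := g), smul_inv_smul]
  intro a ha
  rw [D.supp_smul] at ha
  obtain ⟨b, hb, rfl⟩ := Finset.mem_image.1 ha
  have := hg (k b) (Finset.mem_image_of_mem _ hb)
  rw [hk b hb] at this
  change g • g⁻¹ • b = H (g⁻¹ • b)
  rw [smul_inv_smul, ← this, inv_smul_smul, this, hk b hb]

theorem push_smul (hH : IsGeneric G S H) {τ ρ : G} (h : ∀ a, ρ • H a = H (τ • a)) (x : X) :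
    D.push hH (τ • x) = ρ • D.push hH x := by
  obtain ⟨g, hg⟩ := hH.loc (D.supp (τ • x))
  obtain ⟨g', hg'⟩ := hH.loc (D.supp x)
  rw [D.push_eq hH hg, D.push_eq hH hg', ← mul_smul, ← mul_smul]
  refine D.smul_eq_smul fun a ha => ?_
  rw [mul_smul, mul_smul, hg' a ha, h, hg]
  rw [D.supp_smul]
  exact Finset.mem_image_of_mem _ ha

theorem push_comp_self (hH : IsGeneric G S H) (x : X) :
    D.push hH.comp_self x = D.push hH (D.push hH x) := by
  obtain ⟨g, hg⟩ := hH.loc (D.supp x)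
  obtain ⟨g', hg'⟩ := hH.loc (D.supp (D.push hH x))
  rw [D.push_eq hH hg', D.push_eq hH hg, ← mul_smul]
  refine D.push_eq _ fun a ha => ?_
  rw [mul_smul, hg a ha, hg' _ (by rw [D.supp_push]; exact Finset.mem_image_of_mem _ ha)]
  rfl

/-- Elements in general position have supports disjoint from `S`: an atom of `S` in the image of
`H` is fixed by `G`, hence is in no least support. -/
theorem disjoint_supp_push (hH : IsGeneric G S H) (x : X) :
    Disjoint (D.supp (D.push hH x)) S := by
  rw [Finset.disjoint_left]
  intro h hx hS
  rw [D.supp_push] at hx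
  obtain ⟨a, ha, rfl⟩ := Finset.mem_image.1 hx
  have hfix : ∀ τ : G, τ • a = a := fun τ => by
    obtain ⟨ρ, h1, h2⟩ := hH.equi τ
    apply hH.inj
    rw [← h2, h1 _ hS]
  have := D.supp_subset ((D.supp x).erase a) x fun g hg => D.smul_eq_of_fix g x fun b hb => by
    by_cases hba : b = a
    · rw [hba, hfix]
    · exact hg b (Finset.mem_erase.2 ⟨hba, hb⟩)
  exact Finset.notMem_erase a _ (this ha)

theorem supp_map_subset {f : X → X} (hf : SupportsMap G S f) (x : X) :
    D.supp (f x) ⊆ D.supp x ∪ S :=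
  D.supp_subset _ _ fun g hg => by
    rw [← hf g fun a ha => hg a (Finset.mem_union_right _ ha),
      D.smul_eq_of_fix g x fun a ha => hg a (Finset.mem_union_left _ ha)]

/-- The involution `f` preserves the least support of the copy of `x` in general position.  If this
holds for all `x`, then `f` maps the copy of `X` in general position to itself, and can be pulled
back to an equivariant map on `X`. -/
def Good (f : X → X) (hH : IsGeneric G S H) (x : X) : Prop :=
  D.supp (f (D.push hH x)) = D.supp (D.push hH x)

theorem Good.smul {f : X → X} (hf : SupportsMap G S f) {hH : IsGeneric G S H} {x : X}
    (h : D.Good f hH x) (τ : G) : D.Good f hH (τ • x) := by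
  obtain ⟨ρ, h1, h2⟩ := hH.equi τ
  unfold Good at *
  rw [D.push_smul hH h2, hf ρ h1, D.supp_smul, D.supp_smul, h]

theorem good_smul_iff {f : X → X} (hf : SupportsMap G S f) {hH : IsGeneric G S H} {x : X} (τ : G) :
    D.Good f hH (τ • x) ↔ D.Good f hH x :=
  ⟨fun h => by simpa using Good.smul D hf h τ⁻¹, fun h => Good.smul D hf h τ⟩

/-- A good element is mapped to an element in general position, which is good as well. -/
theorem Good.exists_map {f : X → X} (hinv : Function.Involutive f) {hH : IsGeneric G S H} {x : X}
    (h : D.Good f hH x) : ∃ y, D.push hH y = f (D.push hH x) ∧ D.Good f hH y := by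
  obtain ⟨y, hy⟩ := D.exists_push hH (z := f (D.push hH x)) (by
    intro a ha
    rw [h, D.supp_push] at ha
    obtain ⟨b, -, rfl⟩ := Finset.mem_image.1 ha
    exact ⟨b, rfl⟩)
  refine ⟨y, hy, ?_⟩
  unfold Good
  rw [hy, hinv, h]

theorem finite_supported (U : Finset α) : {x : X | D.supp x ⊆ U}.Finite := by
  obtain ⟨K, _, κ, hκ⟩ := D.finite_orbits U
  refine Set.Finite.of_finite_image (f := κ) (Set.toFinite _) ?_
  intro x hx y hy h
  obtain ⟨g, hg, rfl⟩ := hκ x y h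
  exact (D.smul_eq_of_fix g x fun a ha => hg a (hx ha)).symm

theorem finite_quotient (D : SupportSystem G α X) : Finite (MulAction.orbitRel.Quotient G X) := by
  obtain ⟨K, _, κ, hκ⟩ := D.finite_orbits ∅
  refine Finite.of_injective (fun q => κ (Quotient.out q)) fun q q' h => ?_
  obtain ⟨g, -, hg⟩ := hκ _ _ h
  rw [← Quotient.out_eq q, ← Quotient.out_eq q']
  exact Quotient.sound ((MulAction.orbitRel G X).symm ⟨g, hg⟩)

theorem exists_card_supp_le : ∃ N, ∀ x : X, (D.supp x).card ≤ N := by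
  have := D.finite_quotient
  obtain ⟨N, hN⟩ := (Set.finite_range fun q : MulAction.orbitRel.Quotient G X =>
    (D.supp (Quotient.out q)).card).bddAbove
  refine ⟨N, fun x => ?_⟩
  obtain ⟨g, hg⟩ := MulAction.orbitRel_apply.1
    (Quotient.mk_out (s := MulAction.orbitRel G X) x)
  have h := hN ⟨Quotient.mk _ x, rfl⟩
  simp only at hg h
  rw [← hg, D.card_supp_smul] at h
  exact h

/-- The `G`-orbits of elements that are not good. -/
def badOrbits (f : X → X) (hH : IsGeneric G S H) : Set (MulAction.orbitRel.Quotient G X) :=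
  {q | ∃ x, Quotient.mk _ x = q ∧ ¬ D.Good f hH x}

theorem mk_mem_badOrbits {f : X → X} (hf : SupportsMap G S f) (hH : IsGeneric G S H) (x : X) :
    (Quotient.mk _ x : MulAction.orbitRel.Quotient G X) ∈ D.badOrbits f hH ↔
      ¬ D.Good f hH x := by
  refine ⟨?_, fun h => ⟨x, rfl, h⟩⟩
  rintro ⟨y, hy, hb⟩ hg
  obtain ⟨g, rfl⟩ := MulAction.orbitRel_apply.1 (Quotient.exact hy)
  exact hb (Good.smul D hf hg g)

/-- A conjugate of `f`, by an element of `G` that acts as `H` on a support of `f`, is the image of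
`f` under `H`. -/
theorem conj_push {f : X → X} (hf : SupportsMap G S f) (hH : IsGeneric G S H) {π : G}
    (hπ : ∀ a ∈ S, π • a = H a) (x : X) :
    π • f (π⁻¹ • D.push hH x) = D.push hH (f x) := by
  obtain ⟨g, hg⟩ := hH.loc (S ∪ D.supp x ∪ D.supp (f x))
  rw [D.push_eq hH (x := f x) fun a ha => hg a (Finset.mem_union_right _ ha),
    D.push_eq hH (x := x) fun a ha =>
      hg a (Finset.mem_union_left _ (Finset.mem_union_right _ ha)), ← mul_smul, hf, mul_smul,
    smul_inv_smul]
  intro a ha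
  rw [mul_smul, hg a (Finset.mem_union_left _ (Finset.mem_union_left _ ha)), ← hπ a ha,
    inv_smul_smul]

theorem supportsMap_conj {f : X → X} (hf : SupportsMap G S f) {π : G}
    (hπ : ∀ a ∈ S, π • a = H a) :
    SupportsMap G (S.image H) fun x => π • f (π⁻¹ • x) := by
  intro g hg x
  have h : π⁻¹ • g • x = (π⁻¹ * g * π) • π⁻¹ • x := by simp [mul_smul]
  simp only
  rw [h, hf, mul_smul, mul_smul, smul_inv_smul]
  intro a ha
  rw [mul_smul, mul_smul, hπ a ha, hg _ (Finset.mem_image_of_mem _ ha), ← hπ a ha, inv_smul_smul]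

/-- If all elements with a support larger than that of `x` are good for `f`, then some zigzag
between `f` and its generic conjugate `f₂` is good at `x`: otherwise the elements visited by
the zigzag, which are supported by a common finite set, would never return to their start. -/
theorem exists_zigzag_good {f f₂ : X → X} (hinv : Function.Involutive f)
    (hf₂ : SupportsMap G (S.image H) f₂) (hinv₂ : Function.Involutive f₂)
    (hH : IsGeneric G S H) {x : X}
    (hmax : ∀ z, (D.supp x).card < (D.supp z).card → D.Good f hH z) :
    ∃ k, D.Good (zigzag f₂ f k) hH.comp_self x := by
  by_contra! hno
  set x₀ := D.push hH.comp_self x with hx₀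
  have hdisj : Disjoint (D.supp x₀) (S.image H) :=
    (D.disjoint_supp_push hH.comp_self x).mono_right Finset.subset_union_right
  have hcard : (D.supp x₀).card = (D.supp x).card := D.card_supp_push _ _
  have hrange : ∀ a ∈ D.supp x₀ ∪ S.image H, a ∈ Set.range H := by
    intro a ha
    rcases Finset.mem_union.1 ha with ha | ha
    · rw [hx₀, D.supp_push] at ha
      obtain ⟨b, -, rfl⟩ := Finset.mem_image.1 ha
      exact ⟨H b, rfl⟩
    · obtain ⟨b, -, rfl⟩ := Finset.mem_image.1 ha
      exact ⟨b, rfl⟩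
  -- If no zigzag is good at `x`, then the orbit of `x₀` under `f ∘ f₂` stays among the finitely
  -- many elements supported by `D.supp x₀ ∪ S.image H`, but never comes back to the support of `x₀`.
  have key : ∀ k, D.supp x₀ ⊆ D.supp ((f ∘ f₂)^[k] x₀) ∧
      D.supp ((f ∘ f₂)^[k] x₀) ⊆ D.supp x₀ ∪ S.image H ∧
      (0 < k → D.supp ((f ∘ f₂)^[k] x₀) ≠ D.supp x₀) := by
    intro k
    induction k with
    | zero => simp [Finset.subset_union_left]
    | succ k ih =>
      obtain ⟨h1, h2, -⟩ := ih
      set y := f₂ ((f ∘ f₂)^[k] x₀) with hy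
      have hy1 : D.supp y ⊆ D.supp x₀ ∪ S.image H :=
        (D.supp_map_subset hf₂ _).trans (Finset.union_subset h2 Finset.subset_union_right)
      have hy2 : D.supp x₀ ⊆ D.supp y := by
        intro a ha
        have h3 := D.supp_map_subset hf₂ y
        rw [hy, hinv₂] at h3
        rcases Finset.mem_union.1 (h3 (h1 ha)) with h | h
        · exact h
        · exact absurd h (Finset.disjoint_left.1 hdisj ha)
      have hy3 : D.supp y ≠ D.supp x₀ := fun h => hno k h
      have hlt : (D.supp x).card < (D.supp y).card := by
        rw [← hcard]
        exact Finset.card_lt_card (lt_of_le_of_ne hy2 hy3.symm)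
      obtain ⟨z, hz⟩ := D.exists_push hH (z := y) fun a ha => hrange a (hy1 ha)
      have hgood : D.supp (f y) = D.supp y := by
        have := hmax z (by rwa [← D.card_supp_push hH z, hz])
        rwa [Good, hz] at this
      rw [Function.iterate_succ_apply']
      change _ ⊆ D.supp (f y) ∧ D.supp (f y) ⊆ _ ∧ (_ → D.supp (f y) ≠ _)
      rw [hgood]
      exact ⟨hy2, hy1, fun _ => hy3⟩
  have hinj : Function.Injective (f ∘ f₂) := hinv.injective.comp hinv₂.injective
  obtain ⟨m, n, hmn, heq⟩ : ∃ m n, m < n ∧ (f ∘ f₂)^[m] x₀ = (f ∘ f₂)^[n] x₀ := by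
    have hfin := D.finite_supported (D.supp x₀ ∪ S.image H)
    obtain ⟨m, -, n, -, hne, heq⟩ := Set.infinite_univ.exists_ne_map_eq_of_mapsTo
      (f := fun k : ℕ => (f ∘ f₂)^[k] x₀) (fun k _ => (key k).2.1) hfin
    rcases lt_or_gt_of_ne hne with h | h
    · exact ⟨m, n, h, heq⟩
    · exact ⟨n, m, h, heq.symm⟩
  obtain ⟨d, rfl⟩ := Nat.exists_eq_add_of_lt hmn
  rw [Nat.add_assoc, Function.iterate_add_apply] at heq
  exact (key (d + 1)).2.2 (Nat.succ_pos d) (congrArg D.supp (hinj.iterate m heq)).symm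

/-- Good elements stay good when `f` is replaced by a zigzag between `f` and its generic
conjugate. -/
theorem Good.zigzag {f f₂ : X → X} (hinv : Function.Involutive f) {hH : IsGeneric G S H}
    (hf : SupportsMap G S f) (hpush : ∀ x, f₂ (D.push hH x) = D.push hH (f x)) {x : X}
    (hx : D.Good f hH x) (k : ℕ) : D.Good (zigzag f₂ f k) hH.comp_self x := by
  have hgood : ∀ z, D.Good f hH z → D.Good f hH (D.push hH z) := fun z hz => by
    obtain ⟨g, hg⟩ := D.exists_push_eq hH z
    rw [hg]; exact Good.smul D hf hz g
  have step₂ : ∀ z, D.Good f hH z → ∃ z', D.Good f hH z' ∧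
      f₂ (D.push hH.comp_self z) = D.push hH.comp_self z' ∧
      D.supp (D.push hH.comp_self z') = D.supp (D.push hH.comp_self z) := by
    intro z hz
    obtain ⟨z', h1, h2⟩ := Good.exists_map D hinv hz
    refine ⟨z', h2, ?_, ?_⟩
    · rw [D.push_comp_self, D.push_comp_self, hpush, h1]
    · rw [D.push_comp_self hH, D.push_comp_self hH, D.supp_push hH, D.supp_push hH (D.push hH z),
        h1, hz]
  have step : ∀ z, D.Good f hH z → ∃ z', D.Good f hH z' ∧
      f (D.push hH.comp_self z) = D.push hH.comp_self z' ∧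
      D.supp (D.push hH.comp_self z') = D.supp (D.push hH.comp_self z) := by
    intro z hz
    have h1 : D.supp (f (D.push hH (D.push hH z))) = D.supp (D.push hH (D.push hH z)) := hgood z hz
    obtain ⟨z', hz'⟩ := D.exists_push hH.comp_self (z := f (D.push hH.comp_self z)) (by
      intro a ha
      rw [D.push_comp_self hH, h1, ← D.push_comp_self hH, D.supp_push] at ha
      obtain ⟨b, -, rfl⟩ := Finset.mem_image.1 ha
      exact ⟨b, rfl⟩)
    refine ⟨z', ?_, hz'.symm, by rw [hz', D.push_comp_self, h1]⟩
    have h2 : D.Good f hH (D.push hH z') := by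
      unfold Good
      rw [← D.push_comp_self, hz', hinv, D.push_comp_self, h1]
    obtain ⟨g, hg⟩ := D.exists_push_eq hH z'
    rwa [hg, D.good_smul_iff hf] at h2
  have main : ∀ k, ∃ z', D.Good f hH z' ∧
      (f ∘ f₂)^[k] (D.push hH.comp_self x) = D.push hH.comp_self z' ∧
      D.supp (D.push hH.comp_self z') = D.supp (D.push hH.comp_self x) := by
    intro k
    induction k with
    | zero => exact ⟨x, hx, rfl, rfl⟩
    | succ k ih =>
      obtain ⟨z, h1, h2, h3⟩ := ih
      obtain ⟨z₁, h1', h2', h3'⟩ := step₂ z h1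
      obtain ⟨z₂, h1'', h2'', h3''⟩ := step z₁ h1'
      refine ⟨z₂, h1'', ?_, by rw [h3'', h3', h3]⟩
      rw [Function.iterate_succ_apply', h2, Function.comp_apply, h2', h2'']
  obtain ⟨z, h1, h2, h3⟩ := main k
  obtain ⟨z', h1', h2', h3'⟩ := step₂ z h1
  change D.supp (f₂ ((f ∘ f₂)^[k] (D.push hH.comp_self x))) = _
  rw [h2, h2', h3', h3]

/-- The number of orbits that are not good can be decreased. -/
theorem exists_badOrbits_ssubset {𝓟 : Set (X → X)} (hinv : ∀ f ∈ 𝓟, Function.Involutive f)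
    (hconj : ∀ f ∈ 𝓟, ∀ g : G, (fun x => g • f (g⁻¹ • x)) ∈ 𝓟)
    (hpal : ∀ a ∈ 𝓟, ∀ b ∈ 𝓟, a ∘ b ∘ a ∈ 𝓟) {f : X → X} (hf𝓟 : f ∈ 𝓟)
    (hf : SupportsMap G S f) (hH : IsGeneric G S H) (hbad : ∃ x, ¬ D.Good f hH x) :
    ∃ f' ∈ 𝓟, ∃ (S' : Finset α) (H' : α → α) (hH' : IsGeneric G S' H'), SupportsMap G S' f' ∧
      D.badOrbits f' hH' ⊂ D.badOrbits f hH := by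
  -- A bad element with a support of the greatest size.
  obtain ⟨x, hx, hmax⟩ : ∃ x, ¬ D.Good f hH x ∧
      ∀ z, (D.supp x).card < (D.supp z).card → D.Good f hH z := by
    obtain ⟨N, hN⟩ := D.exists_card_supp_le
    by_contra! hno
    have : ∀ n, ∃ x, ¬ D.Good f hH x ∧ n ≤ (D.supp x).card := by
      intro n
      induction n with
      | zero => exact hbad.imp fun x hx => ⟨hx, Nat.zero_le _⟩
      | succ n ih =>
        obtain ⟨x, h1, h2⟩ := ih
        obtain ⟨z, h3, h4⟩ := hno x h1
        exact ⟨z, h4, by omega⟩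
    obtain ⟨x, -, h⟩ := this (N + 1)
    exact absurd (hN x) (by omega)
  obtain ⟨π, hπ⟩ := hH.loc S
  set f₂ : X → X := fun x => π • f (π⁻¹ • x)
  have hf₂ : SupportsMap G (S.image H) f₂ := supportsMap_conj hf hπ
  obtain ⟨k, hk⟩ := D.exists_zigzag_good (hinv f hf𝓟) hf₂ (hinv _ (hconj f hf𝓟 π)) hH hmax
  have hz : SupportsMap G (S ∪ S.image H) (zigzag f₂ f k) :=
    (hf₂.mono Finset.subset_union_right).zigzag (hf.mono Finset.subset_union_left) k
  refine ⟨zigzag f₂ f k, zigzag_mem hpal (hconj f hf𝓟 π) hf𝓟 k, _, _, hH.comp_self, hz, ?_, ?_⟩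
  · rintro q ⟨z, rfl, hb⟩
    exact ⟨z, rfl, fun hg => hb
      (Good.zigzag D (hinv f hf𝓟) hf (D.conj_push hf hH hπ) hg k)⟩
  · intro hsub
    have := hsub ((D.mk_mem_badOrbits hf hH x).2 hx)
    exact (D.mk_mem_badOrbits hz hH.comp_self x).1 this hk

/-- Parameter elimination: a finitely supported involution in a family `𝓟` that is closed under
conjugation and palindromic composition gives rise to a `G`-equivariant map that coincides with
members of `𝓟` on all finite sets. -/
theorem exists_equivariant (D : SupportSystem G α X)
    (hdense : ∀ S : Finset α, ∃ H, IsGeneric G S H) {𝓟 : Set (X → X)}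
    (hinv : ∀ f ∈ 𝓟, Function.Involutive f)
    (hconj : ∀ f ∈ 𝓟, ∀ g : G, (fun x => g • f (g⁻¹ • x)) ∈ 𝓟)
    (hpal : ∀ a ∈ 𝓟, ∀ b ∈ 𝓟, a ∘ b ∘ a ∈ 𝓟) {f : X → X} (hf𝓟 : f ∈ 𝓟)
    (hf : SupportsMap G S f) :
    ∃ g : X → X, (∀ (τ : G) x, g (τ • x) = τ • g x) ∧
      ∀ F : Set X, F.Finite → ∃ f' ∈ 𝓟, ∀ x ∈ F, g x = f' x := by
  have hall : ∀ n, ∀ f ∈ 𝓟, ∀ (S : Finset α) (H : α → α) (hH : IsGeneric G S H),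
      SupportsMap G S f → (D.badOrbits f hH).ncard = n →
      ∃ f ∈ 𝓟, ∃ (S : Finset α) (H : α → α) (hH : IsGeneric G S H), SupportsMap G S f ∧
        ∀ x, D.Good f hH x := by
    intro n
    induction n using Nat.strong_induction_on with
    | _ n ih =>
      intro f hf𝓟 S H hH hf hn
      by_cases hbad : ∃ x, ¬ D.Good f hH x
      · obtain ⟨f', hf'𝓟, S', H', hH', hf', hss⟩ :=
          D.exists_badOrbits_ssubset hinv hconj hpal hf𝓟 hf hH hbad
        have := D.finite_quotient
        exact ih _ (hn ▸ Set.ncard_lt_ncard hss (Set.toFinite _)) f' hf'𝓟 S' H' hH' hf' rfl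
      · exact ⟨f, hf𝓟, S, H, hH, hf, by simpa using hbad⟩
  obtain ⟨H, hH⟩ := hdense S
  obtain ⟨f, hf𝓟, S, H, hH, hf, hgood⟩ := hall _ f hf𝓟 S H hH hf rfl
  -- `g` is the restriction of `f` to the copy of `X` in general position, pulled back along `H`.
  choose g hg _ using fun x => Good.exists_map D (hinv f hf𝓟) (hgood x)
  refine ⟨g, fun τ x => ?_, fun F hF => ?_⟩
  · obtain ⟨ρ, h1, h2⟩ := hH.equi τ
    apply D.push_injective hH
    rw [hg, D.push_smul hH h2, hf ρ h1, D.push_smul hH h2, hg]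
  · obtain ⟨π, hπ⟩ := hH.loc (hF.toFinset.biUnion fun x => D.supp x ∪ D.supp (g x))
    refine ⟨_, hconj f hf𝓟 π⁻¹, fun x hx => ?_⟩
    have h : ∀ a ∈ D.supp x ∪ D.supp (g x), π • a = H a := fun a ha =>
      hπ a (Finset.mem_biUnion.2 ⟨x, hF.mem_toFinset.2 hx, ha⟩)
    have h1 := hg x
    rw [D.push_eq hH fun a ha => h a (Finset.mem_union_left _ ha),
      D.push_eq hH fun a ha => h a (Finset.mem_union_right _ ha)] at h1
    simp only [inv_inv]
    rw [← h1, inv_smul_smul]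

end SupportSystem

end ParameterElimination

/-! ### First-order formulas over the atoms -/

namespace Fm

/-- Negation. -/
def not (φ : Fm) : Fm := imp φ falsum

/-- Conjunction. -/
def and (φ ψ : Fm) : Fm := not (imp φ (not ψ))

/-- Finite conjunctions. -/
def conj (l : List Fm) : Fm := l.foldr and (not falsum)

/-- Finite disjunctions. -/
def disj (l : List Fm) : Fm := not (conj (l.map not))

/-- Universal quantification over a list of variables. -/
def alls (xs : List ℕ) (φ : Fm) : Fm := xs.foldr all φ

/-- Existential quantification over a list of variables. -/
def exs (xs : List ℕ) (φ : Fm) : Fm := not (alls xs (not φ))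

end Fm

theorem encode_lt_encode_of_mem {α : Type*} [Encodable α] {x : α} {xs : List α} (h : x ∈ xs) :
    Encodable.encode x < Encodable.encode xs := by
  induction xs with
  | nil => simp at h
  | cons y ys ih =>
    rw [Encodable.encode_list_cons, Nat.lt_succ_iff]
    rcases List.mem_cons.1 h with rfl | h
    · exact Nat.left_le_pair _ _
    · exact (ih h).le.trans (Nat.right_le_pair _ _)

section Satisfaction

variable {L : FirstOrder.Language.{v, w}} {A : Type u} [L.Structure A] {k : ℕ}
  (s : SymbolNumbering L k)

namespace Fm

@[simp] theorem holds_falsum (v : ℕ → A) : falsum.Holds s v ↔ False := Iff.rfl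

@[simp] theorem holds_imp (φ ψ : Fm) (v : ℕ → A) :
    (imp φ ψ).Holds s v ↔ (φ.Holds s v → ψ.Holds s v) := Iff.rfl

@[simp] theorem holds_all (x : ℕ) (φ : Fm) (v : ℕ → A) :
    (all x φ).Holds s v ↔ ∀ a, φ.Holds s (Function.update v x a) := Iff.rfl

@[simp] theorem holds_not (φ : Fm) (v : ℕ → A) : (not φ).Holds s v ↔ ¬ φ.Holds s v := Iff.rfl

@[simp] theorem holds_and (φ ψ : Fm) (v : ℕ → A) :
    (and φ ψ).Holds s v ↔ φ.Holds s v ∧ ψ.Holds s v := by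
  simp [and]

@[simp] theorem holds_conj (l : List Fm) (v : ℕ → A) :
    (conj l).Holds s v ↔ ∀ φ ∈ l, φ.Holds s v := by
  induction l with
  | nil => simp [conj]
  | cons φ l ih => simpa [conj] using fun _ => ih

@[simp] theorem holds_disj (l : List Fm) (v : ℕ → A) :
    (disj l).Holds s v ↔ ∃ φ ∈ l, φ.Holds s v := by
  simp [disj]

@[simp] theorem holds_alls (xs : List ℕ) (φ : Fm) (v : ℕ → A) :
    (alls xs φ).Holds s v ↔ ∀ v' : ℕ → A, (∀ x, x ∉ xs → v' x = v x) → φ.Holds s v' := by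
  induction xs generalizing v with
  | nil =>
    simp only [alls, List.foldr_nil, List.not_mem_nil, not_false_eq_true, forall_const]
    exact ⟨fun h v' hv => by rwa [funext hv], fun h => h v fun _ => rfl⟩
  | cons y xs ih =>
    change (∀ a, (alls xs φ).Holds s (Function.update v y a)) ↔ _
    simp only [ih]
    constructor
    · intro h v' hv
      refine h (v' y) v' fun x hx => ?_
      by_cases hxy : x = y
      · simp [hxy]
      · rw [Function.update_of_ne hxy]
        exact hv x (by simp [hxy, hx])
    · intro h a v' hv
      refine h v' fun x hx => ?_
      rw [List.mem_cons, not_or] at hx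
      rw [hv x hx.2, Function.update_of_ne hx.1]

@[simp] theorem holds_exs (xs : List ℕ) (φ : Fm) (v : ℕ → A) :
    (exs xs φ).Holds s v ↔ ∃ v' : ℕ → A, (∀ x, x ∉ xs → v' x = v x) ∧ φ.Holds s v' := by
  simp [exs]

/-- Satisfaction depends on the variables up to the Gödel number only. -/
theorem holds_congr_code (φ : Fm) {v v' : ℕ → A} (h : ∀ x ≤ φ.code, v x = v' x) :
    φ.Holds s v ↔ φ.Holds s v' := by
  induction φ generalizing v v' with
  | falsum => rfl
  | eq x y =>
    have h1 := Nat.left_le_pair x y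
    have h2 := Nat.right_le_pair x y
    simp only [code] at h
    simp only [Holds]
    rw [h x (by omega), h y (by omega)]
  | rel i xs =>
    have h1 := Nat.right_le_pair i (Encodable.encode xs)
    simp only [code] at h
    simp only [Holds]
    have : ∀ x ∈ xs, v x = v' x := fun x hx => h x (by 
      have : x < _ := encode_lt_encode_of_mem hx
      omega)
    refine exists_congr fun hi => exists_congr fun hn => ?_
    simp only [this _ (List.get_mem _ _)]
  | imp φ ψ ih1 ih2 =>
    have h1 := Nat.left_le_pair (code φ) (code ψ)
    have h2 := Nat.right_le_pair (code φ) (code ψ)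
    simp only [code] at h
    rw [holds_imp, holds_imp, ih1 fun x hx => h x (by omega), ih2 fun x hx => h x (by omega)]
  | all y φ ih =>
    have h2 := Nat.right_le_pair y (code φ)
    simp only [code] at h
    rw [holds_all, holds_all]
    refine forall_congr' fun a => ih fun x hx => ?_
    by_cases hxy : x = y
    · simp [hxy]
    · rw [Function.update_of_ne hxy, Function.update_of_ne hxy, h x (by omega)]

/-- Satisfaction is invariant under automorphisms. -/
theorem holds_equiv (π : A ≃[L] A) (φ : Fm) (v : ℕ → A) :
    φ.Holds s (π ∘ v) ↔ φ.Holds s v := by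
  induction φ generalizing v with
  | falsum => rfl
  | eq x y => simp [Holds]
  | rel i xs =>
    simp only [Holds]
    refine exists_congr fun hi => exists_congr fun hn => ?_
    exact π.map_rel (s ⟨i, hi⟩).2 _
  | imp φ ψ ih1 ih2 => rw [holds_imp, holds_imp, ih1, ih2]
  | all x φ ih =>
    rw [holds_all, holds_all]
    refine ⟨fun h a => ?_, fun h a => ?_⟩
    · have := h (π a)
      rwa [← Function.comp_update, ih] at this
    · have := h (π.symm a)
      rwa [← ih, Function.comp_update, FirstOrder.Language.Equiv.apply_symm_apply] at this

/-- Every formula is equivalent to a formula of Mathlib's syntax. -/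
theorem exists_formula (φ : Fm) : ∃ ψ : L.Formula ℕ, ∀ v : ℕ → A, ψ.Realize v ↔ φ.Holds s v := by
  induction φ with
  | falsum => exact ⟨⊥, fun v => Iff.rfl⟩
  | eq x y =>
    exact ⟨(FirstOrder.Language.Term.var x).equal (FirstOrder.Language.Term.var y),
      fun v => by simp [Holds, FirstOrder.Language.Formula.realize_equal]⟩
  | rel i xs =>
    by_cases h : ∃ hi : i < k, xs.length = (s ⟨i, hi⟩).1
    · obtain ⟨hi, hn⟩ := h
      refine ⟨(s ⟨i, hi⟩).2.formula fun j =>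
        FirstOrder.Language.Term.var (xs.get (j.cast hn.symm)), fun v => ?_⟩
      rw [FirstOrder.Language.Formula.realize_rel]
      exact ⟨fun h => ⟨hi, hn, h⟩, fun ⟨_, _, h⟩ => h⟩
    · refine ⟨⊥, fun v => ⟨fun h => h.elim, fun ⟨hi, hn, _⟩ => absurd ⟨hi, hn⟩ h⟩⟩
  | imp φ ψ ih1 ih2 =>
    obtain ⟨φ', h1⟩ := ih1
    obtain ⟨ψ', h2⟩ := ih2
    exact ⟨φ'.imp ψ', fun v => by rw [FirstOrder.Language.Formula.realize_imp, h1, h2, holds_imp]⟩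
  | all x φ ih =>
    obtain ⟨φ', h⟩ := ih
    refine ⟨(FirstOrder.Language.BoundedFormula.relabel (n := 1)
      (fun y => if y = x then Sum.inr 0 else Sum.inl y) φ').all, fun v => ?_⟩
    rw [FirstOrder.Language.Formula.Realize, FirstOrder.Language.BoundedFormula.realize_all,
      holds_all]
    refine forall_congr' fun a => ?_
    rw [← h, FirstOrder.Language.BoundedFormula.realize_relabel,
      FirstOrder.Language.Formula.Realize]
    have : ((Sum.elim v (Fin.snoc (default : Fin 0 → A) a ∘ Fin.castAdd 0) ∘
        fun y => if y = x then Sum.inr 0 else Sum.inl y) : ℕ → A) = Function.update v x a := by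
      funext y
      by_cases hy : y = x
      · subst hy; simp [Fin.snoc]
      · simp [hy]
    rw [← this]
    exact iff_of_eq (congrArg₂ _ rfl (Subsingleton.elim _ _))

/-- Satisfaction is invariant under elementary embeddings. -/
theorem holds_elementaryEmbedding (H : A ↪ₑ[L] A) (φ : Fm) (v : ℕ → A) :
    φ.Holds s (H ∘ v) ↔ φ.Holds s v := by
  obtain ⟨ψ, hψ⟩ := φ.exists_formula s (A := A)
  rw [← hψ, ← hψ, H.map_formula]

end Fm

/-- The formula `φ` depends on the variables below `n` only. -/
def DependsBelow (A : Type u) [L.Structure A] (n : ℕ) (φ : Fm) : Prop :=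
  ∀ v w : ℕ → A, (∀ x < n, v x = w x) → (φ.Holds s v ↔ φ.Holds s w)

/-- The first `n` values of `v` and `w` have the same first-order type. -/
def SameType (n : ℕ) (v w : ℕ → A) : Prop :=
  ∀ φ, DependsBelow s A n φ → (φ.Holds s v ↔ φ.Holds s w)

variable {s}

theorem DependsBelow.not {n : ℕ} {φ : Fm} (h : DependsBelow s A n φ) :
    DependsBelow s A n φ.not := fun v w hvw => not_congr (h v w hvw)

theorem DependsBelow.conj {n : ℕ} {l : List Fm} (h : ∀ φ ∈ l, DependsBelow s A n φ) :
    DependsBelow s A n (Fm.conj l) := fun v w hvw => by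
  rw [Fm.holds_conj, Fm.holds_conj]
  exact forall₂_congr fun φ hφ => h φ hφ v w hvw

theorem SameType.symm {n : ℕ} {v w : ℕ → A} (h : SameType s n v w) : SameType s n w v :=
  fun φ hφ => (h φ hφ).symm

theorem SameType.congr {n : ℕ} {v w v' w' : ℕ → A} (h : SameType s n v w)
    (hv : ∀ x < n, v' x = v x) (hw : ∀ x < n, w' x = w x) : SameType s n v' w' :=
  fun φ hφ => by rw [hφ v' v hv, hφ w' w hw]; exact h φ hφ

/-- If the first `n` values have different types, this is witnessed by a formula that holds of the
first of them. -/
theorem exists_separating {n : ℕ} {v w : ℕ → A} (h : ¬ SameType s n v w) :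
    ∃ φ, DependsBelow s A n φ ∧ φ.Holds s v ∧ ¬ φ.Holds s w := by
  simp only [SameType, not_forall] at h
  obtain ⟨φ, hφ, h⟩ := h
  by_cases hv : φ.Holds s v
  · exact ⟨φ, hφ, hv, fun hw => h (by simp [hv, hw])⟩
  · refine ⟨φ.not, hφ.not, hv, fun hw => h ?_⟩
    simp only [Fm.holds_not] at hw
    simp [hv, hw]

/-- With finitely many orbits, types are isolated. -/
theorem exists_isolating (n : ℕ) [Finite (Quotient (orbitSetoid L A n))] (v : ℕ → A) :
    ∃ θ, DependsBelow s A n θ ∧ θ.Holds s v ∧ ∀ w, θ.Holds s w → SameType s n v w := by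
  classical
  have := Fintype.ofFinite (Quotient (orbitSetoid L A n))
  let ext : (Fin n → A) → ℕ → A := fun t x => if h : x < n then t ⟨x, h⟩ else v 0
  let rep : Quotient (orbitSetoid L A n) → ℕ → A := fun q => ext q.out
  have hsep : ∀ q, ∃ φ, DependsBelow s A n φ ∧ φ.Holds s v ∧
      (¬ SameType s n v (rep q) → ¬ φ.Holds s (rep q)) := by
    intro q
    by_cases h : SameType s n v (rep q)
    · exact ⟨Fm.falsum.not, fun _ _ _ => Iff.rfl, id, fun h' => absurd h h'⟩
    · obtain ⟨φ, h1, h2, h3⟩ := exists_separating h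
      exact ⟨φ, h1, h2, fun _ => h3⟩
  choose φ h1 h2 h3 using hsep
  refine ⟨Fm.conj (Finset.univ.toList.map φ), DependsBelow.conj (by simpa using h1), ?_, ?_⟩
  · simpa using h2
  · intro w hw
    simp only [Fm.holds_conj, List.mem_map, Finset.mem_toList, Finset.mem_univ, true_and,
      forall_exists_index, forall_apply_eq_imp_iff] at hw
    set q : Quotient (orbitSetoid L A n) := Quotient.mk _ fun i => w i with hq
    obtain ⟨π, hπ⟩ : (orbitSetoid L A n).r q.out fun i => w i :=
      Quotient.mk_out (s := orbitSetoid L A n) _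
    have hagree : ∀ x < n, w x = (π ∘ rep q) x := fun x hx => by
      simp only [Function.comp_apply, rep, ext, hx, dif_pos]
      exact (hπ ⟨x, hx⟩).symm
    have hrep : ∀ ψ, DependsBelow s A n ψ → (ψ.Holds s w ↔ ψ.Holds s (rep q)) := fun ψ hψ => by
      rw [hψ w _ hagree, Fm.holds_equiv]
    by_contra hne
    refine h3 q (fun h => hne fun ψ hψ => ?_) ((hrep _ (h1 q)).1 (hw q))
    rw [h ψ hψ, hrep ψ hψ]

theorem SameType.exists_extend {n : ℕ} (hfin : Finite (Quotient (orbitSetoid L A (n + 1))))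
    {v w : ℕ → A} (h : SameType s n v w) (a : A) :
    ∃ b, SameType s (n + 1) (Function.update v n a) (Function.update w n b) := by
  obtain ⟨θ, h1, h2, h3⟩ := exists_isolating (s := s) (n + 1) (Function.update v n a)
  have hdep : DependsBelow s A n (Fm.exs [n] θ) := by
    intro v w hvw
    have : ∀ {v w : ℕ → A}, (∀ x < n, v x = w x) → (Fm.exs [n] θ).Holds s v →
        (Fm.exs [n] θ).Holds s w := by
      intro v w hvw hv
      rw [Fm.holds_exs] at hv ⊢
      obtain ⟨v', h, h'⟩ := hv
      refine ⟨Function.update w n (v' n), fun x hx => Function.update_of_ne (by simpa using hx) _ _,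
        (h1 _ _ fun x hx => ?_).1 h'⟩
      rcases Nat.lt_succ_iff_lt_or_eq.1 hx with hx | rfl
      · rw [h x (by simp [hx.ne]), Function.update_of_ne hx.ne, hvw x hx]
      · simp
    exact ⟨this hvw, this fun x hx => (hvw x hx).symm⟩
  have := (h _ hdep).1 ((Fm.holds_exs s _ _ _).2
    ⟨_, fun x hx => Function.update_of_ne (by simpa using hx) _ _, h2⟩)
  obtain ⟨w', hw, hw'⟩ := (Fm.holds_exs s _ _ _).1 this
  refine ⟨w' n, (h3 _ hw').congr (fun _ _ => rfl) fun x hx => ?_⟩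
  by_cases hxn : x = n
  · simp [hxn]
  · rw [Function.update_of_ne hxn, hw x (by simpa using hxn)]

/-- Back and forth: in a countable structure with finitely many orbits of tuples of each length,
tuples of the same type are in the same orbit. -/
theorem SameType.exists_equiv [L.IsRelational] [Countable A]
    (hfin : ∀ n, Finite (Quotient (orbitSetoid L A n))) {n : ℕ} {v w : ℕ → A}
    (h : SameType s n v w) : ∃ π : A ≃[L] A, ∀ x < n, π (v x) = w x := by
  have : Nonempty A := ⟨v 0⟩
  obtain ⟨enum, henum⟩ := exists_surjective_nat A
  have hstep : ∀ (p : ℕ × (ℕ → A) × (ℕ → A)) (a : A), SameType s p.1 p.2.1 p.2.2 →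
      ∃ p' : ℕ × (ℕ → A) × (ℕ → A), SameType s p'.1 p'.2.1 p'.2.2 ∧ p.1 ≤ p'.1 ∧
        (∀ x < p.1, p'.2.1 x = p.2.1 x ∧ p'.2.2 x = p.2.2 x) ∧
        (∃ x < p'.1, p'.2.1 x = a) ∧ ∃ x < p'.1, p'.2.2 x = a := by
    rintro ⟨m, v, w⟩ a h
    obtain ⟨b, hb⟩ := h.exists_extend (hfin _) a
    obtain ⟨c, hc⟩ := hb.symm.exists_extend (hfin _) a
    refine ⟨⟨m + 1 + 1, Function.update (Function.update v m a) (m + 1) c,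
      Function.update (Function.update w m b) (m + 1) a⟩, hc.symm, by simp; omega, fun x hx => ?_,
      ⟨m, by simp, ?_⟩, ⟨m + 1, by simp, Function.update_self _ _ _⟩⟩
    · have hx' : x < m := hx
      simp only
      rw [Function.update_of_ne (by omega), Function.update_of_ne (by omega),
        Function.update_of_ne (by omega), Function.update_of_ne (by omega)]
      exact ⟨rfl, rfl⟩
    · simp only
      rw [Function.update_of_ne (by omega), Function.update_self]
  choose! next hn1 hn2 hn3 hn4 hn5 using hstep
  let st : ℕ → ℕ × (ℕ → A) × (ℕ → A) := fun i =>
    Nat.rec (n, v, w) (fun i p => next p (enum i)) i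
  have hst : ∀ i, SameType s (st i).1 (st i).2.1 (st i).2.2 := fun i => by
    induction i with
    | zero => exact h
    | succ i ih => exact hn1 _ _ ih
  have hmono : ∀ i j, i ≤ j → (st i).1 ≤ (st j).1 ∧
      ∀ x < (st i).1, (st j).2.1 x = (st i).2.1 x ∧ (st j).2.2 x = (st i).2.2 x := by
    intro i j hij
    induction j, hij using Nat.le_induction with
    | base => exact ⟨le_rfl, fun x _ => ⟨rfl, rfl⟩⟩
    | succ j _ ih =>
      refine ⟨ih.1.trans (hn2 _ _ (hst j)), fun x hx => ?_⟩
      obtain ⟨h1, h2⟩ := hn3 (st j) (enum j) (hst j) x (hx.trans_le ih.1)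
      exact ⟨h1.trans (ih.2 x hx).1, h2.trans (ih.2 x hx).2⟩
  have hdom : ∀ a, ∃ i x, x < (st i).1 ∧ (st i).2.1 x = a := fun a => by
    obtain ⟨i, rfl⟩ := henum a
    obtain ⟨x, hx⟩ := hn4 (st i) (enum i) (hst i)
    exact ⟨i + 1, x, hx⟩
  have hcod : ∀ a, ∃ i x, x < (st i).1 ∧ (st i).2.2 x = a := fun a => by
    obtain ⟨i, rfl⟩ := henum a
    obtain ⟨x, hx⟩ := hn5 (st i) (enum i) (hst i)
    exact ⟨i + 1, x, hx⟩
  choose I X hX hXa using hdom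
  choose J Y hY hYa using hcod
  have late1 : ∀ a j, I a ≤ j → (st j).2.1 (X a) = a ∧ X a < (st j).1 := fun a j hj =>
    ⟨((hmono _ _ hj).2 _ (hX a)).1.trans (hXa a), (hX a).trans_le (hmono _ _ hj).1⟩
  have late2 : ∀ a j, J a ≤ j → (st j).2.2 (Y a) = a ∧ Y a < (st j).1 := fun a j hj =>
    ⟨((hmono _ _ hj).2 _ (hY a)).2.trans (hYa a), (hY a).trans_le (hmono _ _ hj).1⟩
  have heq : ∀ j x y, x < (st j).1 → y < (st j).1 →
      ((st j).2.1 x = (st j).2.1 y ↔ (st j).2.2 x = (st j).2.2 y) := fun j x y hx hy =>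
    hst j (Fm.eq x y) fun v w hvw => by simp only [Fm.Holds]; rw [hvw x hx, hvw y hy]
  let f : A → A := fun a => (st (I a)).2.2 (X a)
  let g : A → A := fun a => (st (J a)).2.1 (Y a)
  have hf : ∀ a j x, x < (st j).1 → (st j).2.1 x = a → f a = (st j).2.2 x := by
    intro a j x hx ha
    have h1 := hmono (I a) (max (I a) j) (le_max_left _ _)
    have h2 := hmono j (max (I a) j) (le_max_right _ _)
    have := (heq (max (I a) j) (X a) x ((hX a).trans_le h1.1) (hx.trans_le h2.1)).1 (by
      rw [(h1.2 _ (hX a)).1, (h2.2 _ hx).1, hXa, ha])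
    rwa [(h1.2 _ (hX a)).2, (h2.2 _ hx).2] at this
  have hg : ∀ a j x, x < (st j).1 → (st j).2.2 x = a → g a = (st j).2.1 x := by
    intro a j x hx ha
    have h1 := hmono (J a) (max (J a) j) (le_max_left _ _)
    have h2 := hmono j (max (J a) j) (le_max_right _ _)
    have := (heq (max (J a) j) (Y a) x ((hY a).trans_le h1.1) (hx.trans_le h2.1)).2 (by
      rw [(h1.2 _ (hY a)).2, (h2.2 _ hx).2, hYa, ha])
    rwa [(h1.2 _ (hY a)).1, (h2.2 _ hx).1] at this
  let e : A ≃ A :=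
    { toFun := f
      invFun := g
      left_inv := fun a => by rw [hg (f a) (I a) (X a) (hX a) rfl, hXa]
      right_inv := fun a => by rw [hf (g a) (J a) (Y a) (hY a) rfl, hYa] }
  have hrel : ∀ {m : ℕ} (R : L.Relations m) (t : Fin m → A),
      FirstOrder.Language.Structure.RelMap R (f ∘ t) ↔
        FirstOrder.Language.Structure.RelMap R t := by
    intro m R t
    obtain ⟨j, hj⟩ : ∃ j, ∀ i, I (t i) ≤ j :=
      ⟨Finset.univ.sup fun i => I (t i), fun i => Finset.le_sup (f := fun i => I (t i)) (by simp)⟩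
    obtain ⟨⟨i, hi⟩, hs⟩ := s.surjective ⟨m, R⟩
    have hlen : (List.ofFn fun i => X (t i)).length = (s ⟨i, hi⟩).1 := by simp [hs]
    have hval : ∀ u : ℕ → A, (Fm.rel i (List.ofFn fun i => X (t i))).Holds s u ↔
        FirstOrder.Language.Structure.RelMap R fun j => u (X (t j)) := by
      intro u
      have : ∀ (σ : Σ m, L.Relations m) (hσ : σ = ⟨m, R⟩)
          (hn : (List.ofFn fun i => X (t i)).length = σ.1),
          (FirstOrder.Language.Structure.RelMap σ.2 fun j =>
            u ((List.ofFn fun i => X (t i)).get (j.cast hn.symm))) ↔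
          FirstOrder.Language.Structure.RelMap R fun j => u (X (t j)) := by
        rintro _ rfl hn
        simp
      exact ⟨fun ⟨_, hn, h⟩ => (this _ hs hn).1 h, fun h => ⟨hi, hlen, (this _ hs hlen).2 h⟩⟩
    have hdep : DependsBelow s A (st j).1 (Fm.rel i (List.ofFn fun i => X (t i))) := by
      intro u u' huu
      rw [hval, hval]
      simp only [huu _ (late1 _ j (hj _)).2]
    have := hst j _ hdep
    rw [hval, hval] at this
    rw [show t = fun i => (st j).2.1 (X (t i)) from funext fun i => (late1 _ j (hj i)).1.symm]
    rw [this]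
    refine iff_of_eq (congrArg _ (funext fun i => ?_))
    exact hf _ j _ (late1 _ j (hj i)).2 rfl
  refine ⟨⟨e, fun F => isEmptyElim F, fun R t => hrel R t⟩, fun x hx => ?_⟩
  exact hf (v x) 0 x hx rfl

end Satisfaction

/-! ### Sets with atoms: membership, pairs, and renaming -/

namespace HSet

variable {A : Type u}

/-- The object presented by a tree. -/
def mk (x : PreHSet A) : HSet A := Quotient.mk _ x

theorem mk_eq_mk {x y : PreHSet A} : mk x = mk y ↔ PreHSet.Equiv x y := Quotient.eq

theorem exists_mk (x : HSet A) : ∃ y, mk y = x := Quotient.exists_rep x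

theorem rename_mk (π : A → A) (x : PreHSet A) : rename π (mk x) = mk (PreHSet.map π x) := rfl

/-- `x` is a set, not an atom. -/
def IsSet (x : HSet A) : Prop :=
  ∃ (ι : Type u) (f : ι → PreHSet A), x = mk (PreHSet.set ι f)

theorem mem_mk_iff (x : HSet A) (y : PreHSet A) : x ∈ mk y ↔ ∃ i, x = mk (y.elem i) := by
  obtain ⟨x, rfl⟩ := exists_mk x
  exact exists_congr fun i => mk_eq_mk.symm

theorem notMem_atom (x : HSet A) (a : A) : x ∉ atom a := by
  change x ∉ mk _
  rw [mem_mk_iff]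
  rintro ⟨i, -⟩
  exact i.elim

theorem IsSet.ext {x y : HSet A} (hx : IsSet x) (hy : IsSet y) (h : ∀ z, z ∈ x ↔ z ∈ y) :
    x = y := by
  obtain ⟨ι, f, rfl⟩ := hx
  obtain ⟨κ, g, rfl⟩ := hy
  simp only [mem_mk_iff] at h
  refine mk_eq_mk.2 ⟨fun i => ?_, fun j => ?_⟩
  · obtain ⟨j, hj⟩ := (h _).1 ⟨i, rfl⟩
    exact ⟨j, mk_eq_mk.1 hj⟩
  · obtain ⟨i, hi⟩ := (h _).2 ⟨j, rfl⟩
    exact ⟨i, mk_eq_mk.1 hi.symm⟩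

theorem isSet_range {ι : Type u} (f : ι → HSet A) : IsSet (range f) := ⟨_, _, rfl⟩

theorem mem_range {ι : Type u} (f : ι → HSet A) (x : HSet A) : x ∈ range f ↔ ∃ i, x = f i := by
  change x ∈ mk _ ↔ _
  rw [mem_mk_iff]
  refine exists_congr fun i => ?_
  rw [show mk ((PreHSet.set ι fun i => (f i).out).elem i) = f i from Quotient.out_eq (f i)]

theorem mem_upair (x y z : HSet A) : z ∈ upair x y ↔ z = x ∨ z = y := by
  rw [upair, mem_range]
  constructor
  · rintro ⟨⟨b⟩, hb⟩
    cases b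
    · exact Or.inr hb
    · exact Or.inl hb
  · rintro (rfl | rfl)
    · exact ⟨⟨true⟩, rfl⟩
    · exact ⟨⟨false⟩, rfl⟩

theorem isSet_upair (x y : HSet A) : IsSet (upair x y) := isSet_range _

theorem upair_self_inj {x y z : HSet A} (h : upair x x = upair y z) : x = y ∧ x = z := by
  have h1 := (mem_upair y z y).2 (Or.inl rfl)
  have h2 := (mem_upair y z z).2 (Or.inr rfl)
  rw [← h, mem_upair, or_self] at h1 h2
  exact ⟨h1.symm, h2.symm⟩

theorem pair_inj {x y x' y' : HSet A} : pair x y = pair x' y' ↔ x = x' ∧ y = y' := by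
  refine ⟨fun h => ?_, by rintro ⟨rfl, rfl⟩; rfl⟩
  have hx : x = x' := by
    have h1 : upair x x ∈ pair x' y' := by rw [← h, pair, mem_upair]; exact Or.inr rfl
    rw [pair, mem_upair] at h1
    rcases h1 with h1 | h1 <;> exact (upair_self_inj h1).1
  subst hx
  refine ⟨rfl, ?_⟩
  have h1 : upair x y ∈ pair x y' := by rw [← h, pair, mem_upair]; exact Or.inl rfl
  have h2 : upair x y' ∈ pair x y := by rw [h, pair, mem_upair]; exact Or.inl rfl
  rw [pair, mem_upair] at h1 h2
  rcases h1 with h1 | h1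
  · have h3 := (mem_upair x y y).2 (Or.inr rfl)
    have h4 := (mem_upair x y' y').2 (Or.inr rfl)
    rw [h1, mem_upair] at h3
    rw [← h1, mem_upair] at h4
    rcases h3 with h3 | h3
    · rcases h4 with h4 | h4
      · rw [h3, h4]
      · exact h4.symm
    · exact h3
  · have h5 := (upair_self_inj h1.symm).2
    subst h5
    rcases h2 with h2 | h2 <;> exact (upair_self_inj h2.symm).2

section Rename

theorem IsSet.rename (π : A → A) {x : HSet A} (hx : IsSet x) : IsSet (rename π x) := by
  obtain ⟨ι, f, rfl⟩ := hx
  exact ⟨_, _, rfl⟩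

theorem mem_rename (π : A → A) (x z : HSet A) : z ∈ rename π x ↔ ∃ y ∈ x, z = rename π y := by
  obtain ⟨x, rfl⟩ := exists_mk x
  cases x with
  | atom a => exact ⟨fun h => (notMem_atom _ _ h).elim, fun ⟨y, hy, _⟩ => (notMem_atom _ _ hy).elim⟩
  | set ι f =>
    rw [rename_mk, PreHSet.map, mem_mk_iff]
    constructor
    · rintro ⟨i, rfl⟩
      exact ⟨mk (f i), (mem_mk_iff _ _).2 ⟨i, rfl⟩, rfl⟩
    · rintro ⟨y, hy, rfl⟩
      obtain ⟨i, rfl⟩ := (mem_mk_iff _ _).1 hy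
      exact ⟨i, rfl⟩

theorem map_map (f g : A → A) (x : PreHSet A) :
    PreHSet.map f (PreHSet.map g x) = PreHSet.map (f ∘ g) x := by
  induction x with
  | atom a => rfl
  | set ι h ih => simp only [PreHSet.map, ih]

theorem map_id (x : PreHSet A) : PreHSet.map id x = x := by
  induction x with
  | atom a => rfl
  | set ι h ih => simp only [PreHSet.map, ih]

theorem rename_rename (f g : A → A) (x : HSet A) : rename f (rename g x) = rename (f ∘ g) x := by
  obtain ⟨x, rfl⟩ := exists_mk x
  rw [rename_mk, rename_mk, rename_mk, map_map]

theorem rename_id (x : HSet A) : rename id x = x := by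
  obtain ⟨x, rfl⟩ := exists_mk x
  rw [rename_mk, map_id]

theorem mem_rename_of_mem (π : A → A) {x z : HSet A} (h : z ∈ x) : rename π z ∈ rename π x :=
  (mem_rename _ _ _).2 ⟨z, h, rfl⟩

theorem rename_upair (π : A → A) (x y : HSet A) :
    rename π (upair x y) = upair (rename π x) (rename π y) := by
  refine IsSet.ext ((isSet_upair _ _).rename π) (isSet_upair _ _) fun z => ?_
  rw [mem_rename, mem_upair]
  simp only [mem_upair, or_and_right, exists_or, exists_eq_left]

theorem rename_pair (π : A → A) (x y : HSet A) :
    rename π (pair x y) = pair (rename π x) (rename π y) := by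
  rw [pair, rename_upair, rename_upair, rename_upair, pair]

theorem rename_tuple (π : A → A) (x : HSet A) (xs : List (HSet A)) :
    rename π (tuple x xs) = tuple (rename π x) (xs.map (rename π)) := by
  induction xs generalizing x with
  | nil => rfl
  | cons y ys ih => rw [tuple, rename_pair, ih]; rfl

end Rename

end HSet

/-! ### Values of expressions -/

/-- The expressions: variables and formal unions. -/
abbrev Body := ℕ ⊕ SetExpr

/-- A single set-builder expression `{e | as, φ}`. -/
abbrev Branch := Body × List ℕ × Fm

/-- The set-builder expressions of which a formal union is the union. -/
def SetExpr.branches : SetExpr → List Branch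
  | empty => []
  | consVar x as φ r => (Sum.inl x, as, φ) :: r.branches
  | consSet e as φ r => (Sum.inr e, as, φ) :: r.branches

/-- The formal union of a set-builder expression and a formal union. -/
def SetExpr.cons (b : Branch) (r : SetExpr) : SetExpr :=
  Sum.elim (fun x => consVar x b.2.1 b.2.2 r) (fun e => consSet e b.2.1 b.2.2 r) b.1

/-- The formal union of a list of set-builder expressions. -/
def SetExpr.ofBranches (l : List Branch) : SetExpr := l.foldr SetExpr.cons SetExpr.empty

theorem SetExpr.branches_ofBranches (l : List Branch) : (ofBranches l).branches = l := by
  induction l with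
  | nil => rfl
  | cons b l ih =>
    obtain ⟨b | b, as, φ⟩ := b <;>
    · change _ :: (ofBranches l).branches = _
      rw [ih]

/-- Induction on the nesting of set-builder expressions. -/
theorem SetExpr.induction_branches {P : SetExpr → Prop}
    (h : ∀ e : SetExpr, (∀ b ∈ e.branches, ∀ e', b.1 = Sum.inr e' → P e') → P e) (e : SetExpr) :
    P e := by
  have main : ∀ e : SetExpr, ∀ b ∈ e.branches, ∀ e', b.1 = Sum.inr e' → P e' := by
    intro e
    induction e with
    | empty => simp [branches]
    | consVar x as φ r ih =>
      intro b hb e' he'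
      rcases List.mem_cons.1 hb with rfl | hb
      · simp at he'
      · exact ih b hb e' he'
    | consSet e as φ r ih1 ih2 =>
      intro b hb e' he'
      rcases List.mem_cons.1 hb with rfl | hb
      · obtain rfl : e = e' := by simpa using he'
        exact h _ ih1
      · exact ih2 b hb e' he'
  exact h e (main e)

section Values

variable {L : FirstOrder.Language.{v, w}} {A : Type u} [L.Structure A] {k : ℕ}
  (s : SymbolNumbering L k)

/-- The value of an expression. -/
def Body.eval (b : Body) (v : ℕ → A) : HSet A :=
  Sum.elim (fun x => HSet.atom (v x)) (fun e => e.eval s v) b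

theorem SetExpr.isSet_eval (e : SetExpr) (v : ℕ → A) : (e.eval s v).IsSet := by
  cases e <;> exact ⟨_, _, rfl⟩

theorem SetExpr.mem_eval (e : SetExpr) (v : ℕ → A) (z : HSet A) :
    z ∈ e.eval s v ↔ ∃ b ∈ e.branches, ∃ v' : ℕ → A, (∀ x, x ∉ b.2.1 → v' x = v x) ∧
      b.2.2.Holds s v' ∧ z = b.1.eval s v' := by
  have hmk : ∀ e : SetExpr, z ∈ e.eval s v ↔
      ∃ i, z = HSet.mk ((e.preEval s v).elem i) := fun e => HSet.mem_mk_iff _ _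
  induction e with
  | empty =>
    rw [hmk]
    simp only [branches, List.not_mem_nil, false_and, exists_false, iff_false]
    rintro ⟨i, -⟩
    exact i.elim
  | consVar x as φ r ih =>
    rw [hmk, branches, List.exists_mem_cons_iff]
    refine Iff.trans ?_ (or_congr Iff.rfl ((hmk r).symm.trans ih))
    constructor
    · rintro ⟨⟨v', h1, h2⟩ | i, h⟩
      · exact Or.inl ⟨v', h1, h2, h⟩
      · exact Or.inr ⟨i, h⟩
    · rintro (⟨v', h1, h2, h⟩ | ⟨i, h⟩)
      · exact ⟨Sum.inl ⟨v', h1, h2⟩, h⟩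
      · exact ⟨Sum.inr i, h⟩
  | consSet e as φ r _ ih =>
    rw [hmk, branches, List.exists_mem_cons_iff]
    refine Iff.trans ?_ (or_congr Iff.rfl ((hmk r).symm.trans ih))
    constructor
    · rintro ⟨⟨v', h1, h2⟩ | i, h⟩
      · exact Or.inl ⟨v', h1, h2, h⟩
      · exact Or.inr ⟨i, h⟩
    · rintro (⟨v', h1, h2, h⟩ | ⟨i, h⟩)
      · exact ⟨Sum.inl ⟨v', h1, h2⟩, h⟩
      · exact ⟨Sum.inr i, h⟩

theorem SetExpr.mem_ofBranches (l : List Branch) (v : ℕ → A) (z : HSet A) :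
    z ∈ (ofBranches l).eval s v ↔ ∃ b ∈ l, ∃ v' : ℕ → A, (∀ x, x ∉ b.2.1 → v' x = v x) ∧
      b.2.2.Holds s v' ∧ z = b.1.eval s v' := by
  rw [mem_eval, branches_ofBranches]

theorem Body.isDefinable_eval (b : Body) (v : ℕ → A) : IsDefinable s (b.eval s v) := by
  cases b with
  | inl x => exact ⟨v, Or.inl ⟨x, rfl⟩⟩
  | inr e => exact ⟨v, Or.inr ⟨e, rfl⟩⟩

theorem SetExpr.isDefinable_of_mem {e : SetExpr} {v : ℕ → A} {z : HSet A} (h : z ∈ e.eval s v) :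
    IsDefinable s z := by
  obtain ⟨b, -, v', -, -, rfl⟩ := (mem_eval s _ _ _).1 h
  exact b.1.isDefinable_eval s v'

/-- The values of expressions are equivariant under automorphisms. -/
theorem SetExpr.rename_eval (π : A ≃[L] A) (e : SetExpr) :
    ∀ v : ℕ → A, (e.eval s v).rename π = e.eval s (π ∘ v) := by
  induction e using SetExpr.induction_branches with
  | h e ih =>
    intro v
    refine HSet.IsSet.ext ((isSet_eval s e v).rename π) (isSet_eval s e _) fun z => ?_
    have hb : ∀ b ∈ e.branches, ∀ v', (Body.eval s b.1 v').rename π = Body.eval s b.1 (π ∘ v') := by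
      intro b hb v'
      obtain ⟨x | e', as, φ⟩ := b
      · rfl
      · exact ih _ hb e' rfl v'
    rw [HSet.mem_rename, mem_eval]
    constructor
    · rintro ⟨y, hy, rfl⟩
      obtain ⟨b, h1, v', h2, h3, rfl⟩ := (mem_eval s _ _ _).1 hy
      exact ⟨b, h1, π ∘ v', fun x hx => congrArg π (h2 x hx), (Fm.holds_equiv s π _ _).2 h3,
        hb b h1 v'⟩
    · rintro ⟨b, h1, v', h2, h3, rfl⟩
      have hv' : π ∘ (π.symm ∘ v') = v' := by
        funext x; exact π.apply_symm_apply _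
      refine ⟨b.1.eval s (π.symm ∘ v'), (mem_eval s _ _ _).2 ⟨b, h1, π.symm ∘ v', fun x hx => ?_,
        ?_, rfl⟩, ?_⟩
      · simp [h2 x hx]
      · rwa [← Fm.holds_equiv s π, hv']
      · rw [hb b h1, hv']

theorem Body.rename_eval (π : A ≃[L] A) (b : Body) (v : ℕ → A) :
    (b.eval s v).rename π = b.eval s (π ∘ v) := by
  cases b with
  | inl x => rfl
  | inr e => exact e.rename_eval s π v

/-- The Gödel number of a formal union, or the variable. -/
def Body.code (b : Body) : ℕ := Sum.elim id SetExpr.code b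

theorem SetExpr.code_branches_le {e : SetExpr} {b : Branch} (h : b ∈ e.branches) :
    b.1.code ≤ e.code ∧ b.2.2.code ≤ e.code := by
  induction e with
  | empty => simp [branches] at h
  | consVar x as φ r ih =>
    have h1 := Nat.left_le_pair (Nat.pair x (code r))
      (Nat.pair (Encodable.encode as) (Encodable.encode φ))
    have h2 := Nat.right_le_pair (Nat.pair x (code r))
      (Nat.pair (Encodable.encode as) (Encodable.encode φ))
    have h3 := Nat.left_le_pair x (code r)
    have h4 := Nat.right_le_pair x (code r)
    have h5 : φ.code ≤ _ := Nat.right_le_pair (Encodable.encode as) (Encodable.encode φ)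
    simp only [code]
    rcases List.mem_cons.1 h with rfl | h
    · simp only [Body.code, Sum.elim_inl, id]
      omega
    · have := ih h
      omega
  | consSet e as φ r _ ih =>
    have h1 := Nat.left_le_pair (Nat.pair (code e) (code r))
      (Nat.pair (Encodable.encode as) (Encodable.encode φ))
    have h2 := Nat.right_le_pair (Nat.pair (code e) (code r))
      (Nat.pair (Encodable.encode as) (Encodable.encode φ))
    have h3 := Nat.left_le_pair (code e) (code r)
    have h4 := Nat.right_le_pair (code e) (code r)
    have h5 : φ.code ≤ _ := Nat.right_le_pair (Encodable.encode as) (Encodable.encode φ)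
    simp only [code]
    rcases List.mem_cons.1 h with rfl | h
    · simp only [Body.code, Sum.elim_inr]
      omega
    · have := ih h
      omega

/-- The value depends on the variables up to the Gödel number only. -/
theorem SetExpr.eval_congr_code (e : SetExpr) : ∀ {v w : ℕ → A}, (∀ x ≤ e.code, v x = w x) →
    e.eval s v = e.eval s w := by
  induction e using SetExpr.induction_branches with
  | h e ih =>
    have main : ∀ {v w : ℕ → A}, (∀ x ≤ e.code, v x = w x) → ∀ z, z ∈ e.eval s v →
        z ∈ e.eval s w := by
      intro v w hvw z hz
      obtain ⟨b, h1, v', h2, h3, rfl⟩ := (mem_eval s _ _ _).1 hz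
      obtain ⟨hb1, hb2⟩ := code_branches_le h1
      classical
      have hagree : ∀ x ≤ e.code, v' x = if x ∈ b.2.1 then v' x else w x := by
        intro x hx
        by_cases h : x ∈ b.2.1
        · simp [h]
        · simp [h, h2 x h, hvw x hx]
      refine (mem_eval s _ _ _).2 ⟨b, h1, fun x => if x ∈ b.2.1 then v' x else w x,
        fun x hx => by simp [hx],
        (Fm.holds_congr_code s _ fun x hx => hagree x (hx.trans hb2)).1 h3, ?_⟩
      obtain ⟨x | e', as, φ⟩ := b
      · exact congrArg HSet.atom (hagree x hb1)
      · exact ih _ h1 e' rfl fun x hx => hagree x (hx.trans hb1)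
    intro v w hvw
    exact HSet.IsSet.ext (isSet_eval s e v) (isSet_eval s e w) fun z =>
      ⟨main hvw z, main (fun x hx => (hvw x hx).symm) z⟩

theorem Body.eval_congr_code (b : Body) {v w : ℕ → A} (h : ∀ x ≤ b.code, v x = w x) :
    b.eval s v = b.eval s w := by
  cases b with
  | inl x => exact congrArg HSet.atom (h x le_rfl)
  | inr e => exact e.eval_congr_code s h

end Values

/-! ### Renaming of variables -/

/-- Renaming of all variables of a formula, bound ones included. -/
def Fm.ren (ρ : ℕ → ℕ) : Fm → Fm
  | falsum => falsum
  | eq x y => eq (ρ x) (ρ y)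
  | rel i xs => rel i (xs.map ρ)
  | imp φ ψ => imp (ren ρ φ) (ren ρ ψ)
  | all x φ => all (ρ x) (ren ρ φ)

/-- Renaming of all variables of a formal union, bound ones included. -/
def SetExpr.ren (ρ : ℕ → ℕ) : SetExpr → SetExpr
  | empty => empty
  | consVar x as φ r => consVar (ρ x) (as.map ρ) (φ.ren ρ) (ren ρ r)
  | consSet e as φ r => consSet (ren ρ e) (as.map ρ) (φ.ren ρ) (ren ρ r)

/-- Renaming of all variables of an expression. -/
def Body.ren (ρ : ℕ → ℕ) (b : Body) : Body := Sum.map ρ (SetExpr.ren ρ) b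

theorem SetExpr.branches_ren (ρ : ℕ → ℕ) (e : SetExpr) : (e.ren ρ).branches =
    e.branches.map fun b => (b.1.ren ρ, b.2.1.map ρ, b.2.2.ren ρ) := by
  induction e with
  | empty => rfl
  | consVar x as φ r ih => simp [ren, branches, ih, Body.ren]
  | consSet e as φ r _ ih => simp [ren, branches, ih, Body.ren]

section Values

variable {L : FirstOrder.Language.{v, w}} {A : Type u} [L.Structure A] {k : ℕ}
  (s : SymbolNumbering L k) {ρ : ℕ → ℕ}

theorem Fm.holds_ren (hρ : Function.Injective ρ) (φ : Fm) (v : ℕ → A) :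
    (φ.ren ρ).Holds s v ↔ φ.Holds s (v ∘ ρ) := by
  induction φ generalizing v with
  | falsum => rfl
  | eq x y => rfl
  | rel i xs =>
    simp only [ren, Holds, List.get_eq_getElem, List.getElem_map]
    refine exists_congr fun hi => ⟨fun ⟨hn, h⟩ => ⟨by simpa using hn, h⟩,
      fun ⟨hn, h⟩ => ⟨by simpa using hn, h⟩⟩
  | imp φ ψ ih1 ih2 => rw [ren, holds_imp, holds_imp, ih1, ih2]
  | all x φ ih =>
    rw [ren, holds_all, holds_all]
    refine forall_congr' fun a => ?_
    rw [ih, Function.update_comp_eq_of_injective _ hρ]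

/-- A valuation can be changed on the renamed variables `as`, independently of the values of
all variables that are not in the range of the renaming. -/
theorem exists_extend_ren (hρ : Function.Injective ρ) (as : List ℕ) (v u : ℕ → A)
    (h : ∀ x, x ∉ as → u x = v (ρ x)) :
    ∃ v' : ℕ → A, (∀ x, x ∉ as.map ρ → v' x = v x) ∧ v' ∘ ρ = u ∧
      ∀ x, x ∉ Set.range ρ → v' x = v x := by
  classical
  refine ⟨fun y => if h : y ∈ Set.range ρ then u h.choose else v y, fun x hx => ?_, ?_,
    fun x hx => dif_neg hx⟩
  · by_cases hr : x ∈ Set.range ρ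
    · simp only [hr, dif_pos]
      rw [h, hr.choose_spec]
      intro hmem
      exact hx (List.mem_map.2 ⟨_, hmem, hr.choose_spec⟩)
    · simp [hr]
  · funext x
    have hr : ρ x ∈ Set.range ρ := ⟨x, rfl⟩
    simp only [Function.comp_apply, hr, dif_pos]
    exact congrArg u (hρ hr.choose_spec)

theorem comp_ren_eq (hρ : Function.Injective ρ) {as : List ℕ} {v v' : ℕ → A}
    (h : ∀ x, x ∉ as.map ρ → v' x = v x) (x : ℕ) (hx : x ∉ as) : (v' ∘ ρ) x = v (ρ x) :=
  h _ fun hmem => hx (by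
    obtain ⟨y, hy, hyx⟩ := List.mem_map.1 hmem
    rwa [← hρ hyx])

theorem SetExpr.eval_ren (hρ : Function.Injective ρ) (e : SetExpr) :
    ∀ v : ℕ → A, (e.ren ρ).eval s v = e.eval s (v ∘ ρ) := by
  induction e using SetExpr.induction_branches with
  | h e ih =>
    intro v
    have hb : ∀ b ∈ e.branches, ∀ v' : ℕ → A,
        Body.eval s (Body.ren ρ b.1) v' = Body.eval s b.1 (v' ∘ ρ) := by
      intro b hb v'
      obtain ⟨x | e', as, φ⟩ := b
      · rfl
      · exact ih _ hb e' rfl v'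
    refine HSet.IsSet.ext (isSet_eval s _ v) (isSet_eval s e _) fun z => ?_
    rw [mem_eval, mem_eval, branches_ren]
    constructor
    · rintro ⟨_, hm, v', h2, h3, rfl⟩
      obtain ⟨b, h1, rfl⟩ := List.mem_map.1 hm
      exact ⟨b, h1, v' ∘ ρ, comp_ren_eq hρ h2, (Fm.holds_ren s hρ _ _).1 h3, hb b h1 v'⟩
    · rintro ⟨b, h1, u, h2, h3, rfl⟩
      obtain ⟨v', h4, rfl, -⟩ := exists_extend_ren hρ b.2.1 v u h2
      exact ⟨_, List.mem_map_of_mem h1, v', h4, (Fm.holds_ren s hρ _ _).2 h3, (hb b h1 v').symm⟩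

theorem Body.eval_ren (hρ : Function.Injective ρ) (b : Body) (v : ℕ → A) :
    (b.ren ρ).eval s v = b.eval s (v ∘ ρ) := by
  cases b with
  | inl x => rfl
  | inr e => exact e.eval_ren s hρ v

end Values

/-! ### Formulas for equality and membership of values -/

/-- The `c`-th copy (`c < 3`) of the variables.  Copies keep apart the variables of two expressions
that occur in one formula; the copy `0` is left to the free variables of the input. -/
def copy (c x : ℕ) : ℕ := 3 * x + c

theorem copy_injective (c : ℕ) : Function.Injective (copy c) := fun x y h => by
  simp only [copy] at h; omega

/-- A formula saying that the atom `x` belongs to `e`, where the variables `x` and those of `e` are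
taken from the copies `c` and `c'`. -/
def memVar (c c' x : ℕ) : SetExpr → Fm
  | .empty => .falsum
  | .consVar y as φ r => .disj [.exs (as.map (copy c'))
      (.and (φ.ren (copy c')) (.eq (copy c x) (copy c' y))), memVar c c' x r]
  | .consSet _ _ _ r => memVar c c' x r

/-- Formulas saying that `e ⊆ e'` (for the flag `true`) or that `e ∈ e'` (for the flag `false`),
where the variables of `e` and `e'` are taken from the copies `c` and `c'`. -/
def cmp : Bool → ℕ → ℕ → SetExpr → SetExpr → Fm
  | true, _, _, .empty, _ => .not .falsum
  | true, c, c', .consVar x as φ r, e' => .and (.alls (as.map (copy c))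
      (.imp (φ.ren (copy c)) (memVar c c' x e'))) (cmp true c c' r e')
  | true, c, c', .consSet e as φ r, e' => .and (.alls (as.map (copy c))
      (.imp (φ.ren (copy c)) (cmp false c c' e e'))) (cmp true c c' r e')
  | false, _, _, _, .empty => .falsum
  | false, c, c', e, .consVar _ _ _ r => cmp false c c' e r
  | false, c, c', e, .consSet e' as φ r => .disj [.exs (as.map (copy c'))
      (.and (φ.ren (copy c')) (.and (cmp true c c' e e') (cmp true c' c e' e))),
      cmp false c c' e r]
termination_by _ _ _ e e' => sizeOf e + sizeOf e'

/-- A formula saying that the value of `b` belongs to that of `e`, where the variables of `b` and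
`e` are taken from the copies `c` and `c'`. -/
def memBody (c c' : ℕ) (b : Body) (e : SetExpr) : Fm :=
  Sum.elim (fun x => memVar c c' x e) (fun e' => cmp false c c' e' e) b

/-- The unordered pair of two expressions. -/
def upairBody (b b' : Body) : Body :=
  Sum.inr (.ofBranches [(b, [], .not .falsum), (b', [], .not .falsum)])

/-- The Kuratowski pair of two expressions. -/
def pairBody (b b' : Body) : Body := upairBody (upairBody b b') (upairBody b b)

/-! ### Definable binary relations -/

/-- A set `{(e, e') | as, φ}` of pairs, given by a list of variables and a guard. -/
abbrev PairBranch := Body × Body × List ℕ × Fm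

/-- A formal finite union of sets `{(e, e') | as, φ}` of pairs. -/
abbrev RelExpr := List PairBranch

/-- The identity relation of a definable set. -/
def diag (e : SetExpr) : RelExpr := e.branches.map fun b => (b.1, b.1, b.2)

/-- The coordinatewise product of two relations: it relates `(x, x')` and `(y, y')`
if the first factor relates `x` and `y`, and the second one relates `x'` and `y'`. -/
def prodRel (h h' : RelExpr) : RelExpr := h.flatMap fun p => h'.map fun q =>
  (pairBody (p.1.ren (copy 1)) (q.1.ren (copy 2)),
    pairBody (p.2.1.ren (copy 1)) (q.2.1.ren (copy 2)),
    p.2.2.1.map (copy 1) ++ q.2.2.1.map (copy 2),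
    .and (p.2.2.2.ren (copy 1)) (q.2.2.2.ren (copy 2)))

/-- The coordinatewise power of a relation with exponent `i + 1`. -/
def powRel (h : RelExpr) : ℕ → RelExpr
  | 0 => h
  | i + 1 => prodRel h (powRel h i)

/-- The domain of a relation. -/
def domRel (h : RelExpr) : SetExpr := .ofBranches (h.map fun p => (p.1, p.2.2))

/-- The range of a relation. -/
def ranRel (h : RelExpr) : SetExpr := .ofBranches (h.map fun p => (p.2.1, p.2.2))

/-- A relation as a set of Kuratowski pairs. -/
def graphRel (h : RelExpr) : SetExpr := .ofBranches (h.map fun p => (pairBody p.1 p.2.1, p.2.2))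

/-- A formula saying that, for all pairs in a relation, the first component belongs to
`e` if and only if the second one belongs to `e'`. -/
def allRel (h : RelExpr) (e e' : SetExpr) : Fm :=
  .conj (h.map fun p => .alls (p.2.2.1.map (copy 1)) (.imp (p.2.2.2.ren (copy 1))
    (.and (.imp (memBody 1 2 p.1 e) (memBody 1 2 p.2.1 e'))
      (.imp (memBody 1 2 p.2.1 e') (memBody 1 2 p.1 e)))))

section Semantics

variable {L : FirstOrder.Language.{v, w}} {A : Type u} [L.Structure A] {k : ℕ}
  (s : SymbolNumbering L k)

/-- Replacing the values of the `c`-th copies of the variables `as` leaves the other copies alone. -/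
theorem exists_extend_copy {c c' : ℕ} (hc : c % 3 ≠ c' % 3) (as : List ℕ) (v u : ℕ → A)
    (h : ∀ x, x ∉ as → u x = (v ∘ copy c) x) :
    ∃ v' : ℕ → A, (∀ x, x ∉ as.map (copy c) → v' x = v x) ∧ v' ∘ copy c = u ∧
      v' ∘ copy c' = v ∘ copy c' := by
  obtain ⟨v', h1, h2, h3⟩ := exists_extend_ren (copy_injective c) as v u h
  refine ⟨v', h1, h2, funext fun x => h3 _ ?_⟩
  rintro ⟨y, hy⟩
  simp only [copy] at hy
  omega

theorem comp_copy_eq_of_ne {c c' : ℕ} (hc : c % 3 ≠ c' % 3) {as : List ℕ} {v v' : ℕ → A}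
    (h : ∀ x, x ∉ as.map (copy c) → v' x = v x) : v' ∘ copy c' = v ∘ copy c' :=
  funext fun x => h _ fun hmem => by
    obtain ⟨y, -, hy⟩ := List.mem_map.1 hmem
    simp only [copy] at hy
    omega

theorem forall_copy {c c' : ℕ} (hc : c % 3 ≠ c' % 3) (as : List ℕ) (v : ℕ → A)
    {P : (ℕ → A) → (ℕ → A) → Prop} :
    (∀ v' : ℕ → A, (∀ x, x ∉ as.map (copy c) → v' x = v x) → P (v' ∘ copy c) (v' ∘ copy c')) ↔
      ∀ u : ℕ → A, (∀ x, x ∉ as → u x = (v ∘ copy c) x) → P u (v ∘ copy c') := by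
  constructor
  · intro h u hu
    obtain ⟨v', h1, h2, h3⟩ := exists_extend_copy hc as v u hu
    rw [← h2, ← h3]
    exact h v' h1
  · intro h v' hv'
    rw [comp_copy_eq_of_ne hc hv']
    exact h _ (comp_ren_eq (copy_injective c) hv')

theorem exists_copy {c c' : ℕ} (hc : c % 3 ≠ c' % 3) (as : List ℕ) (v : ℕ → A)
    {P : (ℕ → A) → (ℕ → A) → Prop} :
    (∃ v' : ℕ → A, (∀ x, x ∉ as.map (copy c) → v' x = v x) ∧ P (v' ∘ copy c) (v' ∘ copy c')) ↔
      ∃ u : ℕ → A, (∀ x, x ∉ as → u x = (v ∘ copy c) x) ∧ P u (v ∘ copy c') := by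
  have := forall_copy hc as v (P := fun u w => ¬ P u w)
  simpa only [not_exists, not_and, not_forall, not_not, exists_prop] using not_congr this

theorem SetExpr.mem_eval_consVar (x : ℕ) (as : List ℕ) (φ : Fm) (r : SetExpr) (v : ℕ → A)
    (z : HSet A) : z ∈ (consVar x as φ r).eval s v ↔
      (∃ v' : ℕ → A, (∀ y, y ∉ as → v' y = v y) ∧ φ.Holds s v' ∧ z = HSet.atom (v' x)) ∨
        z ∈ r.eval s v := by
  rw [mem_eval, mem_eval, branches, List.exists_mem_cons_iff]; rfl

theorem SetExpr.mem_eval_consSet (e : SetExpr) (as : List ℕ) (φ : Fm) (r : SetExpr) (v : ℕ → A)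
    (z : HSet A) : z ∈ (consSet e as φ r).eval s v ↔
      (∃ v' : ℕ → A, (∀ y, y ∉ as → v' y = v y) ∧ φ.Holds s v' ∧ z = e.eval s v') ∨
        z ∈ r.eval s v := by
  rw [mem_eval, mem_eval, branches, List.exists_mem_cons_iff]; rfl

theorem SetExpr.notMem_eval_empty (v : ℕ → A) (z : HSet A) : z ∉ (empty.eval s v) := by
  rw [mem_eval]; simp [branches]

theorem HSet.atom_inj {a b : A} : HSet.atom a = HSet.atom b ↔ a = b :=
  HSet.mk_eq_mk.trans (by simp [PreHSet.Equiv])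

theorem HSet.atom_ne_of_isSet {a : A} {x : HSet A} (hx : x.IsSet) : HSet.atom a ≠ x := by
  obtain ⟨ι, f, rfl⟩ := hx
  intro h
  exact (HSet.mk_eq_mk.1 h).elim

theorem holds_memVar {c c' : ℕ} (hc : c % 3 ≠ c' % 3) (x : ℕ) (e : SetExpr) (v : ℕ → A) :
    (memVar c c' x e).Holds s v ↔ HSet.atom (v (copy c x)) ∈ e.eval s (v ∘ copy c') := by
  induction e with
  | empty => simp [memVar, SetExpr.notMem_eval_empty]
  | consVar y as φ r ih =>
    rw [SetExpr.mem_eval_consVar, memVar, Fm.holds_disj]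
    simp only [List.mem_cons, List.not_mem_nil, or_false, exists_eq_or_imp, exists_eq_left, ih,
      Fm.holds_exs, Fm.holds_and, Fm.holds_ren s (copy_injective c')]
    refine or_congr (Iff.trans ?_ (exists_copy hc.symm as v (P := fun u w => φ.Holds s u ∧
      HSet.atom (w x) = HSet.atom (u y)))) Iff.rfl
    simp only [HSet.atom_inj]
    rfl
  | consSet e as φ r _ ih =>
    rw [SetExpr.mem_eval_consSet, memVar, ih, or_iff_right]
    rintro ⟨v', -, -, h⟩
    exact HSet.atom_ne_of_isSet (SetExpr.isSet_eval s e v') h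

theorem holds_cmp : ∀ (f : Bool) (c c' : ℕ) (e e' : SetExpr) (v : ℕ → A), c % 3 ≠ c' % 3 →
    ((cmp f c c' e e').Holds s v ↔
      if f then ∀ z ∈ e.eval s (v ∘ copy c), z ∈ e'.eval s (v ∘ copy c')
      else e.eval s (v ∘ copy c) ∈ e'.eval s (v ∘ copy c')) := by
  intro f c c' e e'
  induction f, c, c', e, e' using cmp.induct with
  | case1 => intro v _; simp [cmp, SetExpr.notMem_eval_empty]
  | case2 c c' x as φ r e' ih =>
    intro v hc
    rw [cmp, Fm.holds_and, ih v hc]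
    simp only [if_true, SetExpr.mem_eval_consVar, or_imp, forall_and, Fm.holds_alls, Fm.holds_imp,
      Fm.holds_ren s (copy_injective c), holds_memVar s hc]
    refine and_congr_left fun _ => ?_
    refine (forall_copy hc as v (P := fun u w => φ.Holds s u →
      HSet.atom (u x) ∈ e'.eval s w)).trans ?_
    exact ⟨fun h z ⟨u, h1, h2, h3⟩ => h3 ▸ h u h1 h2, fun h u h1 h2 => h _ ⟨u, h1, h2, rfl⟩⟩
  | case3 c c' e as φ r e' ih1 ih2 =>
    intro v hc
    rw [cmp, Fm.holds_and, ih2 v hc]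
    simp only [if_true, SetExpr.mem_eval_consSet, or_imp, forall_and, Fm.holds_alls, Fm.holds_imp,
      Fm.holds_ren s (copy_injective c), fun v => ih1 v hc, Bool.false_eq_true, if_false]
    refine and_congr_left fun _ => ?_
    refine (forall_copy hc as v (P := fun u w => φ.Holds s u →
      e.eval s u ∈ e'.eval s w)).trans ?_
    exact ⟨fun h z ⟨u, h1, h2, h3⟩ => h3 ▸ h u h1 h2, fun h u h1 h2 => h _ ⟨u, h1, h2, rfl⟩⟩
  | case4 => intro v _; simp [cmp, SetExpr.notMem_eval_empty]
  | case5 c c' e y as φ r ih =>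
    intro v hc
    rw [cmp, ih v hc]
    simp only [Bool.false_eq_true, if_false]
    rw [SetExpr.mem_eval_consVar, or_iff_right]
    rintro ⟨v', -, -, h⟩
    exact HSet.atom_ne_of_isSet (SetExpr.isSet_eval s e _) h.symm
  | case6 c c' e e' as φ r ih1 ih2 ih3 =>
    intro v hc
    rw [cmp, Fm.holds_disj]
    simp only [List.mem_cons, List.not_mem_nil, or_false, exists_eq_or_imp, exists_eq_left,
      ih3 v hc, Fm.holds_exs, Fm.holds_and, Fm.holds_ren s (copy_injective c'),
      fun v => ih1 v hc, fun v => ih2 v hc.symm, if_true, Bool.false_eq_true, if_false]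
    rw [SetExpr.mem_eval_consSet]
    refine or_congr ?_ Iff.rfl
    refine (exists_copy hc.symm as v (P := fun u w => φ.Holds s u ∧
      (∀ z ∈ e.eval s w, z ∈ e'.eval s u) ∧ ∀ z ∈ e'.eval s u, z ∈ e.eval s w)).trans ?_
    refine exists_congr fun u => and_congr_right fun _ => and_congr_right fun _ => ?_
    constructor
    · rintro ⟨h1, h2⟩
      exact HSet.IsSet.ext (SetExpr.isSet_eval s e _) (SetExpr.isSet_eval s e' _) fun z =>
        ⟨h1 z, h2 z⟩
    · intro h
      rw [h]
      exact ⟨fun _ => id, fun _ => id⟩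

theorem holds_cmp_true {c c' : ℕ} (hc : c % 3 ≠ c' % 3) (e e' : SetExpr) (v : ℕ → A) :
    (cmp true c c' e e').Holds s v ↔
      ∀ z ∈ e.eval s (v ∘ copy c), z ∈ e'.eval s (v ∘ copy c') := by
  simpa using holds_cmp s true c c' e e' v hc

theorem holds_memBody {c c' : ℕ} (hc : c % 3 ≠ c' % 3) (b : Body) (e : SetExpr) (v : ℕ → A) :
    (memBody c c' b e).Holds s v ↔ b.eval s (v ∘ copy c) ∈ e.eval s (v ∘ copy c') := by
  cases b with
  | inl x => exact holds_memVar s hc x e v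
  | inr e' => exact (holds_cmp s false c c' e' e v hc).trans (by simp; rfl)

theorem eval_upairBody (b b' : Body) (v : ℕ → A) :
    (upairBody b b').eval s v = HSet.upair (b.eval s v) (b'.eval s v) := by
  refine HSet.IsSet.ext (SetExpr.isSet_eval s _ v) (HSet.isSet_upair _ _) fun z => ?_
  change z ∈ SetExpr.eval s _ v ↔ _
  rw [SetExpr.mem_ofBranches, HSet.mem_upair]
  have : ∀ v' : ℕ → A, (∀ x, v' x = v x) ↔ v' = v := fun v' => funext_iff.symm
  simp [this]

theorem eval_pairBody (b b' : Body) (v : ℕ → A) :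
    (pairBody b b').eval s v = HSet.pair (b.eval s v) (b'.eval s v) := by
  rw [pairBody, eval_upairBody, eval_upairBody, eval_upairBody, HSet.pair]

/-- The relation presented by a formal union of sets of pairs. -/
def RelExpr.Rel (h : RelExpr) (v : ℕ → A) (x y : HSet A) : Prop :=
  ∃ p ∈ h, ∃ v' : ℕ → A, (∀ x, x ∉ p.2.2.1 → v' x = v x) ∧ p.2.2.2.Holds s v' ∧
    x = p.1.eval s v' ∧ y = p.2.1.eval s v'

theorem rel_diag (e : SetExpr) (v : ℕ → A) (x y : HSet A) :
    RelExpr.Rel s (diag e) v x y ↔ x ∈ e.eval s v ∧ x = y := by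
  rw [SetExpr.mem_eval]
  constructor
  · rintro ⟨p, hp, v', h1, h2, rfl, rfl⟩
    obtain ⟨b, hb, rfl⟩ := List.mem_map.1 hp
    exact ⟨⟨b, hb, v', h1, h2, rfl⟩, rfl⟩
  · rintro ⟨⟨b, hb, v', h1, h2, rfl⟩, rfl⟩
    exact ⟨_, List.mem_map_of_mem hb, v', h1, h2, rfl, rfl⟩

/-- Two independent changes of the values of the copies `1` and `2` of variables. -/
theorem exists_two_copies (as as' : List ℕ) (v : ℕ → A) {P : (ℕ → A) → (ℕ → A) → Prop} :
    (∃ v' : ℕ → A, (∀ x, x ∉ as.map (copy 1) ++ as'.map (copy 2) → v' x = v x) ∧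
      P (v' ∘ copy 1) (v' ∘ copy 2)) ↔
    ∃ u u' : ℕ → A, (∀ x, x ∉ as → u x = (v ∘ copy 1) x) ∧
      (∀ x, x ∉ as' → u' x = (v ∘ copy 2) x) ∧ P u u' := by
  constructor
  · rintro ⟨v', h1, h2⟩
    refine ⟨_, _, fun x hx => h1 _ ?_, fun x hx => h1 _ ?_, h2⟩ <;>
    · rw [List.mem_append, not_or]
      constructor <;>
      · intro hmem
        obtain ⟨y, hy, hyx⟩ := List.mem_map.1 hmem
        simp only [copy] at hyx
        first
          | omega
          | (obtain rfl : y = x := by omega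
             exact hx hy)
  · rintro ⟨u, u', h1, h2, h3⟩
    obtain ⟨w, hw1, rfl, hw2⟩ := exists_extend_copy (c := 1) (c' := 2) (by decide) as v u h1
    obtain ⟨w', hw1', rfl, hw2'⟩ := exists_extend_copy (c := 2) (c' := 1) (by decide) as' w u'
      (by rwa [hw2])
    refine ⟨w', fun x hx => ?_, by rwa [hw2']⟩
    rw [List.mem_append, not_or] at hx
    rw [hw1' x hx.2, hw1 x hx.1]

/-- The valuation gives the same values to the copies `1` and `2` of a variable as to the variable
itself. -/
def Stable (v : ℕ → A) : Prop := v ∘ copy 1 = v ∧ v ∘ copy 2 = v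

variable {v : ℕ → A}

theorem rel_prodRel (hv : Stable v) (h h' : RelExpr) (z z' : HSet A) :
    RelExpr.Rel s (prodRel h h') v z z' ↔ ∃ x y x' y', RelExpr.Rel s h v x y ∧
      RelExpr.Rel s h' v x' y' ∧ z = HSet.pair x x' ∧ z' = HSet.pair y y' := by
  have key : ∀ p q : PairBranch,
      (∃ v' : ℕ → A, (∀ x, x ∉ p.2.2.1.map (copy 1) ++ q.2.2.1.map (copy 2) → v' x = v x) ∧
        (Fm.and (p.2.2.2.ren (copy 1)) (q.2.2.2.ren (copy 2))).Holds s v' ∧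
        z = (pairBody (p.1.ren (copy 1)) (q.1.ren (copy 2))).eval s v' ∧
        z' = (pairBody (p.2.1.ren (copy 1)) (q.2.1.ren (copy 2))).eval s v') ↔
      ∃ u u' : ℕ → A, (∀ x, x ∉ p.2.2.1 → u x = v x) ∧ (∀ x, x ∉ q.2.2.1 → u' x = v x) ∧
        (p.2.2.2.Holds s u ∧ q.2.2.2.Holds s u') ∧
        z = HSet.pair (p.1.eval s u) (q.1.eval s u') ∧
        z' = HSet.pair (p.2.1.eval s u) (q.2.1.eval s u') := by
    intro p q
    simp only [Fm.holds_and, Fm.holds_ren s (copy_injective _), eval_pairBody,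
      Body.eval_ren s (copy_injective _)]
    have := exists_two_copies p.2.2.1 q.2.2.1 v (P := fun u u' =>
      (p.2.2.2.Holds s u ∧ q.2.2.2.Holds s u') ∧
        z = HSet.pair (p.1.eval s u) (q.1.eval s u') ∧
        z' = HSet.pair (p.2.1.eval s u) (q.2.1.eval s u'))
    rwa [hv.1, hv.2] at this
  constructor
  · rintro ⟨t, ht, hh⟩
    obtain ⟨p, hp, ht⟩ := List.mem_flatMap.1 ht
    obtain ⟨q, hq, rfl⟩ := List.mem_map.1 ht
    obtain ⟨u, u', h1, h2, ⟨h3, h4⟩, h5, h6⟩ := (key p q).1 hh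
    exact ⟨_, _, _, _, ⟨p, hp, u, h1, h3, rfl, rfl⟩, ⟨q, hq, u', h2, h4, rfl, rfl⟩, h5, h6⟩
  · rintro ⟨_, _, _, _, ⟨p, hp, u, h1, h3, rfl, rfl⟩, ⟨q, hq, u', h2, h4, rfl, rfl⟩, h5, h6⟩
    exact ⟨_, List.mem_flatMap.2 ⟨p, hp, List.mem_map_of_mem hq⟩,
      (key p q).2 ⟨u, u', h1, h2, ⟨h3, h4⟩, h5, h6⟩⟩

theorem rel_powRel (hv : Stable v) (h : RelExpr) (i : ℕ) (z z' : HSet A) :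
    RelExpr.Rel s (powRel h i) v z z' ↔ ∃ x xs y ys, RelExpr.Rel s h v x y ∧
      List.Forall₂ (RelExpr.Rel s h v) xs ys ∧ xs.length = i ∧
        z = HSet.tuple x xs ∧ z' = HSet.tuple y ys := by
  induction i generalizing z z' with
  | zero =>
    constructor
    · intro hz
      exact ⟨z, [], z', [], hz, .nil, rfl, rfl, rfl⟩
    · rintro ⟨x, xs, y, ys, h1, h2, h3, rfl, rfl⟩
      obtain rfl := List.length_eq_zero_iff.1 h3
      cases h2
      exact h1
  | succ i ih =>
    rw [powRel, rel_prodRel s hv]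
    simp only [ih]
    constructor
    · rintro ⟨x, y, _, _, h1, ⟨x', xs, y', ys, h2, h3, h4, rfl, rfl⟩, rfl, rfl⟩
      exact ⟨x, x' :: xs, y, y' :: ys, h1, .cons h2 h3, by simp [h4], rfl, rfl⟩
    · rintro ⟨x, xs, y, ys, h1, h2, h3, rfl, rfl⟩
      cases h2 with
      | nil => simp at h3
      | cons h4 h5 =>
        exact ⟨x, y, _, _, h1, ⟨_, _, _, _, h4, h5, by simpa using h3, rfl, rfl⟩, rfl, rfl⟩

/-- The relation `(σ, x₁, …, xᵣ) ↦ (σ, y₁, …, yᵣ)` with `r = i + 1`, where `h` relates `xⱼ`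
and `yⱼ`. -/
theorem rel_prodRel_powRel (hv : Stable v) (P : SetExpr) (h : RelExpr) (i : ℕ) (z z' : HSet A) :
    RelExpr.Rel s (prodRel (diag P) (powRel h i)) v z z' ↔ ∃ σ ∈ P.eval s v, ∃ xs ys,
      List.Forall₂ (RelExpr.Rel s h v) xs ys ∧ xs.length = i + 1 ∧
        z = HSet.tuple σ xs ∧ z' = HSet.tuple σ ys := by
  rw [rel_prodRel s hv]
  simp only [rel_powRel s hv, rel_diag]
  constructor
  · rintro ⟨σ, _, _, _, ⟨h1, rfl⟩, ⟨x', xs, y', ys, h2, h3, h4, rfl, rfl⟩, rfl, rfl⟩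
    exact ⟨σ, h1, x' :: xs, y' :: ys, .cons h2 h3, by simp [h4], rfl, rfl⟩
  · rintro ⟨σ, h1, xs, ys, h2, h3, rfl, rfl⟩
    cases h2 with
    | nil => simp at h3
    | cons h4 h5 =>
      exact ⟨σ, σ, _, _, ⟨h1, rfl⟩, ⟨_, _, _, _, h4, h5, by simpa using h3, rfl, rfl⟩, rfl, rfl⟩

theorem mem_domRel (h : RelExpr) (v : ℕ → A) (x : HSet A) :
    x ∈ (domRel h).eval s v ↔ ∃ y, RelExpr.Rel s h v x y := by
  rw [domRel, SetExpr.mem_ofBranches]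
  constructor
  · rintro ⟨_, hb, v', h1, h2, rfl⟩
    obtain ⟨p, hp, rfl⟩ := List.mem_map.1 hb
    exact ⟨_, p, hp, v', h1, h2, rfl, rfl⟩
  · rintro ⟨_, p, hp, v', h1, h2, rfl, rfl⟩
    exact ⟨_, List.mem_map_of_mem hp, v', h1, h2, rfl⟩

theorem mem_ranRel (h : RelExpr) (v : ℕ → A) (y : HSet A) :
    y ∈ (ranRel h).eval s v ↔ ∃ x, RelExpr.Rel s h v x y := by
  rw [ranRel, SetExpr.mem_ofBranches]
  constructor
  · rintro ⟨_, hb, v', h1, h2, rfl⟩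
    obtain ⟨p, hp, rfl⟩ := List.mem_map.1 hb
    exact ⟨_, p, hp, v', h1, h2, rfl, rfl⟩
  · rintro ⟨_, p, hp, v', h1, h2, rfl, rfl⟩
    exact ⟨_, List.mem_map_of_mem hp, v', h1, h2, rfl⟩

theorem mem_graphRel (h : RelExpr) (v : ℕ → A) (z : HSet A) :
    z ∈ (graphRel h).eval s v ↔ ∃ x y, RelExpr.Rel s h v x y ∧ z = HSet.pair x y := by
  rw [graphRel, SetExpr.mem_ofBranches]
  constructor
  · rintro ⟨_, hb, v', h1, h2, rfl⟩
    obtain ⟨p, hp, rfl⟩ := List.mem_map.1 hb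
    exact ⟨_, _, ⟨p, hp, v', h1, h2, rfl, rfl⟩, eval_pairBody s _ _ _⟩
  · rintro ⟨_, _, ⟨p, hp, v', h1, h2, rfl, rfl⟩, rfl⟩
    exact ⟨_, List.mem_map_of_mem hp, v', h1, h2, (eval_pairBody s _ _ _).symm⟩

theorem holds_allRel (hv : Stable v) (h : RelExpr) (e e' : SetExpr) :
    (allRel h e e').Holds s v ↔ ∀ x y, RelExpr.Rel s h v x y →
      (x ∈ e.eval s v ↔ y ∈ e'.eval s v) := by
  have key : ∀ p : PairBranch, (Fm.alls (p.2.2.1.map (copy 1)) (.imp (p.2.2.2.ren (copy 1))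
      (.and (.imp (memBody 1 2 p.1 e) (memBody 1 2 p.2.1 e'))
        (.imp (memBody 1 2 p.2.1 e') (memBody 1 2 p.1 e))))).Holds s v ↔
      ∀ u : ℕ → A, (∀ x, x ∉ p.2.2.1 → u x = v x) → p.2.2.2.Holds s u →
        (p.1.eval s u ∈ e.eval s v ↔ p.2.1.eval s u ∈ e'.eval s v) := by
    intro p
    have := forall_copy (c := 1) (c' := 2) (by decide) p.2.2.1 v (P := fun u w =>
      p.2.2.2.Holds s u → (p.1.eval s u ∈ e.eval s w ↔ p.2.1.eval s u ∈ e'.eval s w))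
    rw [hv.1, hv.2] at this
    rw [← this]
    simp only [Fm.holds_alls, Fm.holds_imp, Fm.holds_and, Fm.holds_ren s (copy_injective _),
      holds_memBody s (show 1 % 3 ≠ 2 % 3 by decide), iff_def]
  rw [allRel, Fm.holds_conj]
  constructor
  · rintro hh _ _ ⟨p, hp, u, h1, h2, rfl, rfl⟩
    exact (key p).1 (hh _ (List.mem_map_of_mem hp)) u h1 h2
  · intro hh φ hφ
    obtain ⟨p, hp, rfl⟩ := List.mem_map.1 hφ
    exact (key p).2 fun u h1 h2 => hh _ _ ⟨p, hp, u, h1, h2, rfl, rfl⟩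

theorem holds_subset (hv : Stable v) (e e' : SetExpr) :
    (cmp true 1 2 e e').Holds s v ↔ ∀ z ∈ e.eval s v, z ∈ e'.eval s v := by
  rw [holds_cmp_true s (by decide), hv.1, hv.2]

end Semantics

/-! ### The group of automorphisms fixing the parameters -/

section Invariant

variable {L : FirstOrder.Language.{v, w}} {A : Type u} [L.Structure A] {k : ℕ}
  {s : SymbolNumbering L k}

variable (L) in
/-- The group of the automorphisms of the atoms that fix all elements of `T`. -/
def autFixing (T : Finset A) : Subgroup (Equiv.Perm A) where
  carrier := {π | (∃ σ : A ≃[L] A, ∀ a, σ a = π a) ∧ ∀ a ∈ T, π a = a}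
  one_mem' := ⟨⟨FirstOrder.Language.Equiv.refl L A, fun _ => rfl⟩, fun _ _ => rfl⟩
  mul_mem' := by
    rintro π ρ ⟨⟨σ, hσ⟩, h⟩ ⟨⟨σ', hσ'⟩, h'⟩
    refine ⟨⟨σ.comp σ', fun a => ?_⟩, fun a ha => ?_⟩
    · rw [FirstOrder.Language.Equiv.comp_apply, hσ', hσ, Equiv.Perm.mul_apply]
    · rw [Equiv.Perm.mul_apply, h' a ha, h a ha]
  inv_mem' := by
    rintro π ⟨⟨σ, hσ⟩, h⟩
    refine ⟨⟨σ.symm, fun a => ?_⟩, fun a ha => ?_⟩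
    · apply σ.injective
      rw [FirstOrder.Language.Equiv.apply_symm_apply, hσ]
      exact (π.apply_symm_apply a).symm
    · rw [Equiv.Perm.inv_eq_iff_eq, h a ha]

instance : MulAction (Equiv.Perm A) (HSet A) where
  smul π x := x.rename π
  one_smul x := HSet.rename_id x
  mul_smul π ρ x := (HSet.rename_rename π ρ x).symm

/-- An automorphism of the atoms that fixes `T`, as an element of the group. -/
def toAutFixing {T : Finset A} (π : A ≃[L] A) (h : ∀ a ∈ T, π a = a) : autFixing L T :=
  ⟨π.toEquiv, ⟨π, fun _ => rfl⟩, h⟩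

theorem smul_eq_self {T : Finset A} (g : autFixing L T) {a : A} (ha : a ∈ T) : g • a = a :=
  g.2.2 a ha

theorem exists_equiv_smul {T : Finset A} (g : autFixing L T) : ∃ σ : A ≃[L] A, (∀ a, σ a = g • a) ∧
    ∀ x : HSet A, x.rename σ = g • x := by
  obtain ⟨σ, hσ⟩ := g.2.1
  refine ⟨σ, hσ, fun x => ?_⟩
  rw [show (σ : A → A) = ((g : Equiv.Perm A) : A → A) from funext hσ]
  rfl

theorem Supports.smul_eq {T S : Finset A} {x : HSet A} (hx : Supports L S x) (g : autFixing L T)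
    (hg : ∀ a ∈ S, g • a = a) : g • x = x := by
  obtain ⟨σ, h1, h2⟩ := exists_equiv_smul g
  rw [← h2]
  exact hx σ fun a ha => (h1 a).trans (hg a ha)

theorem Supports.smul_eq' {T : Finset A} {x : HSet A} (hx : Supports L T x) (g : autFixing L T) :
    g • x = x :=
  hx.smul_eq g fun _ ha => smul_eq_self g ha

theorem smul_mem_iff {T : Finset A} {x z : HSet A} (hx : Supports L T x) (g : autFixing L T) :
    g • z ∈ x ↔ z ∈ x := by
  have : ∀ (g : autFixing L T) z, z ∈ x → g • z ∈ x := fun g z hz => by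
    have := HSet.mem_rename_of_mem (g : Equiv.Perm A) hz
    have h2 := hx.smul_eq' g
    change HSet.rename (g : Equiv.Perm A) x = x at h2
    rw [h2] at this
    exact this
  exact ⟨fun h => by simpa using this g⁻¹ _ h, this g z⟩

theorem smul_tuple {T : Finset A} (g : autFixing L T) (x : HSet A) (xs : List (HSet A)) :
    g • HSet.tuple x xs = HSet.tuple (g • x) (xs.map fun y => g • y) :=
  HSet.rename_tuple _ _ _

/-- The elements of a set supported by `T`. -/
def elems {T : Finset A} {D : HSet A} (hD : Supports L T D) :
    SubMulAction (autFixing L T) (HSet A) where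
  carrier := {x | x ∈ D}
  smul_mem' g _ hx := (smul_mem_iff hD g).2 hx

open Classical in
/-- The least support of a definable set. -/
noncomputable def leastSupp (hs : HasLeastSupports L A s) (x : HSet A) : Finset A :=
  if h : IsDefinable s x then (hs x h).choose else ∅

theorem supports_leastSupp (hs : HasLeastSupports L A s) {x : HSet A} (hx : IsDefinable s x) :
    Supports L (leastSupp hs x) x := by
  rw [leastSupp, dif_pos hx]
  exact (hs x hx).choose_spec.1

theorem leastSupp_subset (hs : HasLeastSupports L A s) {x : HSet A} (hx : IsDefinable s x)
    {S : Finset A} (h : Supports L S x) : leastSupp hs x ⊆ S := by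
  rw [leastSupp, dif_pos hx]
  exact (hs x hx).choose_spec.2 S h

theorem leastSupp_smul [DecidableEq A] (hs : HasLeastSupports L A s) {T : Finset A}
    (g : autFixing L T) {x : HSet A} (hx : IsDefinable s x) (hgx : IsDefinable s (g • x)) :
    leastSupp hs (g • x) = (leastSupp hs x).image fun a => g • a := by
  have key : ∀ (g : autFixing L T) (x : HSet A), IsDefinable s x → IsDefinable s (g • x) →
      leastSupp hs (g • x) ⊆ (leastSupp hs x).image fun a => g • a := by
    intro g x hx hgx
    refine leastSupp_subset hs hgx fun π hπ => ?_
    obtain ⟨σ, h1, h2⟩ := exists_equiv_smul g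
    have h3 := supports_leastSupp hs hx ((σ.symm.comp π).comp σ) fun a ha => by
      have := hπ _ (Finset.mem_image_of_mem (fun a => g • a) ha)
      rw [FirstOrder.Language.Equiv.comp_apply, FirstOrder.Language.Equiv.comp_apply, h1, this,
        ← h1, FirstOrder.Language.Equiv.symm_apply_apply]
    have h4 : σ ∘ ((σ.symm.comp π).comp σ : A ≃[L] A) = π ∘ σ := by
      funext a
      simp
    rw [← h2, HSet.rename_rename, ← h4, ← HSet.rename_rename, h3]
  refine (key g x hx hgx).antisymm fun b hb => ?_
  obtain ⟨a, ha, rfl⟩ := Finset.mem_image.1 hb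
  have := key g⁻¹ (g • x) hgx (by rwa [inv_smul_smul])
  rw [inv_smul_smul] at this
  obtain ⟨c, hc, rfl⟩ := Finset.mem_image.1 (this ha)
  simpa using hc

/-- A definable set has finitely many orbits under the automorphisms that fix a finite set. -/
theorem exists_finite_orbits (hfin : ∀ n, Finite (Quotient (orbitSetoid L A n))) (e : SetExpr)
    (v : ℕ → A) (S : Finset A) :
    ∃ (K : Type) (_ : Finite K) (κ : {x // x ∈ e.eval s v} → K), ∀ x y, κ x = κ y →
      ∃ σ : A ≃[L] A, (∀ a ∈ S, σ a = a) ∧ x.1.rename σ = y.1 := by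
  have hmem : ∀ x : {x // x ∈ e.eval s v}, ∃ i : Fin e.branches.length, ∃ v' : ℕ → A,
      x.1 = (e.branches.get i).1.eval s v' := fun x => by
    obtain ⟨b, hb, v', -, -, h⟩ := (SetExpr.mem_eval s _ _ _).1 x.2
    obtain ⟨i, rfl⟩ := List.mem_iff_get.1 hb
    exact ⟨i, v', h⟩
  choose I V hV using hmem
  let t : {x // x ∈ e.eval s v} → ℕ → A := fun x j =>
    if j ≤ e.code then V x j else S.toList.getD (j - (e.code + 1)) (v 0)
  have hn := hfin (e.code + 1 + S.card)
  obtain ⟨m, ⟨E⟩⟩ := Finite.exists_equiv_fin (Quotient (orbitSetoid L A (e.code + 1 + S.card)))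
  refine ⟨Fin e.branches.length × Fin m, inferInstance,
    fun x => (I x, E (Quotient.mk _ fun j => t x j)), fun x y hxy => ?_⟩
  obtain ⟨h1, h2⟩ := Prod.mk.inj hxy
  obtain ⟨σ, hσ⟩ := Quotient.exact (E.injective h2)
  refine ⟨σ, fun a ha => ?_, ?_⟩
  · obtain ⟨j, hj, rfl⟩ := List.mem_iff_getElem.1 (Finset.mem_toList.2 ha)
    have hj' : j < S.card := by simpa using hj
    have := hσ ⟨e.code + 1 + j, by omega⟩
    simpa [t, hj', show ¬ e.code + 1 + j ≤ e.code by omega] using this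
  · rw [hV x, hV y, ← h1, Body.rename_eval]
    refine Body.eval_congr_code s _ fun j hj => ?_
    have hle := (SetExpr.code_branches_le (List.get_mem e.branches (I x))).1
    have hj' : j ≤ e.code := by omega
    simpa [t, hj'] using hσ ⟨j, by omega⟩

/-- The underlying object of an element of a disjoint union of two sets. -/
def elemVal {T : Finset A} {D E : HSet A} {hD : Supports L T D} {hE : Supports L T E} :
    elems hD ⊕ elems hE → HSet A :=
  Sum.elim Subtype.val Subtype.val

/-- The elements of two definable sets, with their least supports relative to `T`: the elements
of `T` are removed from the least supports since the group fixes them. -/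
noncomputable def supportSystem [DecidableEq A] (hs : HasLeastSupports L A s)
    (hfin : ∀ n, Finite (Quotient (orbitSetoid L A n))) {T : Finset A} {d e : SetExpr} {v : ℕ → A}
    (hd : Supports L T (d.eval s v)) (he : Supports L T (e.eval s v)) :
    SupportSystem (autFixing L T) A (elems hd ⊕ elems he) :=
  have hdef : ∀ x : elems hd ⊕ elems he,
      IsDefinable s (elemVal x) := by
    rintro (x | x) <;> exact SetExpr.isDefinable_of_mem s x.2
  have hval : ∀ (g : autFixing L T) (x : elems hd ⊕ elems he),
      elemVal (g • x) =
        g • elemVal x := by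
    rintro g (x | x) <;> rfl
  { supp := fun x => leastSupp hs (elemVal x) \ T
    smul_eq_of_fix := by
      intro g x hx
      have h : ∀ y : HSet A, IsDefinable s y → (∀ a ∈ leastSupp hs y \ T, g • a = a) →
          g • y = y := fun y hy hx => (supports_leastSupp hs hy).smul_eq g fun a ha => by
        by_cases haT : a ∈ T
        · exact smul_eq_self g haT
        · exact hx a (Finset.mem_sdiff.2 ⟨ha, haT⟩)
      rcases x with x | x
      · exact congrArg Sum.inl (Subtype.ext (h _ (hdef (Sum.inl x)) hx))
      · exact congrArg Sum.inr (Subtype.ext (h _ (hdef (Sum.inr x)) hx))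
    supp_smul := by
      intro g x
      rw [hval, leastSupp_smul hs g (hdef x) (by rw [← hval]; exact hdef _),
        Finset.image_sdiff _ _ (MulAction.injective g)]
      congr 1
      ext a
      simp only [Finset.mem_image]
      constructor
      · intro ha
        exact ⟨a, ha, smul_eq_self g ha⟩
      · rintro ⟨b, hb, rfl⟩
        rwa [smul_eq_self g hb]
    supp_subset := by
      intro S x hx
      rw [sdiff_le_iff]
      refine leastSupp_subset hs (hdef x) fun π hπ => ?_
      have := hx (toAutFixing π fun a ha => hπ a (Finset.mem_union_left _ ha)) fun a ha =>
        hπ a (Finset.mem_union_right _ ha)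
      have h2 := hval (toAutFixing π fun a ha => hπ a (Finset.mem_union_left _ ha)) x
      rw [this] at h2
      exact h2.symm
    finite_orbits := by
      intro S
      obtain ⟨K, _, κ, hκ⟩ := exists_finite_orbits (s := s) hfin d v (T ∪ S)
      obtain ⟨K', _, κ', hκ'⟩ := exists_finite_orbits (s := s) hfin e v (T ∪ S)
      refine ⟨K ⊕ K', inferInstance, Sum.map (fun x => κ ⟨x.1, x.2⟩) (fun x => κ' ⟨x.1, x.2⟩), ?_⟩
      rintro (x | x) (y | y) hxy
      · obtain ⟨σ, h1, h2⟩ := hκ _ _ (Sum.inl.inj hxy)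
        exact ⟨toAutFixing σ fun a ha => h1 a (Finset.mem_union_left _ ha),
          fun a ha => h1 a (Finset.mem_union_right _ ha), congrArg Sum.inl (Subtype.ext h2)⟩
      · simp at hxy
      · simp at hxy
      · obtain ⟨σ, h1, h2⟩ := hκ' _ _ (Sum.inr.inj hxy)
        exact ⟨toAutFixing σ fun a ha => h1 a (Finset.mem_union_left _ ha),
          fun a ha => h1 a (Finset.mem_union_right _ ha), congrArg Sum.inr (Subtype.ext h2)⟩ }

/-- Denseness provides injections of the atoms in general position.  They are locally given by
automorphisms since elementary embeddings preserve types. -/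
theorem exists_isGeneric [DecidableEq A] [L.IsRelational] [Countable A] [Nonempty A]
    (s : SymbolNumbering L k)
    (hfin : ∀ n, Finite (Quotient (orbitSetoid L A n))) (hdense : IsDense L A) (T S : Finset A) :
    ∃ H : A → A, IsGeneric (autFixing L T) S H := by
  obtain ⟨H, h1, h2⟩ := hdense T (T ∪ S) Finset.subset_union_left
  refine ⟨H, H.injective, fun U => ?_, fun τ => ?_⟩
  · let a₀ : A := Classical.arbitrary A
    let v : ℕ → A := fun i => (T ∪ U).toList.getD i a₀
    obtain ⟨π, hπ⟩ := SameType.exists_equiv (s := s) hfin (n := (T ∪ U).toList.length) (v := v)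
      (w := H ∘ v) fun φ _ => (Fm.holds_elementaryEmbedding s H φ v).symm
    have hπ' : ∀ a ∈ T ∪ U, π a = H a := by
      intro a ha
      obtain ⟨j, hj, rfl⟩ := List.mem_iff_getElem.1 (Finset.mem_toList.2 ha)
      have := hπ j hj
      simpa only [v, Function.comp_apply, List.getD_eq_getElem _ _ hj] using this
    exact ⟨toAutFixing π fun a ha => (hπ' a (Finset.mem_union_left _ ha)).trans (h1 a ha),
      fun a ha => hπ' a (Finset.mem_union_right _ ha)⟩
  · obtain ⟨τ', h3, -⟩ := exists_equiv_smul τ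
    obtain ⟨E, hE⟩ : ∃ E : A ≃[L] H.toHom.range, ∀ a, ((E a : H.toHom.range) : A) = H a :=
      ⟨H.toEmbedding.equivRange, fun a => H.toEmbedding.equivRange_apply a⟩
    obtain ⟨π, h4, h5⟩ := h2 ((E.comp τ').comp E.symm) fun x hx => by
      obtain ⟨a, rfl⟩ := E.surjective x
      apply Subtype.ext
      rw [FirstOrder.Language.Equiv.comp_apply, FirstOrder.Language.Equiv.comp_apply,
        FirstOrder.Language.Equiv.symm_apply_apply]
      rw [hE] at hx
      have ha : H a = a := H.injective (by rw [h1 _ hx])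
      rw [ha] at hx
      rw [h3, smul_eq_self τ hx]
    refine ⟨toAutFixing π fun a ha => h4 a (Finset.mem_union_left _ ha),
      fun a ha => h4 a (Finset.mem_union_right _ ha), fun a => ?_⟩
    have := h5 (E a)
    rw [hE, FirstOrder.Language.Equiv.comp_apply, FirstOrder.Language.Equiv.comp_apply,
        FirstOrder.Language.Equiv.symm_apply_apply, hE, h3] at this
    exact this

end Invariant

/-! ### Isomorphisms as involutions of a disjoint union -/

section Isomorphisms

variable {L : FirstOrder.Language.{v, w}} {A : Type u} [L.Structure A] {k : ℕ}
  {s : SymbolNumbering L k}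

/-- The binary relation `ρ` between objects is an isomorphism between two structures. -/
structure RelIso (sig : List (HSet A)) (D : HSet A) (I : List (HSet A)) (E : HSet A)
    (J : List (HSet A)) (ρ : HSet A → HSet A → Prop) : Prop where
  mem : ∀ x y, ρ x y → x ∈ D ∧ y ∈ E
  total : ∀ x ∈ D, ∃ y, ρ x y
  surj : ∀ y ∈ E, ∃ x, ρ x y
  inj : ∀ x y x' y', ρ x y → ρ x' y' → (x = x' ↔ y = y')
  rel : ∀ i P R R', sig[i]? = some P → I[i]? = some R → J[i]? = some R' → ∀ σ ∈ P,
    ∀ xs ys : List (HSet A), xs.length = i + 1 → List.Forall₂ ρ xs ys →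
      (HSet.tuple σ xs ∈ R ↔ HSet.tuple σ ys ∈ R')

theorem IsIsomorphism.relIso {sig I J : List (HSet A)} {D E G : HSet A}
    (h : IsIsomorphism sig D I E J G) : RelIso sig D I E J fun x y => HSet.pair x y ∈ G := by
  obtain ⟨⟨h1, h2, h3⟩, h4⟩ := h
  have hmem : ∀ x y, HSet.pair x y ∈ G → x ∈ D ∧ y ∈ E := by
    intro x y hxy
    obtain ⟨x', hx, y', hy, h⟩ := h1 _ hxy
    obtain ⟨rfl, rfl⟩ := HSet.pair_inj.1 h
    exact ⟨hx, hy⟩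
  refine ⟨hmem, fun x hx => (h2 x hx).exists, fun y hy => (h3 y hy).exists, ?_, ?_⟩
  · intro x y x' y' h h'
    constructor
    · rintro rfl
      exact (h2 x (hmem _ _ h).1).unique h h'
    · rintro rfl
      exact (h3 y (hmem _ _ h).2).unique h h'
  · intro i P R R' hP hR hR' σ hσ xs ys hl hxy
    refine h4 i P R R' hP hR hR' σ hσ xs ys hl ?_ hxy
    clear hl
    induction hxy with
    | nil => simp
    | cons h _ ih => exact List.forall_mem_cons.2 ⟨(hmem _ _ h).1, ih⟩

theorem RelIso.isIsomorphism {sig I J : List (HSet A)} {D E G : HSet A}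
    {ρ : HSet A → HSet A → Prop} (h : RelIso sig D I E J ρ)
    (hG : ∀ z, z ∈ G ↔ ∃ x y, ρ x y ∧ z = HSet.pair x y) : IsIsomorphism sig D I E J G := by
  have hpair : ∀ x y, HSet.pair x y ∈ G ↔ ρ x y := by
    intro x y
    rw [hG]
    constructor
    · rintro ⟨x', y', h, h'⟩
      obtain ⟨rfl, rfl⟩ := HSet.pair_inj.1 h'
      exact h
    · exact fun h => ⟨x, y, h, rfl⟩
  refine ⟨⟨fun z hz => ?_, fun x hx => ?_, fun y hy => ?_⟩, ?_⟩
  · obtain ⟨x, y, hxy, rfl⟩ := (hG z).1 hz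
    exact ⟨x, (h.mem _ _ hxy).1, y, (h.mem _ _ hxy).2, rfl⟩
  · obtain ⟨y, hy⟩ := h.total x hx
    exact ⟨y, (hpair _ _).2 hy, fun y' hy' => ((h.inj _ _ _ _ ((hpair _ _).1 hy') hy).1 rfl)⟩
  · obtain ⟨x, hx⟩ := h.surj y hy
    exact ⟨x, (hpair _ _).2 hx, fun x' hx' => ((h.inj _ _ _ _ ((hpair _ _).1 hx') hx).2 rfl)⟩
  · intro i P R R' hP hR hR' σ hσ xs ys hl _ hxy
    simp only [hpair] at hxy
    exact h.rel i P R R' hP hR hR' σ hσ xs ys hl hxy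

/-- The tuple `(σ, zs)` belongs to the relation `R` of the first structure, or to the relation `R'`
of the second one. -/
def InRel {T : Finset A} {D E : HSet A} {hD : Supports L T D} {hE : Supports L T E}
    (R R' σ : HSet A) (zs : List (elems hD ⊕ elems hE)) : Prop :=
  (∃ xs : List (elems hD), zs = xs.map Sum.inl ∧ HSet.tuple σ (xs.map Subtype.val) ∈ R) ∨
    ∃ ys : List (elems hE), zs = ys.map Sum.inr ∧ HSet.tuple σ (ys.map Subtype.val) ∈ R'

theorem InRel.smul {T : Finset A} {D E : HSet A} {hD : Supports L T D} {hE : Supports L T E}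
    {R R' σ : HSet A} (hR : Supports L T R) (hR' : Supports L T R')
    {zs : List (elems hD ⊕ elems hE)} (h : InRel R R' σ zs) (g : autFixing L T) :
    InRel R R' (g • σ) (zs.map fun z => g • z) := by
  rcases h with ⟨xs, rfl, h⟩ | ⟨xs, rfl, h⟩
  · refine Or.inl ⟨xs.map fun x => g • x, by simp [Function.comp_def], ?_⟩
    have := (smul_mem_iff hR g).2 h
    rw [smul_tuple] at this
    simpa [Function.comp_def] using this
  · refine Or.inr ⟨xs.map fun x => g • x, by simp [Function.comp_def], ?_⟩
    have := (smul_mem_iff hR' g).2 h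
    rw [smul_tuple] at this
    simpa [Function.comp_def] using this

/-- An isomorphism between two structures, seen as an involution of the disjoint union of their
universes. -/
structure IsSwap {T : Finset A} {D E : HSet A} (hD : Supports L T D) (hE : Supports L T E)
    (sig I J : List (HSet A)) (f : elems hD ⊕ elems hE → elems hD ⊕ elems hE) : Prop where
  invol : Function.Involutive f
  left : ∀ x, ∃ y, f (Sum.inl x) = Sum.inr y
  right : ∀ y, ∃ x, f (Sum.inr y) = Sum.inl x
  rel : ∀ i P R R', sig[i]? = some P → I[i]? = some R → J[i]? = some R' → ∀ σ ∈ P,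
    ∀ zs, zs.length = i + 1 → InRel R R' σ zs → InRel R R' σ (zs.map f)

variable {T : Finset A} {D E : HSet A} {hD : Supports L T D} {hE : Supports L T E}
  {sig I J : List (HSet A)}

theorem IsSwap.conj (hsig : ∀ P ∈ sig, Supports L T P) (hI : ∀ R ∈ I, Supports L T R)
    (hJ : ∀ R ∈ J, Supports L T R) {f : elems hD ⊕ elems hE → elems hD ⊕ elems hE}
    (hf : IsSwap hD hE sig I J f) (g : autFixing L T) :
    IsSwap hD hE sig I J fun x => g • f (g⁻¹ • x) where
  invol x := by simp [hf.invol (g⁻¹ • x)]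
  left x := by
    obtain ⟨y, hy⟩ := hf.left (g⁻¹ • x)
    exact ⟨g • y, by rw [Sum.smul_inl, hy, Sum.smul_inr]⟩
  right x := by
    obtain ⟨y, hy⟩ := hf.right (g⁻¹ • x)
    exact ⟨g • y, by rw [Sum.smul_inr, hy, Sum.smul_inl]⟩
  rel i P R R' hP hR hR' σ hσ zs hl h := by
    have h1 := hI R (List.mem_of_getElem? hR)
    have h2 := hJ R' (List.mem_of_getElem? hR')
    have h3 := hf.rel i P R R' hP hR hR' (g⁻¹ • σ)
      ((smul_mem_iff (hsig P (List.mem_of_getElem? hP)) _).2 hσ) _ (by simpa using hl)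
      (h.smul h1 h2 g⁻¹)
    have h4 := h3.smul h1 h2 g
    simpa [Function.comp_def] using h4

theorem IsSwap.palindrome {a b : elems hD ⊕ elems hE → elems hD ⊕ elems hE}
    (ha : IsSwap hD hE sig I J a) (hb : IsSwap hD hE sig I J b) :
    IsSwap hD hE sig I J (a ∘ b ∘ a) where
  invol x := by simp [ha.invol _, hb.invol _]
  left x := by
    obtain ⟨y, hy⟩ := ha.left x
    obtain ⟨z, hz⟩ := hb.right y
    obtain ⟨t, ht⟩ := ha.left z
    exact ⟨t, by simp [hy, hz, ht]⟩
  right x := by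
    obtain ⟨y, hy⟩ := ha.right x
    obtain ⟨z, hz⟩ := hb.left y
    obtain ⟨t, ht⟩ := ha.right z
    exact ⟨t, by simp [hy, hz, ht]⟩
  rel i P R R' hP hR hR' σ hσ zs hl h := by
    have h1 := ha.rel i P R R' hP hR hR' σ hσ _ hl h
    have h2 := hb.rel i P R R' hP hR hR' σ hσ _ (by simpa using hl) h1
    have h3 := ha.rel i P R R' hP hR hR' σ hσ _ (by simpa using hl) h2
    simpa [Function.comp_def] using h3

theorem IsSwap.of_locally {g : elems hD ⊕ elems hE → elems hD ⊕ elems hE}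
    (h : ∀ F : Set (elems hD ⊕ elems hE), F.Finite →
      ∃ f, IsSwap hD hE sig I J f ∧ ∀ x ∈ F, g x = f x) : IsSwap hD hE sig I J g where
  invol x := by
    obtain ⟨f, hf, hg⟩ := h {x, g x} (Set.toFinite _)
    rw [hg (g x) (by simp), hg x (by simp), hf.invol]
  left x := by
    obtain ⟨f, hf, hg⟩ := h {Sum.inl x} (Set.toFinite _)
    rw [hg _ rfl]
    exact hf.left x
  right x := by
    obtain ⟨f, hf, hg⟩ := h {Sum.inr x} (Set.toFinite _)
    rw [hg _ rfl]
    exact hf.right x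
  rel i P R R' hP hR hR' σ hσ zs hl h' := by
    obtain ⟨f, hf, hg⟩ := h {z | z ∈ zs} (List.finite_toSet zs)
    rw [List.map_congr_left (g := f) fun z hz => hg z hz]
    exact hf.rel i P R R' hP hR hR' σ hσ zs hl h'

theorem forall₂_map_inl {f : elems hD ⊕ elems hE → elems hD ⊕ elems hE}
    (hf : ∀ x, ∃ y, f (Sum.inl x) = Sum.inr y) {ρ : HSet A → HSet A → Prop}
    (hρ : ∀ x y, f (Sum.inl x) = Sum.inr y → ρ x y) (xs : List (elems hD)) :
    ∃ ys : List (elems hE), (xs.map Sum.inl).map f = ys.map Sum.inr ∧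
      List.Forall₂ ρ (xs.map Subtype.val) (ys.map Subtype.val) := by
  induction xs with
  | nil => exact ⟨[], rfl, .nil⟩
  | cons x xs ih =>
    obtain ⟨ys, h1, h2⟩ := ih
    obtain ⟨y, hy⟩ := hf x
    exact ⟨y :: ys, by simp only [List.map_cons, hy, h1], .cons (hρ _ _ hy) h2⟩

theorem forall₂_map_inr {f : elems hD ⊕ elems hE → elems hD ⊕ elems hE}
    (hf : ∀ y, ∃ x, f (Sum.inr y) = Sum.inl x) {ρ : HSet A → HSet A → Prop}
    (hρ : ∀ x y, f (Sum.inr y) = Sum.inl x → ρ x y) (ys : List (elems hE)) :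
    ∃ xs : List (elems hD), (ys.map Sum.inr).map f = xs.map Sum.inl ∧
      List.Forall₂ ρ (xs.map Subtype.val) (ys.map Subtype.val) := by
  induction ys with
  | nil => exact ⟨[], rfl, .nil⟩
  | cons y ys ih =>
    obtain ⟨xs, h1, h2⟩ := ih
    obtain ⟨x, hx⟩ := hf y
    exact ⟨x :: xs, by simp only [List.map_cons, hx, h1], .cons (hρ _ _ hx) h2⟩

/-- An isomorphism with support `S` gives rise to an involution commuting with the
automorphisms that fix `S`. -/
theorem RelIso.exists_isSwap {ρ : HSet A → HSet A → Prop} (h : RelIso sig D I E J ρ)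
    {S : Finset A} (hS : ∀ π : A ≃[L] A, (∀ a ∈ S, π a = a) → ∀ x y, ρ x y →
      ρ (x.rename π) (y.rename π)) (hD : Supports L T D) (hE : Supports L T E) :
    ∃ f, IsSwap hD hE sig I J f ∧ SupportsMap (autFixing L T) S f := by
  choose t ht using h.total
  choose r hr using h.surj
  let f : elems hD ⊕ elems hE → elems hD ⊕ elems hE :=
    Sum.elim (fun x => Sum.inr ⟨t x.1 x.2, (h.mem _ _ (ht x.1 x.2)).2⟩)
      fun y => Sum.inl ⟨r y.1 y.2, (h.mem _ _ (hr y.1 y.2)).1⟩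
  have hfl : ∀ (x : elems hD) (y : elems hE), ρ x y → f (Sum.inl x) = Sum.inr y :=
    fun x y hxy => congrArg Sum.inr (Subtype.ext ((h.inj _ _ _ _ (ht x.1 x.2) hxy).1 rfl))
  have hfr : ∀ (x : elems hD) (y : elems hE), ρ x y → f (Sum.inr y) = Sum.inl x :=
    fun x y hxy => congrArg Sum.inl (Subtype.ext ((h.inj _ _ _ _ (hr y.1 y.2) hxy).2 rfl))
  have hl : ∀ x, ∃ y, f (Sum.inl x) = Sum.inr y := fun x => ⟨_, rfl⟩
  have hrr : ∀ y, ∃ x, f (Sum.inr y) = Sum.inl x := fun x => ⟨_, rfl⟩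
  refine ⟨f, ⟨?_, hl, hrr, ?_⟩, ?_⟩
  · rintro (x | y)
    · exact hfr x ⟨_, (h.mem _ _ (ht x.1 x.2)).2⟩ (ht x.1 x.2)
    · exact hfl ⟨_, (h.mem _ _ (hr y.1 y.2)).1⟩ y (hr y.1 y.2)
  · intro i P R R' hP hR hR' σ hσ zs hlen hz
    rcases hz with ⟨xs, rfl, hx⟩ | ⟨ys, rfl, hy⟩
    · obtain ⟨ys, h1, h2⟩ := forall₂_map_inl (f := f) (ρ := ρ) hl (fun x y hxy => by
        obtain rfl := Sum.inr.inj hxy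
        exact ht x.1 x.2) xs
      exact Or.inr ⟨ys, h1, (h.rel i P R R' hP hR hR' σ hσ _ _ (by simpa using hlen) h2).1 hx⟩
    · obtain ⟨xs, h1, h2⟩ := forall₂_map_inr (f := f) (ρ := ρ) hrr (fun x y hxy => by
        obtain rfl := Sum.inl.inj hxy
        exact hr y.1 y.2) ys
      refine Or.inl ⟨xs, h1, (h.rel i P R R' hP hR hR' σ hσ _ _ ?_ h2).2 hy⟩
      rw [h2.length_eq]
      simpa using hlen
  · intro g hg x
    obtain ⟨σ, h1, h2⟩ := exists_equiv_smul g
    have hσ : ∀ x y, ρ x y → ρ (g • x) (g • y) := fun x y hxy => by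
      rw [← h2, ← h2]
      exact hS σ (fun a ha => (h1 a).trans (hg a ha)) x y hxy
    rcases x with x | y
    · exact hfl (g • x) (g • ⟨_, (h.mem _ _ (ht x.1 x.2)).2⟩) (hσ _ _ (ht x.1 x.2))
    · exact hfr (g • ⟨_, (h.mem _ _ (hr y.1 y.2)).1⟩) (g • y) (hσ _ _ (hr y.1 y.2))

/-- An equivariant involution exchanging the two structures gives an invariant isomorphism. -/
theorem IsSwap.exists_relIso {f : elems hD ⊕ elems hE → elems hD ⊕ elems hE}
    (hf : IsSwap hD hE sig I J f) (hequi : ∀ (g : autFixing L T) x, f (g • x) = g • f x) :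
    ∃ ρ : HSet A → HSet A → Prop, RelIso sig D I E J ρ ∧
      ∀ π : A ≃[L] A, (∀ a ∈ T, π a = a) → ∀ x y, ρ x y → ρ (x.rename π) (y.rename π) := by
  let ρ : HSet A → HSet A → Prop := fun x y =>
    ∃ (hx : x ∈ D) (hy : y ∈ E), f (Sum.inl ⟨x, hx⟩) = Sum.inr ⟨y, hy⟩
  refine ⟨ρ, ⟨?_, ?_, ?_, ?_, ?_⟩, ?_⟩
  · rintro x y ⟨hx, hy, -⟩
    exact ⟨hx, hy⟩
  · intro x hx
    obtain ⟨y, hy⟩ := hf.left ⟨x, hx⟩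
    exact ⟨y, hx, y.2, hy⟩
  · intro y hy
    obtain ⟨x, hx⟩ := hf.right ⟨y, hy⟩
    exact ⟨x, x.2, hy, by rw [Subtype.coe_eta, ← hx, hf.invol]⟩
  · rintro x y x' y' ⟨hx, hy, h⟩ ⟨hx', hy', h'⟩
    constructor
    · rintro rfl
      rw [h] at h'
      exact congrArg Subtype.val (Sum.inr.inj h')
    · rintro rfl
      rw [← h'] at h
      exact congrArg Subtype.val (Sum.inl.inj (hf.invol.injective h))
  · intro i P R R' hP hR hR' σ hσ xs ys hl hxy
    obtain ⟨xs', ys', rfl, rfl, h⟩ : ∃ (xs' : List (elems hD)) (ys' : List (elems hE)),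
        xs = xs'.map Subtype.val ∧ ys = ys'.map Subtype.val ∧
          (xs'.map Sum.inl).map f = ys'.map Sum.inr := by
      clear hl
      induction hxy with
      | nil => exact ⟨[], [], rfl, rfl, rfl⟩
      | cons h _ ih =>
        obtain ⟨xs', ys', rfl, rfl, h'⟩ := ih
        obtain ⟨hx, hy, h⟩ := h
        exact ⟨⟨_, hx⟩ :: xs', ⟨_, hy⟩ :: ys', rfl, rfl, by simp only [List.map_cons, h, h']⟩
    have hinv : (ys'.map Sum.inr).map f = xs'.map Sum.inl := by
      rw [← h, List.map_map, hf.invol.comp_self, List.map_id]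
    have hl1 : xs'.length = i + 1 := by simpa using hl
    have hl2 : ys'.length = i + 1 := by
      have := congrArg List.length h
      simp only [List.length_map] at this
      omega
    constructor
    · intro hx
      rcases hf.rel i P R R' hP hR hR' σ hσ (xs'.map Sum.inl) (by simpa using hl)
        (Or.inl ⟨xs', rfl, hx⟩) with ⟨zs, h1, h2⟩ | ⟨zs, h1, h2⟩
      · rw [h] at h1
        cases ys' with
        | nil => simp at hl2
        | cons y ys' => cases zs <;> simp at h1
      · rw [h] at h1
        rwa [List.map_injective_iff.2 Sum.inr_injective h1]
    · intro hy
      rcases hf.rel i P R R' hP hR hR' σ hσ (ys'.map Sum.inr) (by simpa using hl2)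
        (Or.inr ⟨ys', rfl, hy⟩) with ⟨zs, h1, h2⟩ | ⟨zs, h1, h2⟩
      · rw [hinv] at h1
        rwa [List.map_injective_iff.2 Sum.inl_injective h1]
      · rw [hinv] at h1
        cases xs' with
        | nil => simp at hl1
        | cons x xs' => cases zs <;> simp at h1
  · rintro π hπ x y ⟨hx, hy, h⟩
    have := hequi (toAutFixing π hπ) (Sum.inl ⟨x, hx⟩)
    rw [h] at this
    exact ⟨((toAutFixing π hπ) • (⟨x, hx⟩ : elems hD)).2,
      ((toAutFixing π hπ) • (⟨y, hy⟩ : elems hE)).2, this⟩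

/-- If there is a definable isomorphism between two definable structures, then there is an
isomorphism that is invariant under all automorphisms that fix the parameters of
the structures. -/
theorem exists_invariant_relIso [L.IsRelational] [Countable A] [Nonempty A]
    (hfin : ∀ n, Finite (Quotient (orbitSetoid L A n))) (hdense : IsDense L A)
    (hs : HasLeastSupports L A s) {d e : SetExpr} {v : ℕ → A}
    (hD : Supports L T (d.eval s v)) (hE : Supports L T (e.eval s v))
    (hsig : ∀ P ∈ sig, Supports L T P) (hI : ∀ R ∈ I, Supports L T R)
    (hJ : ∀ R ∈ J, Supports L T R) {G : HSet A} (hG : IsDefinable s G)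
    (hiso : IsIsomorphism sig (d.eval s v) I (e.eval s v) J G) :
    ∃ ρ : HSet A → HSet A → Prop, RelIso sig (d.eval s v) I (e.eval s v) J ρ ∧
      ∀ π : A ≃[L] A, (∀ a ∈ T, π a = a) → ∀ x y, ρ x y → ρ (x.rename π) (y.rename π) := by
  classical
  obtain ⟨S, hS, -⟩ := hs G hG
  obtain ⟨f, hf, hfS⟩ := hiso.relIso.exists_isSwap (S := S) (fun π hπ x y hxy => by
    have := HSet.mem_rename_of_mem π hxy
    rwa [hS π hπ, HSet.rename_pair] at this) hD hE
  obtain ⟨g, h1, h2⟩ := (supportSystem hs hfin hD hE).exists_equivariant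
    (exists_isGeneric s hfin hdense T) (𝓟 := {f | IsSwap hD hE sig I J f})
    (fun f hf => hf.invol) (fun f hf g => hf.conj hsig hI hJ g)
    (fun a ha b hb => ha.palindrome hb) hf hfS
  exact (IsSwap.of_locally h2).exists_relIso h1

end Isomorphisms

/-! ### A formula for the definable isomorphism problem -/

/-- A formula saying that the members of `sg` are pairwise disjoint. -/
def sigFm (sg : List SetExpr) : Fm :=
  .conj ((List.range sg.length).flatMap fun i => (List.range i).map fun j =>
    allRel (diag (sg.getD j .empty)) (sg.getD i .empty) .empty)

/-- A formula saying that `(d, is)` is a structure over the signature `sg`. -/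
def structFm (sg : List SetExpr) (d : SetExpr) (is : List SetExpr) : Fm :=
  if is.length = sg.length then
    .conj ((List.range sg.length).map fun i => cmp true 1 2 (is.getD i .empty)
      (domRel (prodRel (diag (sg.getD i .empty)) (powRel (diag d) i))))
  else .falsum

/-- A formula saying that `h`, which relates elements of `d` to elements of `e`, is an isomorphism
from `(d, is)` to `(e, js)`. -/
def isoFm (sg : List SetExpr) (d : SetExpr) (is : List SetExpr) (e : SetExpr) (js : List SetExpr)
    (h : RelExpr) : Fm :=
  .conj [cmp true 1 2 d (domRel h), cmp true 1 2 e (ranRel h),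
    allRel (prodRel h h) (graphRel (diag d)) (graphRel (diag e)),
    .conj ((List.range sg.length).map fun i =>
      allRel (prodRel (diag (sg.getD i .empty)) (powRel h i)) (is.getD i .empty)
        (js.getD i .empty))]

/-- The relations between an expression of `d` and an expression of `e` that are
cut out by one of the formulas `χs`. -/
def pieces (d e : SetExpr) (χs : List Fm) : RelExpr :=
  d.branches.flatMap fun b => e.branches.flatMap fun b' => χs.map fun χ =>
    (b.1.ren (copy 1), b'.1.ren (copy 2), b.2.1.map (copy 1) ++ b'.2.1.map (copy 2),
      .and (.and (b.2.2.ren (copy 1)) (b'.2.2.ren (copy 2))) χ)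

/-- All sublists of a list. -/
def subs {α : Type*} (l : List α) : List (List α) :=
  l.foldr (fun a t => t ++ t.map (List.cons a)) [([] : List α)]

theorem filter_mem_subs {α : Type*} (p : α → Bool) (l : List α) : l.filter p ∈ subs l := by
  induction l with
  | nil => simp [subs]
  | cons a l ih =>
    change _ ∈ subs l ++ (subs l).map (List.cons a)
    rw [List.filter_cons]
    split
    · exact List.mem_append_right _ (List.mem_map_of_mem ih)
    · exact List.mem_append_left _ ih

theorem subset_of_mem_subs {α : Type*} {l t : List α} (h : t ∈ subs l) : ∀ a ∈ t, a ∈ l := by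
  induction l generalizing t with
  | nil =>
    obtain rfl : t = [] := by simpa [subs] using h
    simp
  | cons b l ih =>
    rcases List.mem_append.1 (show t ∈ subs l ++ (subs l).map (List.cons b) from h) with h | h
    · exact fun a ha => List.mem_cons_of_mem _ (ih h a ha)
    · obtain ⟨t', h', rfl⟩ := List.mem_map.1 h
      intro a ha
      rcases List.mem_cons.1 ha with rfl | ha
      · exact List.mem_cons_self
      · exact List.mem_cons_of_mem _ (ih h' a ha)

/-- A formula saying that `sg` is a signature and that `(d, is)` and `(e, js)` are structures over
it, and that a union of some of the relations cut out by
the formulas `χs` is an isomorphism. -/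
def problemFm (sg : List SetExpr) (d : SetExpr) (is : List SetExpr) (e : SetExpr)
    (js : List SetExpr) (χs : List Fm) : Fm :=
  .conj [sigFm sg, structFm sg d is, structFm sg e js,
    .disj ((subs (pieces d e χs)).map fun h => isoFm sg d is e js h)]

section Semantics

variable {L : FirstOrder.Language.{v, w}} {A : Type u} [L.Structure A] {k : ℕ}
  {s : SymbolNumbering L k} {v : ℕ → A}

theorem getElem?_map_eval {l : List SetExpr} {i : ℕ} {P : HSet A}
    (h : (l.map fun t => t.eval s v)[i]? = some P) :
    i < l.length ∧ (l.getD i .empty).eval s v = P := by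
  rw [List.getElem?_map, Option.map_eq_some_iff] at h
  obtain ⟨t, ht, rfl⟩ := h
  obtain ⟨hi, rfl⟩ := List.getElem?_eq_some_iff.1 ht
  exact ⟨hi, by rw [List.getD_eq_getElem _ _ hi]⟩

theorem map_eval_getElem? {l : List SetExpr} {i : ℕ} (hi : i < l.length) :
    (l.map fun t => t.eval s v)[i]? = some ((l.getD i .empty).eval s v) := by
  rw [List.getElem?_map, List.getElem?_eq_getElem hi, List.getD_eq_getElem _ _ hi]; rfl

theorem holds_sigFm (hv : Stable v) (sg : List SetExpr) :
    (sigFm sg).Holds s v ↔ IsSignature (sg.map fun t => t.eval s v) := by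
  rw [sigFm, Fm.holds_conj, IsSignature, List.pairwise_iff_getElem]
  simp only [List.mem_flatMap, List.mem_range, List.mem_map, forall_exists_index, and_imp,
    List.length_map, List.getElem_map]
  constructor
  · intro h j i hj hi hji x hx hx'
    have := h _ i hi j hji rfl
    rw [holds_allRel s hv] at this
    refine SetExpr.notMem_eval_empty s v x ((this x x ((rel_diag s _ _ _ _).2 ⟨?_, rfl⟩)).1 ?_)
    · rwa [List.getD_eq_getElem _ _ hj]
    · rwa [List.getD_eq_getElem _ _ hi]
  · rintro h _ i hi j hji rfl
    rw [holds_allRel s hv]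
    intro x y hxy
    obtain ⟨hx, rfl⟩ := (rel_diag s _ _ _ _).1 hxy
    rw [List.getD_eq_getElem _ _ (hji.trans hi)] at hx
    rw [List.getD_eq_getElem _ _ hi]
    exact iff_of_false (h j i (hji.trans hi) hi hji x hx) (SetExpr.notMem_eval_empty s v x)

theorem forall₂_rel_diag {d : SetExpr} {xs ys : List (HSet A)} :
    List.Forall₂ (RelExpr.Rel s (diag d) v) xs ys ↔ (∀ x ∈ xs, x ∈ d.eval s v) ∧ xs = ys := by
  constructor
  · intro h
    induction h with
    | nil => simp
    | cons h _ ih =>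
      obtain ⟨h1, rfl⟩ := (rel_diag s _ _ _ _).1 h
      exact ⟨List.forall_mem_cons.2 ⟨h1, ih.1⟩, by rw [ih.2]⟩
  · rintro ⟨h, rfl⟩
    induction xs with
    | nil => exact .nil
    | cons x xs ih =>
      rw [List.forall_mem_cons] at h
      exact .cons ((rel_diag s _ _ _ _).2 ⟨h.1, rfl⟩) (ih h.2)

theorem holds_structFm (hv : Stable v) (sg : List SetExpr) (d : SetExpr) (is : List SetExpr) :
    (structFm sg d is).Holds s v ↔ IsStructure (sg.map fun t => t.eval s v) (d.eval s v)
      (is.map fun t => t.eval s v) := by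
  rw [structFm, IsStructure, List.length_map, List.length_map]
  split
  · rename_i hlen
    rw [and_iff_right hlen, Fm.holds_conj]
    simp only [List.mem_map, List.mem_range, forall_exists_index, and_imp,
      forall_apply_eq_imp_iff₂, holds_subset s hv, mem_domRel, rel_prodRel_powRel s hv,
      forall₂_rel_diag]
    constructor
    · intro h i P R hP hR z hz
      obtain ⟨hi, rfl⟩ := getElem?_map_eval hP
      obtain ⟨-, rfl⟩ := getElem?_map_eval hR
      obtain ⟨_, σ, hσ, xs, ys, ⟨h1, -⟩, h2, h3, -⟩ := h i hi z hz
      exact ⟨σ, hσ, xs, h2, h1, h3⟩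
    · intro h i hi z hz
      obtain ⟨σ, hσ, xs, h2, h1, h3⟩ :=
        h i _ _ (map_eval_getElem? hi) (map_eval_getElem? (hlen ▸ hi)) z hz
      exact ⟨z, σ, hσ, xs, xs, ⟨h1, rfl⟩, h2, h3, h3⟩
  · rename_i hlen
    simp [hlen]

theorem holds_isoFm (hv : Stable v) {sg : List SetExpr} {d : SetExpr} {is : List SetExpr}
    {e : SetExpr} {js : List SetExpr} (his : is.length = sg.length) (hjs : js.length = sg.length)
    {h : RelExpr} (hh : ∀ x y, RelExpr.Rel s h v x y → x ∈ d.eval s v ∧ y ∈ e.eval s v) :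
    (isoFm sg d is e js h).Holds s v ↔ RelIso (sg.map fun t => t.eval s v) (d.eval s v)
      (is.map fun t => t.eval s v) (e.eval s v) (js.map fun t => t.eval s v)
      (RelExpr.Rel s h v) := by
  rw [isoFm, Fm.holds_conj]
  simp only [List.forall_mem_cons, List.not_mem_nil, false_imp_iff, implies_true, and_true,
    holds_subset s hv, mem_domRel, mem_ranRel, Fm.holds_conj, List.mem_map, List.mem_range,
    forall_exists_index, and_imp, forall_apply_eq_imp_iff₂, holds_allRel s hv]
  have hdiag : ∀ (d : SetExpr) x x', x ∈ d.eval s v →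
      (HSet.pair x x' ∈ (graphRel (diag d)).eval s v ↔ x = x') := by
    intro d x x' hx
    simp only [mem_graphRel, rel_diag]
    constructor
    · rintro ⟨a, _, ⟨-, rfl⟩, h⟩
      obtain ⟨rfl, rfl⟩ := HSet.pair_inj.1 h
      rfl
    · rintro rfl
      exact ⟨x, x, ⟨hx, rfl⟩, rfl⟩
  constructor
  · rintro ⟨h1, h2, h3, h4⟩
    refine ⟨hh, h1, h2, fun x y x' y' hxy hxy' => ?_, ?_⟩
    · have := h3 _ _ ((rel_prodRel s hv _ _ _ _).2 ⟨x, y, x', y', hxy, hxy', rfl, rfl⟩)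
      rwa [hdiag _ _ _ (hh _ _ hxy).1, hdiag _ _ _ (hh _ _ hxy).2] at this
    · intro i P R R' hP hR hR' σ hσ xs ys hl hxy
      obtain ⟨hi, rfl⟩ := getElem?_map_eval hP
      obtain ⟨-, rfl⟩ := getElem?_map_eval hR
      obtain ⟨-, rfl⟩ := getElem?_map_eval hR'
      exact h4 i hi _ _ ((rel_prodRel_powRel s hv _ _ _ _ _).2 ⟨σ, hσ, xs, ys, hxy, hl, rfl, rfl⟩)
  · intro hiso
    refine ⟨hiso.total, hiso.surj, fun z z' hz => ?_, fun i hi z z' hz => ?_⟩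
    · obtain ⟨x, y, x', y', hxy, hxy', rfl, rfl⟩ := (rel_prodRel s hv _ _ _ _).1 hz
      rw [hdiag _ _ _ (hh _ _ hxy).1, hdiag _ _ _ (hh _ _ hxy).2]
      exact hiso.inj _ _ _ _ hxy hxy'
    · obtain ⟨σ, hσ, xs, ys, hxy, hl, rfl, rfl⟩ := (rel_prodRel_powRel s hv _ _ _ _ _).1 hz
      exact hiso.rel i _ _ _ (map_eval_getElem? hi) (map_eval_getElem? (his ▸ hi))
        (map_eval_getElem? (hjs ▸ hi)) σ hσ xs ys hl hxy

variable (L A s) in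
/-- The formulas `χs` define all the orbits of `N`-tuples of atoms, the tuple being given by the
variables below `N`. -/
structure DefinesOrbits (N : ℕ) (χs : List Fm) : Prop where
  orbit : ∀ χ ∈ χs, ∀ v w : ℕ → A, χ.Holds s v → χ.Holds s w →
    ∃ π : A ≃[L] A, ∀ x < N, π (v x) = w x
  cover : ∀ v : ℕ → A, ∃ χ ∈ χs, χ.Holds s v

theorem rel_piece (hv : Stable v) {d e : SetExpr} {χs : List Fm} {p : PairBranch}
    (hp : p ∈ pieces d e χs) {u : ℕ → A} (h1 : ∀ x, x ∉ p.2.2.1 → u x = v x)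
    (h2 : p.2.2.2.Holds s u) : p.1.eval s u ∈ d.eval s v ∧ p.2.1.eval s u ∈ e.eval s v := by
  obtain ⟨b, hb, hp⟩ := List.mem_flatMap.1 hp
  obtain ⟨b', hb', hp⟩ := List.mem_flatMap.1 hp
  obtain ⟨χ, hχ, rfl⟩ := List.mem_map.1 hp
  simp only [Fm.holds_and, Fm.holds_ren s (copy_injective _)] at h2
  obtain ⟨u₁, u₂, h3, h4, h5, h6⟩ := (exists_two_copies b.2.1 b'.2.1 v
    (P := fun u₁ u₂ => u₁ = u ∘ copy 1 ∧ u₂ = u ∘ copy 2)).1 ⟨u, h1, rfl, rfl⟩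
  rw [hv.1] at h3
  rw [hv.2] at h4
  subst h5 h6
  simp only [Body.eval_ren s (copy_injective _)]
  exact ⟨(SetExpr.mem_eval s _ _ _).2 ⟨b, hb, _, h3, h2.1.1, rfl⟩,
    (SetExpr.mem_eval s _ _ _).2 ⟨b', hb', _, h4, h2.1.2, rfl⟩⟩

/-- Every invariant relation between two definable sets is a union of relations that are cut out
by formulas defining orbits. -/
theorem exists_mem_subs_pieces (hv : Stable v) {d e : SetExpr} {χs : List Fm} {N : ℕ}
    (hχs : DefinesOrbits L A s N χs) (hd : 3 * d.code + 2 < N) (he : 3 * e.code + 2 < N)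
    {ρ : HSet A → HSet A → Prop} (hmem : ∀ x y, ρ x y → x ∈ d.eval s v ∧ y ∈ e.eval s v)
    (hρ : ∀ π : A ≃[L] A, (∀ x < N, x % 3 = 0 → π (v x) = v x) → ∀ x y, ρ x y →
      ρ (x.rename π) (y.rename π)) :
    ∃ h ∈ subs (pieces d e χs), ∀ x y, RelExpr.Rel s h v x y ↔ ρ x y := by
  classical
  refine ⟨_, filter_mem_subs (fun p => decide (∃ u : ℕ → A, (∀ x, x ∉ p.2.2.1 → u x = v x) ∧
    p.2.2.2.Holds s u ∧ ρ (p.1.eval s u) (p.2.1.eval s u))) _, fun x y => ⟨?_, fun hxy => ?_⟩⟩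
  · rintro ⟨p, hp, u, h1, h2, rfl, rfl⟩
    rw [List.mem_filter, decide_eq_true_eq] at hp
    obtain ⟨hp, u', h1', h2', h3'⟩ := hp
    obtain ⟨b, hb, hp⟩ := List.mem_flatMap.1 hp
    obtain ⟨b', hb', hp⟩ := List.mem_flatMap.1 hp
    obtain ⟨χ, hχ, rfl⟩ := List.mem_map.1 hp
    obtain ⟨π, hπ⟩ := hχs.orbit χ hχ u' u ((Fm.holds_and s _ _ _).1 h2').2
      ((Fm.holds_and s _ _ _).1 h2).2
    have hfix : ∀ x < N, x % 3 = 0 → π (v x) = v x := by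
      intro x hx hx3
      have hx' : x ∉ b.2.1.map (copy 1) ++ b'.2.1.map (copy 2) := by
        rw [List.mem_append, not_or]
        constructor <;>
        · intro hm
          obtain ⟨y, -, rfl⟩ := List.mem_map.1 hm
          simp only [copy] at hx3
          omega
      rw [← h1' x hx', hπ x hx, h1 x hx', ← h1' x hx']
    have := hρ π hfix _ _ h3'
    simp only [Body.eval_ren s (copy_injective _), Body.rename_eval] at this ⊢
    have hb1 := (SetExpr.code_branches_le hb).1
    have hb2 := (SetExpr.code_branches_le hb').1
    rwa [Body.eval_congr_code s b.1 (v := π ∘ u' ∘ copy 1) (w := u ∘ copy 1) fun x hx => hπ _ (by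
        simp only [copy]; omega),
      Body.eval_congr_code s b'.1 (v := π ∘ u' ∘ copy 2) (w := u ∘ copy 2) fun x hx => hπ _ (by
        simp only [copy]; omega)] at this
  · obtain ⟨hx, hy⟩ := hmem x y hxy
    obtain ⟨b, hb, u₁, h1, h2, rfl⟩ := (SetExpr.mem_eval s _ _ _).1 hx
    obtain ⟨b', hb', u₂, h1', h2', rfl⟩ := (SetExpr.mem_eval s _ _ _).1 hy
    obtain ⟨u, h3, rfl, rfl⟩ := (exists_two_copies b.2.1 b'.2.1 v
      (P := fun w₁ w₂ => w₁ = u₁ ∧ w₂ = u₂)).2 ⟨u₁, u₂, by rwa [hv.1], by rwa [hv.2], rfl, rfl⟩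
    obtain ⟨χ, hχ, hχu⟩ := hχs.cover u
    have hguard : (Fm.and (.and (b.2.2.ren (copy 1)) (b'.2.2.ren (copy 2))) χ).Holds s u := by
      simp only [Fm.holds_and, Fm.holds_ren s (copy_injective _)]
      exact ⟨⟨h2, h2'⟩, hχu⟩
    refine ⟨_, List.mem_filter.2 ⟨List.mem_flatMap.2 ⟨b, hb, List.mem_flatMap.2 ⟨b', hb',
      List.mem_map_of_mem hχ⟩⟩, decide_eq_true ⟨u, h3, hguard, ?_⟩⟩, u, h3, hguard, ?_, ?_⟩
    · simpa only [Body.eval_ren s (copy_injective _)] using hxy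
    · rw [Body.eval_ren s (copy_injective _)]
    · rw [Body.eval_ren s (copy_injective _)]

theorem holds_problemFm [L.IsRelational] [Countable A] [Nonempty A]
    (hfin : ∀ n, Finite (Quotient (orbitSetoid L A n))) (hdense : IsDense L A)
    (hs : HasLeastSupports L A s) (hv : Stable v) {sg : List SetExpr} {d : SetExpr}
    {is : List SetExpr} {e : SetExpr} {js : List SetExpr} {χs : List Fm} {N : ℕ}
    (hχs : DefinesOrbits L A s N χs) (hd : 3 * d.code + 2 < N) (he : 3 * e.code + 2 < N)
    {T : Finset A} (hT : ∀ a ∈ T, ∃ x < N, x % 3 = 0 ∧ v x = a)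
    (hsupp : ∀ t, t ∈ sg ∨ t = d ∨ t ∈ is ∨ t = e ∨ t ∈ js → Supports L T (t.eval s v)) :
    (problemFm sg d is e js χs).Holds s v ↔
      (IsSignature (sg.map fun t => t.eval s v) ∧
        IsStructure (sg.map fun t => t.eval s v) (d.eval s v) (is.map fun t => t.eval s v) ∧
        IsStructure (sg.map fun t => t.eval s v) (e.eval s v) (js.map fun t => t.eval s v)) ∧
      ∃ G : HSet A, IsDefinable s G ∧ IsIsomorphism (sg.map fun t => t.eval s v) (d.eval s v)
        (is.map fun t => t.eval s v) (e.eval s v) (js.map fun t => t.eval s v) G := by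
  rw [problemFm, Fm.holds_conj]
  simp only [List.forall_mem_cons, List.not_mem_nil, false_imp_iff, implies_true, and_true,
    holds_sigFm hv, holds_structFm hv, Fm.holds_disj, List.mem_map, exists_exists_and_eq_and]
  rw [← and_assoc, ← and_assoc, ← and_assoc]
  refine and_congr_right fun hvalid => ?_
  have his : is.length = sg.length := by simpa using hvalid.1.2.1
  have hjs : js.length = sg.length := by simpa using hvalid.2.1
  have hsub : ∀ h ∈ subs (pieces d e χs), ∀ x y, RelExpr.Rel s h v x y →
      x ∈ d.eval s v ∧ y ∈ e.eval s v := by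
    rintro h hh _ _ ⟨p, hp, u, h1, h2, rfl, rfl⟩
    exact rel_piece hv (subset_of_mem_subs hh p hp) h1 h2
  constructor
  · rintro ⟨h, hh, hiso⟩
    rw [holds_isoFm hv his hjs (hsub h hh)] at hiso
    exact ⟨(graphRel h).eval s v, ⟨v, Or.inr ⟨_, rfl⟩⟩, hiso.isIsomorphism (mem_graphRel s h v)⟩
  · rintro ⟨G, hG, hiso⟩
    have hmap : ∀ l : List SetExpr, (∀ t ∈ l, Supports L T (t.eval s v)) →
        ∀ P ∈ l.map fun t => t.eval s v, Supports L T P := by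
      intro l hl P hP
      obtain ⟨t, ht, rfl⟩ := List.mem_map.1 hP
      exact hl t ht
    obtain ⟨ρ, hρ, hinv⟩ := exists_invariant_relIso hfin hdense hs (T := T)
      (hsupp d (by simp)) (hsupp e (by simp)) (hmap sg fun t ht => hsupp t (by simp [ht]))
      (hmap is fun t ht => hsupp t (by simp [ht])) (hmap js fun t ht => hsupp t (by simp [ht]))
      hG hiso
    obtain ⟨h, hh, hrel⟩ := exists_mem_subs_pieces hv hχs hd he hρ.mem fun π hπ =>
      hinv π fun a ha => by
        obtain ⟨x, hx, hx3, rfl⟩ := hT a ha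
        exact hπ x hx hx3
    refine ⟨h, hh, (holds_isoFm hv his hjs (hsub h hh)).2 ?_⟩
    rwa [show RelExpr.Rel s h v = ρ from funext₂ fun x y => propext (hrel x y)]

end Semantics

/-! ### Primitive recursive functions on formulas and expressions -/

attribute [fun_prop] Primrec Primrec.id Primrec.const Primrec.comp

section Basic

variable {α β γ σ : Type*} [Primcodable α] [Primcodable β] [Primcodable γ] [Primcodable σ]

@[fun_prop]
theorem primrec_fst {f : α → β × γ} (hf : Primrec f) : Primrec fun a => (f a).1 :=
  Primrec.fst.comp hf

@[fun_prop]
theorem primrec_snd {f : α → β × γ} (hf : Primrec f) : Primrec fun a => (f a).2 :=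
  Primrec.snd.comp hf

@[fun_prop]
theorem primrec_pair {f : α → β} {g : α → γ} (hf : Primrec f) (hg : Primrec g) :
    Primrec fun a => (f a, g a) := Primrec.pair hf hg

@[fun_prop]
theorem primrec_inl {f : α → β} (hf : Primrec f) : Primrec fun a => (Sum.inl (f a) : β ⊕ γ) :=
  Primrec.sumInl.comp hf

@[fun_prop]
theorem primrec_inr {f : α → γ} (hf : Primrec f) : Primrec fun a => (Sum.inr (f a) : β ⊕ γ) :=
  Primrec.sumInr.comp hf

@[fun_prop]
theorem primrec_sumElim {f : α → β ⊕ γ} {g : α → β → σ} {h : α → γ → σ} (hf : Primrec f)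
    (hg : Primrec fun p : α × β => g p.1 p.2) (hh : Primrec fun p : α × γ => h p.1 p.2) :
    Primrec fun a => Sum.elim (g a) (h a) (f a) :=
  (Primrec.sumCasesOn hf hg hh).of_eq fun a => by cases f a <;> rfl

@[fun_prop]
theorem primrec_add {f g : α → ℕ} (hf : Primrec f) (hg : Primrec g) :
    Primrec fun a => f a + g a := Primrec.nat_add.comp hf hg

@[fun_prop]
theorem primrec_mul {f g : α → ℕ} (hf : Primrec f) (hg : Primrec g) :
    Primrec fun a => f a * g a := Primrec.nat_mul.comp hf hg

@[fun_prop]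
theorem primrec_div {f g : α → ℕ} (hf : Primrec f) (hg : Primrec g) :
    Primrec fun a => f a / g a := Primrec.nat_div.comp hf hg

@[fun_prop]
theorem primrec_mod {f g : α → ℕ} (hf : Primrec f) (hg : Primrec g) :
    Primrec fun a => f a % g a := Primrec.nat_mod.comp hf hg

@[fun_prop]
theorem primrec_natPair {f g : α → ℕ} (hf : Primrec f) (hg : Primrec g) :
    Primrec fun a => Nat.pair (f a) (g a) := Primrec₂.natPair.comp hf hg

@[fun_prop]
theorem primrec_unpair {f : α → ℕ} (hf : Primrec f) : Primrec fun a => (f a).unpair :=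
  Primrec.unpair.comp hf

@[fun_prop]
theorem primrec_encode {f : α → β} (hf : Primrec f) : Primrec fun a => Encodable.encode (f a) :=
  Primrec.encode.comp hf

@[fun_prop]
theorem primrec_ofNat {δ : Type*} [Denumerable δ] {f : α → ℕ} (hf : Primrec f) :
    Primrec fun a => Denumerable.ofNat δ (f a) := (Primrec.ofNat δ).comp hf

@[fun_prop]
theorem primrec_ite_eq {f g : α → ℕ} {h h' : α → σ} (hf : Primrec f) (hg : Primrec g)
    (hh : Primrec h) (hh' : Primrec h') : Primrec fun a => if f a = g a then h a else h' a :=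
  Primrec.ite (Primrec.eq.comp hf hg) hh hh'

@[fun_prop]
theorem primrec_cond {f : α → Bool} {g h : α → σ} (hf : Primrec f) (hg : Primrec g)
    (hh : Primrec h) : Primrec fun a => cond (f a) (g a) (h a) := Primrec.cond hf hg hh

@[fun_prop]
theorem primrec_cons {f : α → β} {g : α → List β} (hf : Primrec f) (hg : Primrec g) :
    Primrec fun a => f a :: g a := Primrec.list_cons.comp hf hg

@[fun_prop]
theorem primrec_append {f g : α → List β} (hf : Primrec f) (hg : Primrec g) :
    Primrec fun a => f a ++ g a := Primrec.list_append.comp hf hg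

@[fun_prop]
theorem primrec_map {f : α → List β} {g : α → β → σ} (hf : Primrec f)
    (hg : Primrec fun p : α × β => g p.1 p.2) : Primrec fun a => (f a).map (g a) :=
  Primrec.list_map hf hg

@[fun_prop]
theorem primrec_flatMap {f : α → List β} {g : α → β → List σ} (hf : Primrec f)
    (hg : Primrec fun p : α × β => g p.1 p.2) : Primrec fun a => (f a).flatMap (g a) :=
  Primrec.list_flatMap hf hg

@[fun_prop]
theorem primrec_foldr {f : α → List β} {g : α → σ} {h : α → β → σ → σ} (hf : Primrec f)
    (hg : Primrec g) (hh : Primrec fun p : α × β × σ => h p.1 p.2.1 p.2.2) :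
    Primrec fun a => (f a).foldr (h a) (g a) :=
  Primrec.list_foldr (h := fun a p => h a p.1 p.2) hf hg hh

@[fun_prop]
theorem primrec_range {f : α → ℕ} (hf : Primrec f) : Primrec fun a => List.range (f a) :=
  Primrec.list_range.comp hf

@[fun_prop]
theorem primrec_length {f : α → List β} (hf : Primrec f) : Primrec fun a => (f a).length :=
  Primrec.list_length.comp hf

@[fun_prop]
theorem primrec_getD {f : α → List β} {g : α → ℕ} {d : β} (hf : Primrec f) (hg : Primrec g) :
    Primrec fun a => (f a).getD (g a) d := (Primrec.list_getD d).comp hf hg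

/-- Primitive recursion along a measure: the values of `f` at finitely many smaller arguments `l b`
determine `f b`. -/
theorem primrec_of_recursive (f : β → σ) {m : β → ℕ} {l : β → List β} {g : β → List σ → σ}
    (hm : Primrec m) (hl : Primrec l) (hg : Primrec fun p : β × List σ => g p.1 p.2)
    (hlt : ∀ b, ∀ b' ∈ l b, m b' < m b) (h : ∀ b, g b ((l b).map f) = f b) : Primrec f :=
  Primrec.nat_omega_rec' (g := fun b t => some (g b t)) f hm hl (Primrec.option_some.comp hg) hlt
    fun b => congrArg some (h b)

end Basic

section Formulas

variable {α σ : Type*} [Primcodable α] [Primcodable σ]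

namespace Fm

theorem ofNat_code (φ : Fm) : Denumerable.ofNat Fm φ.code = φ :=
  Denumerable.ofNat_encode φ

@[fun_prop]
theorem primrec_eq {f g : α → ℕ} (hf : Primrec f) (hg : Primrec g) :
    Primrec fun a => Fm.eq (f a) (g a) :=
  Primrec.encode_iff.1 (show Primrec fun a => 4 * Nat.pair (f a) (g a) + 1 by fun_prop)

@[fun_prop]
theorem primrec_rel {f : α → ℕ} {g : α → List ℕ} (hf : Primrec f) (hg : Primrec g) :
    Primrec fun a => Fm.rel (f a) (g a) :=
  Primrec.encode_iff.1
    (show Primrec fun a => 4 * Nat.pair (f a) (Encodable.encode (g a)) + 2 by fun_prop)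

@[fun_prop]
theorem primrec_imp {f g : α → Fm} (hf : Primrec f) (hg : Primrec g) :
    Primrec fun a => Fm.imp (f a) (g a) :=
  Primrec.encode_iff.1 (show Primrec fun a =>
    4 * Nat.pair (Encodable.encode (f a)) (Encodable.encode (g a)) + 3 by fun_prop)

@[fun_prop]
theorem primrec_all {f : α → ℕ} {g : α → Fm} (hf : Primrec f) (hg : Primrec g) :
    Primrec fun a => Fm.all (f a) (g a) :=
  Primrec.encode_iff.1
    (show Primrec fun a => 4 * Nat.pair (f a) (Encodable.encode (g a)) + 4 by fun_prop)

@[fun_prop]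
theorem primrec_casesOn {f : α → Fm} {a : α → σ} {b : α → ℕ → ℕ → σ} {c : α → ℕ → List ℕ → σ}
    {d : α → Fm → Fm → σ} {e : α → ℕ → Fm → σ} (hf : Primrec f) (ha : Primrec a)
    (hb : Primrec fun p : α × ℕ × ℕ => b p.1 p.2.1 p.2.2)
    (hc : Primrec fun p : α × ℕ × List ℕ => c p.1 p.2.1 p.2.2)
    (hd : Primrec fun p : α × Fm × Fm => d p.1 p.2.1 p.2.2)
    (he : Primrec fun p : α × ℕ × Fm => e p.1 p.2.1 p.2.2) :
    Primrec fun x => (f x).casesOn (motive := fun _ => σ) (a x) (b x) (c x) (d x) (e x) := by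
  have key : Primrec₂ fun (x : α) (m : ℕ) =>
      if m % 4 = 0 then b x (m / 4).unpair.1 (m / 4).unpair.2
      else if m % 4 = 1 then
        c x (m / 4).unpair.1 (Denumerable.ofNat (List ℕ) (m / 4).unpair.2)
      else if m % 4 = 2 then
        d x (Denumerable.ofNat Fm (m / 4).unpair.1) (Denumerable.ofNat Fm (m / 4).unpair.2)
      else e x (m / 4).unpair.1 (Denumerable.ofNat Fm (m / 4).unpair.2) := by
    refine primrec_ite_eq (by fun_prop) (by fun_prop) ?_ (primrec_ite_eq (by fun_prop)
      (by fun_prop) ?_ (primrec_ite_eq (by fun_prop) (by fun_prop) ?_ ?_))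
    · exact hb.comp (g := fun p : α × ℕ => (p.1, (p.2 / 4).unpair)) (by fun_prop)
    · exact hc.comp (g := fun p : α × ℕ =>
        (p.1, (p.2 / 4).unpair.1, Denumerable.ofNat (List ℕ) (p.2 / 4).unpair.2)) (by fun_prop)
    · exact hd.comp (g := fun p : α × ℕ => (p.1, Denumerable.ofNat Fm (p.2 / 4).unpair.1,
        Denumerable.ofNat Fm (p.2 / 4).unpair.2)) (by fun_prop)
    · exact he.comp (g := fun p : α × ℕ =>
        (p.1, (p.2 / 4).unpair.1, Denumerable.ofNat Fm (p.2 / 4).unpair.2)) (by fun_prop)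
  refine (Primrec.nat_casesOn (Primrec.encode.comp hf) ha key).of_eq fun x => ?_
  cases f x with
  | falsum => rfl
  | eq y z =>
    change (if (4 * Nat.pair y z) % 4 = 0 then _ else _ : σ) = _
    rw [if_pos (by omega), Nat.mul_div_cancel_left _ (by omega), Nat.unpair_pair]
  | rel i xs =>
    change (if (4 * Nat.pair i (Encodable.encode xs) + 1) % 4 = 0 then _ else _ : σ) = _
    rw [if_neg (by omega), if_pos (by omega), show (4 * Nat.pair i (Encodable.encode xs) + 1) / 4 =
      Nat.pair i (Encodable.encode xs) by omega, Nat.unpair_pair, Denumerable.ofNat_encode]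
  | imp φ ψ =>
    change (if (4 * Nat.pair φ.code ψ.code + 2) % 4 = 0 then _
      else _ : σ) = _
    rw [if_neg (by omega), if_neg (by omega), if_pos (by omega),
      show (4 * Nat.pair φ.code ψ.code + 2) / 4 =
      Nat.pair φ.code ψ.code by omega, Nat.unpair_pair,
      ofNat_code, ofNat_code]
  | all y φ =>
    change (if (4 * Nat.pair y φ.code + 3) % 4 = 0 then _ else _ : σ) = _
    rw [if_neg (by omega), if_neg (by omega), if_neg (by omega),
      show (4 * Nat.pair y φ.code + 3) / 4 =
      Nat.pair y φ.code by omega, Nat.unpair_pair, ofNat_code]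

@[fun_prop]
theorem primrec_not {f : α → Fm} (hf : Primrec f) : Primrec fun a => Fm.not (f a) :=
  primrec_imp hf (Primrec.const _)

@[fun_prop]
theorem primrec_and {f g : α → Fm} (hf : Primrec f) (hg : Primrec g) :
    Primrec fun a => Fm.and (f a) (g a) := by
  unfold Fm.and; fun_prop

@[fun_prop]
theorem primrec_conj {f : α → List Fm} (hf : Primrec f) : Primrec fun a => Fm.conj (f a) := by
  unfold Fm.conj; fun_prop

@[fun_prop]
theorem primrec_disj {f : α → List Fm} (hf : Primrec f) : Primrec fun a => Fm.disj (f a) := by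
  unfold Fm.disj; fun_prop

@[fun_prop]
theorem primrec_alls {f : α → List ℕ} {g : α → Fm} (hf : Primrec f) (hg : Primrec g) :
    Primrec fun a => Fm.alls (f a) (g a) := by
  unfold Fm.alls; fun_prop

@[fun_prop]
theorem primrec_exs {f : α → List ℕ} {g : α → Fm} (hf : Primrec f) (hg : Primrec g) :
    Primrec fun a => Fm.exs (f a) (g a) := by
  unfold Fm.exs; fun_prop

end Fm

@[fun_prop]
theorem primrec_copy {f g : α → ℕ} (hf : Primrec f) (hg : Primrec g) :
    Primrec fun a => copy (f a) (g a) := by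
  unfold copy; fun_prop

namespace Fm

theorem primrec_ren_copy : Primrec fun p : ℕ × Fm => p.2.ren (copy p.1) := by
  refine primrec_of_recursive _ (m := fun p => Encodable.encode p.2)
    (l := fun p => p.2.casesOn (motive := fun _ => List (ℕ × Fm)) [] (fun _ _ => [])
      (fun _ _ => []) (fun φ ψ => [(p.1, φ), (p.1, ψ)]) (fun _ φ => [(p.1, φ)]))
    (g := fun p t => p.2.casesOn (motive := fun _ => Fm) falsum
      (fun x y => .eq (copy p.1 x) (copy p.1 y)) (fun i xs => .rel i (xs.map fun x => copy p.1 x))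
      (fun _ _ => .imp (t.getD 0 falsum) (t.getD 1 falsum))
      (fun x _ => .all (copy p.1 x) (t.getD 0 falsum)))
    (by fun_prop) (by fun_prop) (by fun_prop) ?_ ?_
  · rintro ⟨c, φ⟩ b hb
    cases φ with
    | falsum => simp at hb
    | eq x y => simp at hb
    | rel i xs => simp at hb
    | imp φ ψ =>
      have h1 := Nat.left_le_pair φ.code ψ.code
      have h2 := Nat.right_le_pair φ.code ψ.code
      simp only [List.mem_cons, List.not_mem_nil, or_false] at hb
      rcases hb with rfl | rfl
      · change φ.code < 4 * _ + 3
        omega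
      · change ψ.code < 4 * _ + 3
        omega
    | all x φ =>
      have h2 := Nat.right_le_pair x φ.code
      simp only [List.mem_cons, List.not_mem_nil, or_false] at hb
      subst hb
      change φ.code < 4 * _ + 4
      omega
  · rintro ⟨c, φ⟩
    cases φ <;> rfl

@[fun_prop]
theorem primrec_ren {f : α → ℕ} {g : α → Fm} (hf : Primrec f) (hg : Primrec g) :
    Primrec fun a => (g a).ren (copy (f a)) :=
  primrec_ren_copy.comp (g := fun a => (f a, g a)) (by fun_prop)

end Fm

end Formulas

section Expressions

variable {α σ : Type*} [Primcodable α] [Primcodable σ]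

namespace SetExpr

theorem ofNat_code (e : SetExpr) : Denumerable.ofNat SetExpr e.code = e :=
  Denumerable.ofNat_encode e

@[fun_prop]
theorem primrec_consVar {f : α → ℕ} {g : α → List ℕ} {h : α → Fm} {r : α → SetExpr}
    (hf : Primrec f) (hg : Primrec g) (hh : Primrec h) (hr : Primrec r) :
    Primrec fun a => consVar (f a) (g a) (h a) (r a) :=
  Primrec.encode_iff.1 (show Primrec fun a => 2 * Nat.pair
    (Nat.pair (f a) (Encodable.encode (r a)))
    (Nat.pair (Encodable.encode (g a)) (Encodable.encode (h a))) + 1 by fun_prop)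

@[fun_prop]
theorem primrec_consSet {f : α → SetExpr} {g : α → List ℕ} {h : α → Fm} {r : α → SetExpr}
    (hf : Primrec f) (hg : Primrec g) (hh : Primrec h) (hr : Primrec r) :
    Primrec fun a => consSet (f a) (g a) (h a) (r a) :=
  Primrec.encode_iff.1 (show Primrec fun a => 2 * Nat.pair
    (Nat.pair (Encodable.encode (f a)) (Encodable.encode (r a)))
    (Nat.pair (Encodable.encode (g a)) (Encodable.encode (h a))) + 2 by fun_prop)

@[fun_prop]
theorem primrec_casesOn {f : α → SetExpr} {a : α → σ} {b : α → ℕ → List ℕ → Fm → SetExpr → σ}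
    {c : α → SetExpr → List ℕ → Fm → SetExpr → σ} (hf : Primrec f) (ha : Primrec a)
    (hb : Primrec fun p : α × ℕ × List ℕ × Fm × SetExpr =>
      b p.1 p.2.1 p.2.2.1 p.2.2.2.1 p.2.2.2.2)
    (hc : Primrec fun p : α × SetExpr × List ℕ × Fm × SetExpr =>
      c p.1 p.2.1 p.2.2.1 p.2.2.2.1 p.2.2.2.2) :
    Primrec fun x => (f x).casesOn (motive := fun _ => σ) (a x) (b x) (c x) := by
  have key : Primrec₂ fun (x : α) (m : ℕ) =>
      if m % 2 = 0 then b x (m / 2).unpair.1.unpair.1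
        (Denumerable.ofNat (List ℕ) (m / 2).unpair.2.unpair.1)
        (Denumerable.ofNat Fm (m / 2).unpair.2.unpair.2)
        (Denumerable.ofNat SetExpr (m / 2).unpair.1.unpair.2)
      else c x (Denumerable.ofNat SetExpr (m / 2).unpair.1.unpair.1)
        (Denumerable.ofNat (List ℕ) (m / 2).unpair.2.unpair.1)
        (Denumerable.ofNat Fm (m / 2).unpair.2.unpair.2)
        (Denumerable.ofNat SetExpr (m / 2).unpair.1.unpair.2) := by
    refine primrec_ite_eq (by fun_prop) (by fun_prop) ?_ ?_
    · exact hb.comp (g := fun p : α × ℕ => (p.1, (p.2 / 2).unpair.1.unpair.1,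
        Denumerable.ofNat (List ℕ) (p.2 / 2).unpair.2.unpair.1,
        Denumerable.ofNat Fm (p.2 / 2).unpair.2.unpair.2,
        Denumerable.ofNat SetExpr (p.2 / 2).unpair.1.unpair.2)) (by fun_prop)
    · exact hc.comp (g := fun p : α × ℕ => (p.1,
        Denumerable.ofNat SetExpr (p.2 / 2).unpair.1.unpair.1,
        Denumerable.ofNat (List ℕ) (p.2 / 2).unpair.2.unpair.1,
        Denumerable.ofNat Fm (p.2 / 2).unpair.2.unpair.2,
        Denumerable.ofNat SetExpr (p.2 / 2).unpair.1.unpair.2)) (by fun_prop)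
  refine (Primrec.nat_casesOn (Primrec.encode.comp hf) ha key).of_eq fun x => ?_
  cases f x with
  | empty => rfl
  | consVar y as φ r =>
    change (if (2 * Nat.pair (Nat.pair y r.code)
      (Nat.pair (Encodable.encode as) (Encodable.encode φ))) % 2 = 0 then _ else _ : σ) = _
    rw [if_pos (by omega), Nat.mul_div_cancel_left _ (by omega)]
    simp only [Nat.unpair_pair, Denumerable.ofNat_encode,
      ofNat_code]
  | consSet e as φ r =>
    change (if (2 * Nat.pair (Nat.pair e.code r.code)
      (Nat.pair (Encodable.encode as) (Encodable.encode φ)) + 1) % 2 = 0 then _ else _ : σ) = _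
    rw [if_neg (by omega), show (2 * Nat.pair (Nat.pair e.code r.code)
      (Nat.pair (Encodable.encode as) (Encodable.encode φ)) + 1) / 2 = Nat.pair
      (Nat.pair e.code r.code)
      (Nat.pair (Encodable.encode as) (Encodable.encode φ)) by omega]
    simp only [Nat.unpair_pair, Denumerable.ofNat_encode,
      ofNat_code]

theorem code_lt_consVar (x : ℕ) (as : List ℕ) (φ : Fm) (r : SetExpr) :
    r.code < (consVar x as φ r).code := by
  have h1 := Nat.right_le_pair x r.code
  have h2 := Nat.left_le_pair (Nat.pair x r.code)
    (Nat.pair (Encodable.encode as) (Encodable.encode φ))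
  rw [code]
  omega

theorem code_lt_consSet (e : SetExpr) (as : List ℕ) (φ : Fm) (r : SetExpr) :
    e.code < (consSet e as φ r).code ∧ r.code < (consSet e as φ r).code := by
  have h0 := Nat.left_le_pair e.code r.code
  have h1 := Nat.right_le_pair e.code r.code
  have h2 := Nat.left_le_pair (Nat.pair e.code r.code)
    (Nat.pair (Encodable.encode as) (Encodable.encode φ))
  rw [code]
  omega

theorem primrec_ren_copy : Primrec fun p : ℕ × SetExpr => p.2.ren (copy p.1) := by
  refine primrec_of_recursive _ (m := fun p => Encodable.encode p.2)
    (l := fun p => p.2.casesOn (motive := fun _ => List (ℕ × SetExpr)) []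
      (fun _ _ _ r => [(p.1, r)]) (fun e _ _ r => [(p.1, e), (p.1, r)]))
    (g := fun p t => p.2.casesOn (motive := fun _ => SetExpr) empty
      (fun x as φ _ => consVar (copy p.1 x) (as.map fun x => copy p.1 x) (φ.ren (copy p.1))
        (t.getD 0 empty))
      (fun _ as φ _ => consSet (t.getD 0 empty) (as.map fun x => copy p.1 x) (φ.ren (copy p.1))
        (t.getD 1 empty)))
    (by fun_prop) (by fun_prop) (by fun_prop) ?_ ?_
  · rintro ⟨c, e⟩ b hb
    cases e with
    | empty => simp at hb
    | consVar x as φ r =>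
      obtain rfl : b = (c, r) := by simpa using hb
      exact code_lt_consVar x as φ r
    | consSet e as φ r =>
      simp only [List.mem_cons, List.not_mem_nil, or_false] at hb
      rcases hb with rfl | rfl
      · exact (code_lt_consSet e as φ r).1
      · exact (code_lt_consSet e as φ r).2
  · rintro ⟨c, e⟩
    cases e <;> rfl

@[fun_prop]
theorem primrec_ren {f : α → ℕ} {g : α → SetExpr} (hf : Primrec f) (hg : Primrec g) :
    Primrec fun a => (g a).ren (copy (f a)) :=
  primrec_ren_copy.comp (g := fun a => (f a, g a)) (by fun_prop)

theorem primrec_branches_aux : Primrec branches := by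
  refine primrec_of_recursive _ (m := fun e => Encodable.encode e)
    (l := fun e => e.casesOn (motive := fun _ => List SetExpr) []
      (fun _ _ _ r => [r]) (fun _ _ _ r => [r]))
    (g := fun e t => e.casesOn (motive := fun _ => List Branch) []
      (fun x as φ _ => (Sum.inl x, as, φ) :: t.getD 0 [])
      (fun e as φ _ => (Sum.inr e, as, φ) :: t.getD 0 []))
    (by fun_prop) (by fun_prop) (by fun_prop) ?_ ?_
  · intro e b hb
    cases e with
    | empty => simp at hb
    | consVar x as φ r =>
      obtain rfl : b = r := by simpa using hb
      exact code_lt_consVar x as φ b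
    | consSet e as φ r =>
      obtain rfl : b = r := by simpa using hb
      exact (code_lt_consSet e as φ b).2
  · intro e
    cases e <;> rfl

@[fun_prop]
theorem primrec_branches {f : α → SetExpr} (hf : Primrec f) : Primrec fun a => (f a).branches :=
  primrec_branches_aux.comp hf

@[fun_prop]
theorem primrec_ofBranches {f : α → List Branch} (hf : Primrec f) :
    Primrec fun a => ofBranches (f a) := by
  unfold ofBranches SetExpr.cons; fun_prop

end SetExpr

@[fun_prop]
theorem Body.primrec_ren {f : α → ℕ} {g : α → Body} (hf : Primrec f) (hg : Primrec g) :
    Primrec fun a => (g a).ren (copy (f a)) := by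
  have : Primrec fun a => Sum.elim (fun x => (Sum.inl (copy (f a) x) : Body))
      (fun e => Sum.inr (e.ren (copy (f a)))) (g a) := by fun_prop
  exact this.of_eq fun a => by cases g a <;> rfl

theorem primrec_memVar_aux : Primrec fun p : (ℕ × ℕ × ℕ) × SetExpr =>
    memVar p.1.1 p.1.2.1 p.1.2.2 p.2 := by
  refine primrec_of_recursive _ (m := fun p => Encodable.encode p.2)
    (l := fun p => p.2.casesOn (motive := fun _ => List ((ℕ × ℕ × ℕ) × SetExpr)) []
      (fun _ _ _ r => [(p.1, r)]) (fun _ _ _ r => [(p.1, r)]))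
    (g := fun p t => p.2.casesOn (motive := fun _ => Fm) .falsum
      (fun y as φ _ => .disj [.exs (as.map fun x => copy p.1.2.1 x)
        (.and (φ.ren (copy p.1.2.1)) (.eq (copy p.1.1 p.1.2.2) (copy p.1.2.1 y))),
        t.getD 0 .falsum])
      (fun _ _ _ _ => t.getD 0 .falsum))
    (by fun_prop) (by fun_prop) (by fun_prop) ?_ ?_
  · rintro ⟨c, e⟩ b hb
    cases e with
    | empty => simp at hb
    | consVar x as φ r =>
      obtain rfl : b = (c, r) := by simpa using hb
      exact SetExpr.code_lt_consVar x as φ r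
    | consSet e as φ r =>
      obtain rfl : b = (c, r) := by simpa using hb
      exact (SetExpr.code_lt_consSet e as φ r).2
  · rintro ⟨c, e⟩
    cases e <;> rfl

@[fun_prop]
theorem primrec_memVar {f g h : α → ℕ} {e : α → SetExpr} (hf : Primrec f) (hg : Primrec g)
    (hh : Primrec h) (he : Primrec e) : Primrec fun a => memVar (f a) (g a) (h a) (e a) :=
  primrec_memVar_aux.comp (g := fun a => ((f a, g a, h a), e a)) (by fun_prop)

theorem primrec_cmp_aux : Primrec fun p : Bool × (ℕ × ℕ) × SetExpr × SetExpr =>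
    cmp p.1 p.2.1.1 p.2.1.2 p.2.2.1 p.2.2.2 := by
  refine primrec_of_recursive _
    (m := fun p => Encodable.encode p.2.2.1 + Encodable.encode p.2.2.2)
    (l := fun p => cond p.1
      (p.2.2.1.casesOn (motive := fun _ => List (Bool × (ℕ × ℕ) × SetExpr × SetExpr)) []
        (fun _ _ _ r => [(true, p.2.1, r, p.2.2.2)])
        (fun e _ _ r => [(false, p.2.1, e, p.2.2.2), (true, p.2.1, r, p.2.2.2)]))
      (p.2.2.2.casesOn (motive := fun _ => List (Bool × (ℕ × ℕ) × SetExpr × SetExpr)) []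
        (fun _ _ _ r => [(false, p.2.1, p.2.2.1, r)])
        (fun e' _ _ r => [(true, p.2.1, p.2.2.1, e'), (true, (p.2.1.2, p.2.1.1), e', p.2.2.1),
          (false, p.2.1, p.2.2.1, r)])))
    (g := fun p t => cond p.1
      (p.2.2.1.casesOn (motive := fun _ => Fm) (.not .falsum)
        (fun x as φ _ => .and (.alls (as.map fun x => copy p.2.1.1 x)
          (.imp (φ.ren (copy p.2.1.1)) (memVar p.2.1.1 p.2.1.2 x p.2.2.2))) (t.getD 0 .falsum))
        (fun _ as φ _ => .and (.alls (as.map fun x => copy p.2.1.1 x)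
          (.imp (φ.ren (copy p.2.1.1)) (t.getD 0 .falsum))) (t.getD 1 .falsum)))
      (p.2.2.2.casesOn (motive := fun _ => Fm) .falsum (fun _ _ _ _ => t.getD 0 .falsum)
        (fun _ as φ _ => .disj [.exs (as.map fun x => copy p.2.1.2 x) (.and (φ.ren (copy p.2.1.2))
          (.and (t.getD 0 .falsum) (t.getD 1 .falsum))), t.getD 2 .falsum])))
    (by fun_prop) (by fun_prop) (by fun_prop) ?_ ?_
  · rintro ⟨f, c, e, e'⟩ b hb
    have hlt1 := fun x as φ r => SetExpr.code_lt_consVar x as φ r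
    have hlt2 := fun e as φ r => SetExpr.code_lt_consSet e as φ r
    change b.2.2.1.code + b.2.2.2.code < e.code + e'.code
    cases f with
    | true =>
      cases e with
      | empty => simp at hb
      | consVar x as φ r =>
        have := hlt1 x as φ r
        obtain rfl : b = _ := by simpa using hb
        dsimp only
        omega
      | consSet e as φ r =>
        have := hlt2 e as φ r
        simp only [cond_true, List.mem_cons, List.not_mem_nil, or_false] at hb
        rcases hb with rfl | rfl <;> dsimp only <;> omega
    | false =>
      cases e' with
      | empty => simp at hb
      | consVar x as φ r =>
        have := hlt1 x as φ r
        obtain rfl : b = _ := by simpa using hb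
        dsimp only
        omega
      | consSet e' as φ r =>
        have := hlt2 e' as φ r
        simp only [cond_false, List.mem_cons, List.not_mem_nil, or_false] at hb
        rcases hb with rfl | rfl | rfl <;> dsimp only <;> omega
  · rintro ⟨f, c, e, e'⟩
    cases f with
    | true =>
      cases e <;> dsimp only <;> rw [cmp] <;> rfl
    | false =>
      cases e' <;> dsimp only <;> rw [cmp] <;> rfl

@[fun_prop]
theorem primrec_cmp {f : α → Bool} {g h : α → ℕ} {e e' : α → SetExpr} (hf : Primrec f)
    (hg : Primrec g) (hh : Primrec h) (he : Primrec e) (he' : Primrec e') :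
    Primrec fun a => cmp (f a) (g a) (h a) (e a) (e' a) :=
  primrec_cmp_aux.comp (g := fun a => (f a, (g a, h a), e a, e' a)) (by fun_prop)

@[fun_prop]
theorem primrec_memBody {f g : α → ℕ} {b : α → Body} {e : α → SetExpr}
    (hf : Primrec f) (hg : Primrec g) (hb : Primrec b) (he : Primrec e) :
    Primrec fun a => memBody (f a) (g a) (b a) (e a) := by
  unfold memBody; fun_prop

@[fun_prop]
theorem primrec_pairBody {f g : α → Body} (hf : Primrec f) (hg : Primrec g) :
    Primrec fun a => pairBody (f a) (g a) := by
  unfold pairBody upairBody; fun_prop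

/-! ### Computing the formula for the problem -/

@[fun_prop]
theorem primrec_diag {f : α → SetExpr} (hf : Primrec f) : Primrec fun a => diag (f a) := by
  unfold diag; fun_prop

@[fun_prop]
theorem primrec_prodRel {f g : α → RelExpr} (hf : Primrec f) (hg : Primrec g) :
    Primrec fun a => prodRel (f a) (g a) := by
  unfold prodRel; fun_prop

@[fun_prop]
theorem primrec_powRel {f : α → RelExpr} {g : α → ℕ} (hf : Primrec f) (hg : Primrec g) :
    Primrec fun a => powRel (f a) (g a) := by
  have key : Primrec₂ fun (a : α) (p : ℕ × RelExpr) => prodRel (f a) p.2 :=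
    show Primrec fun q : α × ℕ × RelExpr => prodRel (f q.1) q.2.2 by fun_prop
  refine (Primrec.nat_rec' hg hf key).of_eq fun a => ?_
  induction g a with
  | zero => rfl
  | succ i ih => exact congrArg (prodRel (f a)) ih

@[fun_prop]
theorem primrec_domRel {f : α → RelExpr} (hf : Primrec f) : Primrec fun a => domRel (f a) := by
  unfold domRel; fun_prop

@[fun_prop]
theorem primrec_ranRel {f : α → RelExpr} (hf : Primrec f) : Primrec fun a => ranRel (f a) := by
  unfold ranRel; fun_prop

@[fun_prop]
theorem primrec_graphRel {f : α → RelExpr} (hf : Primrec f) : Primrec fun a => graphRel (f a) := by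
  unfold graphRel; fun_prop

@[fun_prop]
theorem primrec_allRel {f : α → RelExpr} {e e' : α → SetExpr} (hf : Primrec f) (he : Primrec e)
    (he' : Primrec e') : Primrec fun a => allRel (f a) (e a) (e' a) := by
  unfold allRel; fun_prop

@[fun_prop]
theorem primrec_subs {β : Type*} [Primcodable β] {f : α → List β} (hf : Primrec f) :
    Primrec fun a => subs (f a) := by
  unfold subs; fun_prop

@[fun_prop]
theorem primrec_sigFm {f : α → List SetExpr} (hf : Primrec f) : Primrec fun a => sigFm (f a) := by
  unfold sigFm; fun_prop

@[fun_prop]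
theorem primrec_structFm {f g : α → List SetExpr} {d : α → SetExpr} (hf : Primrec f)
    (hd : Primrec d) (hg : Primrec g) : Primrec fun a => structFm (f a) (d a) (g a) := by
  unfold structFm; fun_prop

@[fun_prop]
theorem primrec_isoFm {f g g' : α → List SetExpr} {d d' : α → SetExpr} {h : α → RelExpr}
    (hf : Primrec f) (hd : Primrec d) (hg : Primrec g) (hd' : Primrec d') (hg' : Primrec g')
    (hh : Primrec h) : Primrec fun a => isoFm (f a) (d a) (g a) (d' a) (g' a) (h a) := by
  unfold isoFm; fun_prop

@[fun_prop]
theorem primrec_pieces {d e : α → SetExpr} {χ : α → List Fm} (hd : Primrec d) (he : Primrec e)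
    (hχ : Primrec χ) : Primrec fun a => pieces (d a) (e a) (χ a) := by
  unfold pieces; fun_prop

@[fun_prop]
theorem primrec_problemFm {f g g' : α → List SetExpr} {d d' : α → SetExpr} {χ : α → List Fm}
    (hf : Primrec f) (hd : Primrec d) (hg : Primrec g) (hd' : Primrec d') (hg' : Primrec g')
    (hχ : Primrec χ) : Primrec fun a => problemFm (f a) (d a) (g a) (d' a) (g' a) (χ a) := by
  unfold problemFm; fun_prop

end Expressions

/-! ### Searching for formulas that define the orbits -/

/-- A choice of witnesses for a decidable condition, when there are some, is computable. -/
theorem exists_computable_choice {t : ℕ → ℕ → Bool} (ht : Computable fun p : ℕ × ℕ => t p.1 p.2)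
    (h : ∀ N, ∃ n, t N n = true) : ∃ f : ℕ → ℕ, Computable f ∧ ∀ N, t N (f N) = true := by
  refine ⟨fun N => Nat.find (h N), ?_, fun N => Nat.find_spec (h N)⟩
  have ht' : Partrec₂ fun (N n : ℕ) => (Part.some (t N n) : Part Bool) := ht
  refine (Partrec.rfind ht').of_eq fun N => Part.eq_some_iff.2 (Nat.mem_rfind.2 ⟨?_, fun hm => ?_⟩)
  · exact Part.mem_some_iff.2 (Nat.find_spec (h N)).symm
  · exact Part.mem_some_iff.2 (Bool.eq_false_iff.2 (Nat.find_min (h N) hm)).symm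

/-- The universal closure of a formula with respect to the variables from `N` on (those up to
the Gödel number suffice).  It depends on the variables below `N` only, and is equivalent to
the formula if that one does. -/
def Fm.closeAbove (N : ℕ) (φ : Fm) : Fm :=
  .alls ((List.range (Encodable.encode φ + 1)).map fun i => N + i) φ

/-- A sentence saying that each of the universal closures of the formulas `l` with respect to the
variables from `N` on is satisfiable, and that no two of them are satisfiable together. -/
def partitionFm (N : ℕ) (l : List Fm) : Fm :=
  .and (.conj (l.map fun χ => .exs (List.range N) (χ.closeAbove N)))
    (.conj ((List.range l.length).flatMap fun i => (List.range i).map fun j =>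
      .not (.exs (List.range N) (.and ((l.getD i .falsum).closeAbove N)
        ((l.getD j .falsum).closeAbove N)))))

section Primrec

variable {α : Type*} [Primcodable α]

@[fun_prop]
theorem Fm.primrec_closeAbove {f : α → ℕ} {g : α → Fm} (hf : Primrec f) (hg : Primrec g) :
    Primrec fun a => (g a).closeAbove (f a) := by
  unfold closeAbove; fun_prop

@[fun_prop]
theorem primrec_partitionFm {f : α → ℕ} {g : α → List Fm} (hf : Primrec f) (hg : Primrec g) :
    Primrec fun a => partitionFm (f a) (g a) := by
  unfold partitionFm; fun_prop

end Primrec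

section Semantics

variable {L : FirstOrder.Language.{v, w}} {A : Type u} [L.Structure A] {k : ℕ}
  {s : SymbolNumbering L k}

theorem Fm.dependsBelow_closeAbove (N : ℕ) (φ : Fm) : DependsBelow s A N (φ.closeAbove N) := by
  have key : ∀ v w : ℕ → A, (∀ x < N, v x = w x) → (φ.closeAbove N).Holds s v →
      (φ.closeAbove N).Holds s w := by
    intro v w hvw h
    rw [closeAbove, holds_alls] at h ⊢
    intro w' hw'
    have := h (fun x => if x ≤ φ.code then w' x else v x) fun x hx => ?_
    · exact (holds_congr_code s φ fun x hx => if_pos hx).1 this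
    · split
      · rename_i hxc
        have hxN : x < N := by
          by_contra hge
          refine hx (List.mem_map.2 ⟨x - N, List.mem_range.2 ?_, by omega⟩)
          change x - N < φ.code + 1
          omega
        rw [hw' x hx, hvw x hxN]
      · rfl
  exact fun v w hvw => ⟨key v w hvw, key w v fun x hx => (hvw x hx).symm⟩

theorem DependsBelow.holds_closeAbove {N : ℕ} {φ : Fm} (h : DependsBelow s A N φ) (v : ℕ → A) :
    (φ.closeAbove N).Holds s v ↔ φ.Holds s v := by
  rw [Fm.closeAbove, Fm.holds_alls]
  refine ⟨fun h' => h' v fun _ _ => rfl, fun hv v' hv' => (h v v' fun x hx => ?_).1 hv⟩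
  refine (hv' x fun hmem => ?_).symm
  obtain ⟨i, -, rfl⟩ := List.mem_map.1 hmem
  omega

theorem DependsBelow.holds_exs {N : ℕ} {φ : Fm} (h : DependsBelow s A N φ) (v : ℕ → A) :
    (Fm.exs (List.range N) φ).Holds s v ↔ ∃ w : ℕ → A, φ.Holds s w := by
  rw [Fm.holds_exs]
  refine ⟨fun ⟨w, _, hw⟩ => ⟨w, hw⟩, fun ⟨w, hw⟩ => ⟨fun x => if x < N then w x else v x, ?_, ?_⟩⟩
  · exact fun x hx => if_neg (by simpa using hx)
  · exact (h _ w fun x hx => if_pos hx).2 hw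

theorem DependsBelow.and {N : ℕ} {φ ψ : Fm} (h : DependsBelow s A N φ)
    (h' : DependsBelow s A N ψ) : DependsBelow s A N (.and φ ψ) := fun v w hvw => by
  rw [Fm.holds_and, Fm.holds_and, h v w hvw, h' v w hvw]

theorem holds_partitionFm (N : ℕ) (l : List Fm) (v : ℕ → A) :
    (partitionFm N l).Holds s v ↔ (∀ χ ∈ l, ∃ w : ℕ → A, (χ.closeAbove N).Holds s w) ∧
      ∀ i j, i < l.length → j < i → ∀ w : ℕ → A,
        ((l.getD i .falsum).closeAbove N).Holds s w →
          ¬ ((l.getD j .falsum).closeAbove N).Holds s w := by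
  rw [partitionFm, Fm.holds_and, Fm.holds_conj, Fm.holds_conj]
  simp only [List.mem_map, List.mem_flatMap, List.mem_range, forall_exists_index, and_imp,
    forall_apply_eq_imp_iff₂]
  have hclose : ∀ {χ : Fm}, DependsBelow s A N (χ.closeAbove N) := fun {χ} =>
    χ.dependsBelow_closeAbove N
  refine and_congr ?_ ?_
  · exact forall₂_congr fun χ _ => hclose.holds_exs v
  · constructor
    · intro h i j hi hj w h1 h2
      refine h _ i hi j hj rfl ?_
      rw [(DependsBelow.and hclose hclose).holds_exs]
      exact ⟨w, (Fm.holds_and s _ _ _).2 ⟨h1, h2⟩⟩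
    · rintro h _ i hi j hj rfl h'
      rw [(DependsBelow.and hclose hclose).holds_exs] at h'
      obtain ⟨w, hw⟩ := h'
      rw [Fm.holds_and] at hw
      exact h i j hi hj w hw.1 hw.2

/-- As many formulas as there are orbits, if they are satisfiable and pairwise disjoint, define the
orbits: each orbit meets, and so contains, exactly one of the sets defined by them. -/
theorem definesOrbits_of_partition {N : ℕ} {l : List Fm}
    [Finite (Quotient (orbitSetoid L A N))]
    (hcard : l.length = Nat.card (Quotient (orbitSetoid L A N))) {v₀ : ℕ → A}
    (h : (partitionFm N l).Holds s v₀) : DefinesOrbits L A s N (l.map (Fm.closeAbove N)) := by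
  rw [holds_partitionFm] at h
  obtain ⟨hsat, hdisj⟩ := h
  let χ : Fin l.length → Fm := fun i => (l.get i).closeAbove N
  have hχ : ∀ i, ∃ w : ℕ → A, (χ i).Holds s w := fun i => hsat _ (List.get_mem _ _)
  choose w hw using hχ
  have hlt : ∀ i j : Fin l.length, j < i → ∀ v : ℕ → A, (χ i).Holds s v → ¬ (χ j).Holds s v := by
    intro i j hij v hi hj
    refine hdisj i j i.2 hij v ?_ ?_
    · rwa [List.getD_eq_getElem _ _ i.2]
    · rwa [List.getD_eq_getElem _ _ j.2]
  have huniq : ∀ (i j : Fin l.length) (v : ℕ → A), (χ i).Holds s v → (χ j).Holds s v → i = j := by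
    intro i j v hi hj
    rcases lt_trichotomy i j with hij | hij | hij
    · exact absurd hi (hlt j i hij v hj)
    · exact hij
    · exact absurd hj (hlt i j hij v hi)
  have horb : ∀ (i : Fin l.length) (π : A ≃[L] A) (v v' : ℕ → A), (∀ x < N, π (v x) = v' x) →
      ((χ i).Holds s v ↔ (χ i).Holds s v') := by
    intro i π v v' hπ
    rw [← Fm.holds_equiv s π (χ i) v]
    exact Fm.dependsBelow_closeAbove N _ _ _ hπ
  let orb : (ℕ → A) → Quotient (orbitSetoid L A N) := fun v => Quotient.mk _ fun x => v x
  have horb_eq : ∀ v v' : ℕ → A, orb v = orb v' → ∃ π : A ≃[L] A, ∀ x < N, π (v x) = v' x := by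
    intro v v' hvv
    obtain ⟨π, hπ⟩ : (orbitSetoid L A N).r _ _ := Quotient.exact hvv
    exact ⟨π, fun x hx => hπ ⟨x, hx⟩⟩
  have hinj : Function.Injective fun i => orb (w i) := by
    intro i j hij
    obtain ⟨π, hπ⟩ := horb_eq _ _ hij
    exact huniq i j (w j) ((horb i π _ _ hπ).1 (hw i)) (hw j)
  have hsurj : Function.Surjective fun i => orb (w i) :=
    ((Nat.bijective_iff_injective_and_card _).2 ⟨hinj, by rw [Nat.card_fin, hcard]⟩).2
  refine ⟨?_, fun v => ?_⟩
  · intro θ hθ v v' hv hv'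
    obtain ⟨θ', hmem, rfl⟩ := List.mem_map.1 hθ
    obtain ⟨i, rfl⟩ := List.get_of_mem hmem
    have key : ∀ v : ℕ → A, (χ i).Holds s v → orb v = orb (w i) := by
      intro v hv
      obtain ⟨j, hj⟩ := hsurj (orb v)
      obtain ⟨π, hπ⟩ := horb_eq _ _ hj
      rw [huniq i j v hv ((horb j π _ _ hπ).1 (hw j))]
      exact hj.symm
    exact horb_eq _ _ ((key v hv).trans (key v' hv').symm)
  · obtain ⟨j, hj⟩ := hsurj (orb v)
    obtain ⟨π, hπ⟩ := horb_eq _ _ hj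
    exact ⟨χ j, List.mem_map_of_mem (List.get_mem _ _), (horb j π _ _ hπ).1 (hw j)⟩

/-- Formulas isolating the types of tuples from the different orbits form a partition. -/
theorem exists_partition [L.IsRelational] [Countable A] [Nonempty A]
    (hfin : ∀ n, Finite (Quotient (orbitSetoid L A n))) (N : ℕ) (v₀ : ℕ → A) :
    ∃ l : List Fm, l.length = Nat.card (Quotient (orbitSetoid L A N)) ∧
      (partitionFm N l).Holds s v₀ := by
  have := hfin N
  let ι := Finite.equivFin (Quotient (orbitSetoid L A N))
  let rep : Quotient (orbitSetoid L A N) → ℕ → A := fun q x =>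
    if h : x < N then q.out ⟨x, h⟩ else v₀ 0
  have hrep : ∀ q q', (∃ π : A ≃[L] A, ∀ x < N, π (rep q x) = rep q' x) → q = q' := by
    rintro q q' ⟨π, hπ⟩
    rw [← q.out_eq, ← q'.out_eq]
    refine Quotient.sound ⟨π, fun i => ?_⟩
    simpa [rep] using hπ i i.2
  choose θ h1 h2 h3 using fun q => exists_isolating (s := s) N (rep q)
  refine ⟨List.ofFn fun i => θ (ι.symm i), List.length_ofFn, ?_⟩
  rw [holds_partitionFm]
  refine ⟨fun χ hχ => ?_, fun i j hi hj v hvi hvj => ?_⟩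
  · obtain ⟨i, rfl⟩ := List.mem_ofFn.1 hχ
    exact ⟨_, ((h1 _).holds_closeAbove _).2 (h2 _)⟩
  · rw [List.getD_eq_getElem _ _ hi, List.getElem_ofFn, (h1 _).holds_closeAbove] at hvi
    rw [List.getD_eq_getElem _ _ (hj.trans hi), List.getElem_ofFn, (h1 _).holds_closeAbove] at hvj
    have htype : SameType s N (rep (ι.symm ⟨i, by simpa using hi⟩))
        (rep (ι.symm ⟨j, by simpa using hj.trans hi⟩)) := fun φ hφ =>
      (h3 _ v hvi φ hφ).trans (h3 _ v hvj φ hφ).symm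
    have := ι.symm.injective (hrep _ _ (htype.exists_equiv hfin))
    simp only [Fin.mk.injEq] at this
    omega

end Semantics

/-! ### Valuations with copies of the parameters -/

/-- The variable of which `x` is an iterated copy: every index ends up in the copy `0` of a unique
variable after finitely many removals of the copies `1` and `2`. -/
def root (x : ℕ) : ℕ := if x % 3 = 0 then x / 3 else root (x / 3)
decreasing_by omega

theorem root_copy_zero (x : ℕ) : root (copy 0 x) = x := by
  rw [root, copy, if_pos (by omega)]
  omega

theorem root_copy {c : ℕ} (h0 : c ≠ 0) (hc : c < 3) (x : ℕ) : root (copy c x) = root x := by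
  rw [root, copy, if_neg (by omega)]
  congr 1
  omega

theorem primrec_root_aux : Primrec root := by
  refine primrec_of_recursive _ (m := id) (l := fun x => if x % 3 = 0 then [] else [x / 3])
    (g := fun x t => if x % 3 = 0 then x / 3 else t.getD 0 0) (by fun_prop) (by fun_prop)
    (by fun_prop) ?_ ?_
  · intro x y hy
    split at hy
    · simp at hy
    · obtain rfl : y = x / 3 := by simpa using hy
      simp only [id]
      omega
  · intro x
    rw [root]
    split <;> rfl

@[fun_prop]
theorem primrec_root {α : Type*} [Primcodable α] {f : α → ℕ} (hf : Primrec f) :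
    Primrec fun a => root (f a) := primrec_root_aux.comp hf

theorem stable_comp_root {A : Type u} (v : ℕ → A) : Stable (v ∘ root) :=
  ⟨funext fun x => congrArg v (root_copy (by omega) (by omega) x),
    funext fun x => congrArg v (root_copy (by omega) (by omega) x)⟩

theorem comp_root_comp_copy_zero {A : Type u} (v : ℕ → A) : (v ∘ root) ∘ copy 0 = v :=
  funext fun x => congrArg v (root_copy_zero x)

/-! ### The decision procedure -/

section Decision

variable {L : FirstOrder.Language.{v, w}} {A : Type u} [L.Structure A] {k : ℕ}
  {s : SymbolNumbering L k} {enc : List Bool → A}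

/-- Satisfaction is decidable also under the valuations that give the value of a variable to all
its copies. -/
theorem exists_computable_holds_root
    (h : ComputablePred fun q : Fm × List (List Bool) => q.1.Holds s (valuation enc q.2)) :
    ∃ o : Fm × List (List Bool) → Bool, Computable o ∧
      ∀ φ p, o (φ, p) = true ↔ φ.Holds s (valuation enc p ∘ root) := by
  obtain ⟨_, ho⟩ := h
  have hred : Primrec fun q : Fm × List (List Bool) => (q.1,
      (List.range (Encodable.encode q.1 + 1)).map fun i => q.2.getD (root i) []) := by fun_prop
  refine ⟨_, ho.comp hred.to_comp, fun φ p => ?_⟩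
  rw [decide_eq_true_iff]
  refine Fm.holds_congr_code s φ fun x hx => ?_
  have hx' : x < Encodable.encode φ + 1 := Nat.lt_succ_of_le hx
  simp [valuation, hx']

/-- Formulas defining the orbits of `N`-tuples can be computed from `N`. -/
theorem exists_computable_definesOrbits [L.IsRelational] [Countable A] [Nonempty A]
    (hfin : ∀ n, Finite (Quotient (orbitSetoid L A n)))
    {o : Fm × List (List Bool) → Bool} (ho : Computable o)
    (hho : ∀ φ p, o (φ, p) = true ↔ φ.Holds s (valuation enc p ∘ root)) {r : ℕ → ℕ}
    (hr : Computable r) (hcard : ∀ n, Nat.card (Quotient (orbitSetoid L A n)) = r n) :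
    ∃ f : ℕ → List Fm, Computable f ∧ ∀ N, DefinesOrbits L A s N (f N) := by
  let t : ℕ → ℕ → Bool := fun N n => ((Denumerable.ofNat (List Fm) n).length == r N) &&
    o (partitionFm N (Denumerable.ofNat (List Fm) n), [])
  have ht : Computable fun p : ℕ × ℕ => t p.1 p.2 := by
    have h1 : Primrec fun p : ℕ × ℕ => (Denumerable.ofNat (List Fm) p.2).length := by fun_prop
    have h2 : Primrec fun p : ℕ × ℕ =>
      (partitionFm p.1 (Denumerable.ofNat (List Fm) p.2), ([] : List (List Bool))) := by fun_prop
    exact Primrec.and.to_comp.comp (Primrec.beq.to_comp.comp h1.to_comp (hr.comp Computable.fst))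
      (ho.comp h2.to_comp)
  have htest : ∀ N n, t N n = true ↔
      (Denumerable.ofNat (List Fm) n).length = Nat.card (Quotient (orbitSetoid L A N)) ∧
        (partitionFm N (Denumerable.ofNat (List Fm) n)).Holds s (valuation enc [] ∘ root) := by
    intro N n
    rw [Bool.and_eq_true, beq_iff_eq, hho, hcard]
  obtain ⟨f, hf, hf'⟩ := exists_computable_choice ht fun N => by
    obtain ⟨l, h⟩ := exists_partition (s := s) hfin N (valuation enc [] ∘ root)
    exact ⟨Encodable.encode l, (htest _ _).2 (by rwa [Denumerable.ofNat_encode])⟩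
  have hclose : Primrec fun p : ℕ × ℕ =>
      (Denumerable.ofNat (List Fm) p.2).map (Fm.closeAbove p.1) := by fun_prop
  refine ⟨_, hclose.to_comp.comp (Computable.id.pair hf), fun N => ?_⟩
  have := hfin N
  obtain ⟨h1, h2⟩ := (htest _ _).1 (hf' N)
  exact definesOrbits_of_partition h1 h2

end Decision

end DefinableSets

open DefinableSets in
theorem theorem3p3 {L : FirstOrder.Language.{v, w}} [L.IsRelational] {A : Type u} [L.Structure A]
    {k : ℕ} (s : SymbolNumbering L k) (enc : List Bool → A) (henc : Function.Surjective enc)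
    (heff : IsEffectivelyOmegaCategorical L A s enc) (hdense : IsDense L A)
    (hsupp : HasLeastSupports L A s) :
    ComputablePred fun q : Input => q.IsValid s enc ∧ q.DefinablyIsomorphic s enc := by
  classical
  have : Countable A := henc.countable
  have : Nonempty A := ⟨enc []⟩
  obtain ⟨r, hr, hcard⟩ := heff.computable
  have hfin : ∀ n, Finite (Quotient (orbitSetoid L A n)) := fun n => by
    rw [← ENat.card_lt_top, hcard]
    exact ENat.natCast_lt_top _
  obtain ⟨o, ho, hho⟩ := exists_computable_holds_root heff.decidable
  obtain ⟨f, hf, hf'⟩ := exists_computable_definesOrbits hfin ho hho hr fun n => by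
    rw [Nat.card, ← ENat.toNat_natCast (r n), ← hcard]
    rfl
  -- The number of variables that matter: it exceeds the indices, in any copy, of all variables of
  -- the input.
  let N : Input → ℕ := fun q => 3 * (Encodable.encode q.2.1 + Encodable.encode q.2.2.1.1 +
    Encodable.encode q.2.2.1.2 + Encodable.encode q.2.2.2.1 + Encodable.encode q.2.2.2.2 +
    Encodable.encode (q.2.2.1.1.ren (copy 0)) + Encodable.encode (q.2.2.2.1.ren (copy 0))) + 3
  let F : Input × List Fm → Fm := fun q => problemFm (q.1.2.1.map (SetExpr.ren (copy 0)))
    (q.1.2.2.1.1.ren (copy 0)) (q.1.2.2.1.2.map (SetExpr.ren (copy 0)))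
    (q.1.2.2.2.1.ren (copy 0)) (q.1.2.2.2.2.map (SetExpr.ren (copy 0))) q.2
  have hN : Primrec N := by fun_prop
  have hF : Primrec F := by fun_prop
  have hdec : Computable fun q : Input => o (F (q, f (N q)), q.1) :=
    ho.comp ((hF.to_comp.comp (Computable.id.pair (hf.comp hN.to_comp))).pair Computable.fst)
  refine ComputablePred.computable_iff.2 ⟨_, hdec, funext fun q => propext ?_⟩
  obtain ⟨p, sg, ⟨d, is⟩, e, js⟩ := q
  rw [hho]
  -- The variables of the input are replaced by their copies `0`, so that the copies `1` and `2` can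
  -- be given the same values without changing the meaning of the input.
  have hv := stable_comp_root (valuation enc p)
  have heval : ∀ t : SetExpr, (t.ren (copy 0)).eval s (valuation enc p ∘ root) =
      t.eval s (valuation enc p) := fun t => by
    rw [SetExpr.eval_ren s (copy_injective 0), comp_root_comp_copy_zero]
  set M := Encodable.encode sg + Encodable.encode d + Encodable.encode is + Encodable.encode e +
    Encodable.encode js with hM
  have hNM : N (p, sg, (d, is), (e, js)) =
      3 * (M + (d.ren (copy 0)).code + (e.ren (copy 0)).code) + 3 := rfl
  have hsuppM : ∀ t : SetExpr, t.code ≤ M →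
      Supports L ((Finset.range (M + 1)).image (valuation enc p))
        ((t.ren (copy 0)).eval s (valuation enc p ∘ root)) := by
    intro t ht π hπ
    rw [heval, SetExpr.rename_eval]
    exact SetExpr.eval_congr_code s t fun x hx =>
      hπ _ (Finset.mem_image_of_mem _ (Finset.mem_range.2 (by omega)))
  have hlist : ∀ (l : List SetExpr), Encodable.encode l ≤ M →
      ∀ t ∈ l.map (SetExpr.ren (copy 0)),
      Supports L ((Finset.range (M + 1)).image (valuation enc p))
        (t.eval s (valuation enc p ∘ root)) := by
    intro l hl t ht
    obtain ⟨t', ht', rfl⟩ := List.mem_map.1 ht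
    exact hsuppM t' ((encode_lt_encode_of_mem ht').le.trans hl)
  have hd : d.code ≤ M := show Encodable.encode d ≤ M by omega
  have he : e.code ≤ M := show Encodable.encode e ≤ M by omega
  have main := holds_problemFm hfin hdense hsupp hv (hf' (N (p, sg, (d, is), (e, js))))
    (sg := sg.map (SetExpr.ren (copy 0))) (d := d.ren (copy 0))
    (is := is.map (SetExpr.ren (copy 0))) (e := e.ren (copy 0))
    (js := js.map (SetExpr.ren (copy 0))) (by omega) (by omega)
    (T := (Finset.range (M + 1)).image (valuation enc p)) (fun a ha => by
      obtain ⟨x, hx, rfl⟩ := Finset.mem_image.1 ha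
      rw [Finset.mem_range] at hx
      exact ⟨copy 0 x, by simp only [copy]; omega, by simp only [copy]; omega,
        congrFun (comp_root_comp_copy_zero (valuation enc p)) x⟩)
    (by
      rintro t (ht | rfl | ht | rfl | ht)
      · exact hlist sg (by omega) t ht
      · exact hsuppM d hd
      · exact hlist is (by omega) t ht
      · exact hsuppM e he
      · exact hlist js (by omega) t ht)
  have hmap : ∀ l : List SetExpr, ((l.map (SetExpr.ren (copy 0))).map fun t =>
      t.eval s (valuation enc p ∘ root)) = l.map fun t => t.eval s (valuation enc p) := fun l => by
    rw [List.map_map]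
    exact List.map_congr_left fun t _ => heval t
  simp only [hmap, heval] at main
  exact main.symm
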